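/- **Setting.** Let $X, A$ be finite sets and let $G=(X^2,A^2,\mu,V)$ be a synchronous game: $\mu$ is a probability distribution on $X\times X$, and $V:X^2\times A^2\to\{0,1\}$ satisfies $V(x,x,a,b)=1$ if and only if $a=b$. A POVM is a family of positive operators $(E_a)_{a\in A}$ with $\sum_a E_a=1$; it is a PVM if moreover $E_a^2=E_a$ for all $a$. Let $(\mathscr A,\tau)$ be a von Neumann algebra with a faithful normal tracial state, in its standard form: $\mathscr A$ acts on $L^2(\mathscr A,\tau)$ with cyclic and separating unit vector $|\tau\rangle$, $\tau(a)=\langle\tau|a|\tau\rangle$. For $a\in\mathscr A$, $a^{op}\in\mathscr A'$ denotes the operator $s|\tau\rangle\mapsto sa|\tau\rangle$ $(s\in\mathscr A)$. A tracial embedded strategy on $(\mathscr A,\tau)$ consists of $\sigma\in\mathscr A$ such that $\sigma|\tau\rangle$ is a unit vector and, for each $x\in X$, of POVMs $\{A^x_a\}_{a\in A}\subseteq\mathscr A$ and $\{\tilde B^x_b\}_{b\in A}\subseteq\mathscr A'$. Its correlation is $C_{x,y,a,b}=\langle\tau|\sigma^*A^x_a\tilde B^y_b\sigma|\tau\rangle$.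 It is symmetric if $\tilde B^x_a=(A^x_a)^{op}$ for all $x,a$, and projective if all its POVMs are PVMs. Call it $\delta$-synchronous if $$\mathbb E_{x\sim\mu_1}\sum_{a\ne b}C_{x,x,a,b}\le\delta\quad\text{and}\quad \mathbb E_{x\sim\mu_2}\sum_{a\ne b}C_{x,x,a,b}\le\delta,$$ where $\mu_1,\mu_2$ are the two marginals of $\mu$ on $X$ (the two conditions are the same if $\mu_1=\mu_2$, for example if $\mu$ is symmetric). **Statement.** There is a universal constant $K$ such that the following holds for every $G$, every $(\mathscr A,\tau)$ and every $\delta$. Let $(\sigma|\tau\rangle,\{A^x_a\},\{\tilde B^y_b\})$ be a $\delta$-synchronous tracial embedded strategy on $(\mathscr A,\tau)$, and let $\sigma=u\sigma^+$ be the polar decomposition of $\sigma$ ($\sigma^+\in\mathscr A$ positive, $u\in\mathscr A$ a partial isometry, $\ker u=\ker\sigma^+$). Then there are PVMs $\{P^x_a\}_{a\in A}\subseteq\mathscr A$ $(x\in X)$ such that the symmetric, projective strategy $(\sigma^+|\tau\rangle,\{P^x_a\},\{(P^y_b)^{op}\})$ is $\delta^{1/4}$-synchronous and $$\mathbb E_{(x,y)\sim\mu}\sum_{a,b\in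 A}\bigl|\langle\tau|\sigma^*A^x_a\tilde B^y_b\,\sigma|\tau\rangle-\langle\tau|\sigma^+P^x_a(P^y_b)^{op}\sigma^+|\tau\rangle\bigr|\le K\,\delta^{1/4}.$$ -/

import Mathlib

/-- A two-player synchronous nonlocal game with finite question set `X` and finite answer set `A`:
a probability distribution `μ` on `X × X` and a `{0,1}`-valued evaluation `V` that, on a repeated
question, accepts exactly the equal answers. -/
structure SynchronousGame (X A : Type*) [Fintype X] where
  μ : X → X → ℝ
  μ_nonneg : ∀ x y, 0 ≤ μ x y
  μ_sum : ∑ x, ∑ y, μ x y = 1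
  V : X → X → A → A → Bool
  V_diag : ∀ x a b, V x x a b = true ↔ a = b

/-- Marginal distribution of Alice's question. -/
def SynchronousGame.marginalFst {X A : Type*} [Fintype X] (G : SynchronousGame X A) (x : X) : ℝ :=
  ∑ y, G.μ x y

/-- Marginal distribution of Bob's question. -/
def SynchronousGame.marginalSnd {X A : Type*} [Fintype X] (G : SynchronousGame X A) (y : X) : ℝ :=
  ∑ x, G.μ x y

section Operators

variable {H : Type*} [NormedAddCommGroup H] [InnerProductSpace ℂ H] [CompleteSpace H]

/-- A positive operator-valued measure with outcome set `A`. -/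
structure IsPOVM {A : Type*} [Fintype A] (E : A → H →L[ℂ] H) : Prop where
  isPositive : ∀ a, (E a).IsPositive
  sum_eq_one : ∑ a, E a = 1

/-- A projection-valued measure: a POVM all of whose elements are idempotent. -/
structure IsPVM {A : Type*} [Fintype A] (E : A → H →L[ℂ] H) : Prop extends IsPOVM E where
  idempotent : ∀ a, E a * E a = E a

/-- `σ = u * σp` is the polar decomposition of the operator `σ` inside the von Neumann
algebra `M`: `σp` is positive and `u` is a partial isometry whose kernel is that of `σp`
(this kernel condition is what makes the decomposition unique). -/
structure IsPolarDecomposition (M : VonNeumannAlgebra H) (σ u σp : H →L[ℂ] H) : Prop where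
  mem_partialIsometry : u ∈ M
  mem_positive : σp ∈ M
  isPositive : σp.IsPositive
  partialIsometry : u * star u * u = u
  ker_eq : ∀ ξ, u ξ = 0 ↔ σp ξ = 0
  eq_mul : σ = u * σp

end Operators

/-- A commuting operator strategy on the Hilbert space `H`. -/
structure CommutingStrategy (X A : Type*) [Fintype A] (H : Type*) [NormedAddCommGroup H]
    [InnerProductSpace ℂ H] [CompleteSpace H] where
  ψ : H
  norm_ψ : ‖ψ‖ = 1
  alice : X → A → H →L[ℂ] H
  bob : X → A → H →L[ℂ] H
  alice_povm : ∀ x, IsPOVM (alice x)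
  bob_povm : ∀ y, IsPOVM (bob y)
  commute : ∀ x y a b, Commute (alice x a) (bob y b)

/-- The correlation `C x y a b = ⟨ψ| A^x_a B^y_b |ψ⟩`. The inner product is a nonnegative real,
`A^x_a` and `B^y_b` being commuting positive operators; we read it as a real number. -/
noncomputable def CommutingStrategy.corr {X A : Type*} [Fintype A] {H : Type*}
    [NormedAddCommGroup H] [InnerProductSpace ℂ H] [CompleteSpace H]
    (S : CommutingStrategy X A H) (x y : X) (a b : A) : ℝ :=
  (inner ℂ S.ψ ((S.alice x a * S.bob y b) S.ψ)).re

/-- A strategy is projective if both players use projection-valued measures. -/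
def CommutingStrategy.IsProjective {X A : Type*} [Fintype A] {H : Type*}
    [NormedAddCommGroup H] [InnerProductSpace ℂ H] [CompleteSpace H]
    (S : CommutingStrategy X A H) : Prop :=
  (∀ x, IsPVM (S.alice x)) ∧ ∀ y, IsPVM (S.bob y)

/-- Synchronicity of a correlation with respect to a weight `ν` on the questions:
`E_{x ∼ ν} ∑_{a ≠ b} C x x a b`. -/
def synchronicity {X A : Type*} [Fintype X] [Fintype A] [DecidableEq A] (ν : X → ℝ)
    (C : X → X → A → A → ℝ) : ℝ :=
  ∑ x, ν x * ∑ a, ∑ b, if a = b then 0 else C x x a b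

/-- A strategy is `δ`-synchronous for `G`: its answers to a repeated question, drawn from the
marginal of Alice's question, differ with probability at most `δ`. -/
def CommutingStrategy.IsSynchronous {X A : Type*} [Fintype X] [Fintype A]
    [DecidableEq A] {H : Type*} [NormedAddCommGroup H] [InnerProductSpace ℂ H] [CompleteSpace H]
    (S : CommutingStrategy X A H) (G : SynchronousGame X A) (δ : ℝ) : Prop :=
  synchronicity G.marginalFst S.corr ≤ δ

/-- The same condition with the repeated question drawn from the marginal of Bob's question.
It coincides with `IsSynchronous` when the two marginals agree. -/
def CommutingStrategy.IsSynchronousSnd {X A : Type*} [Fintype X] [Fintype A]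
    [DecidableEq A] {H : Type*} [NormedAddCommGroup H] [InnerProductSpace ℂ H] [CompleteSpace H]
    (S : CommutingStrategy X A H) (G : SynchronousGame X A) (δ : ℝ) : Prop :=
  synchronicity G.marginalSnd S.corr ≤ δ

/-- A tracial von Neumann algebra `(M, τ)` in standard form: `M` acts on `H = L²(M, τ)`, the unit
vector `Ω = |τ⟩` is cyclic for `M`, and the (automatically normal) vector state
`τ a = ⟨Ω, a Ω⟩` is a trace on `M`, faithful because `Ω` is separating
(`τ (a* a) = ‖a Ω‖²`). So `H` with `Ω` is the GNS representation of `τ`. -/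
structure TracialStandardForm (H : Type*) [NormedAddCommGroup H] [InnerProductSpace ℂ H]
    [CompleteSpace H] where
  M : VonNeumannAlgebra H
  Ω : H
  norm_Ω : ‖Ω‖ = 1
  cyclic : Dense {ξ : H | ∃ a ∈ M, ξ = a Ω}
  separating : ∀ a ∈ M, a Ω = 0 → a = 0
  tracial : ∀ a ∈ M, ∀ b ∈ M, inner ℂ Ω ((a * b) Ω) = inner ℂ Ω ((b * a) Ω)

section TracialEmbedded

variable {H : Type*} [NormedAddCommGroup H] [InnerProductSpace ℂ H] [CompleteSpace H]

/-- `b = a^op`, the operator of right multiplication by `a` on `L²(M, τ)`: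
`a^op (s |τ⟩) = (s a) |τ⟩` for all `s ∈ M`. It is determined by `a` because `|τ⟩` is cyclic. -/
def TracialStandardForm.IsOpposite (T : TracialStandardForm H) (a b : H →L[ℂ] H) : Prop :=
  ∀ s ∈ T.M, b (s T.Ω) = (s * a) T.Ω

/-- `S` is a tracial embedded strategy on `(M, τ)` with state `σ |τ⟩`. -/
structure CommutingStrategy.IsTracialEmbedded {X A : Type*} [Fintype A]
    (S : CommutingStrategy X A H) (T : TracialStandardForm H) (σ : H →L[ℂ] H) : Prop where
  σ_mem : σ ∈ T.M
  ψ_eq : S.ψ = σ T.Ω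
  alice_mem : ∀ x a, S.alice x a ∈ T.M
  bob_mem : ∀ y b, S.bob y b ∈ T.M.commutant

/-- A strategy on `(M, τ)` is symmetric if Bob's operators are the opposites of Alice's. -/
def CommutingStrategy.IsSymmetric {X A : Type*} [Fintype A] (S : CommutingStrategy X A H)
    (T : TracialStandardForm H) : Prop :=
  ∀ x a, T.IsOpposite (S.alice x a) (S.bob x a)

end TracialEmbedded

set_option linter.unusedSectionVars false

namespace TracialRounding

variable {H : Type*} [NormedAddCommGroup H] [InnerProductSpace ℂ H] [CompleteSpace H]

/-! Write ψ = σ⁺|τ⟩. Compressing Alice's POVMs by the partial isometry u, and giving the leftover 1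
- u*u to one outcome, changes no correlation (`vecState_compress`), so σ may be taken positive.

Fix a question with defect d = 1 - ∑⟨ψ, E_a B_a ψ⟩. Cauchy-Schwarz for the form τ(aσbσ)
(`re_inner_mul_le`) gives ∑ τ(E_a σ E_a σ) ≥ 1 - 2d. This single inequality says both that E almost
commutes with σ, ∑‖[E_a, σ]Ω‖² ≤ 4d, and that E is almost projective in the state ψ.

If E commuted with σ exactly, ψ would be a tracial vector for the elements of M commuting with σ. In
a tracial state an almost projective POVM can be orthogonalized at linear cost
(`IsTracialVector.exists_isPVM`): round each E_a to its spectral projection above 1/2, shrink these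
projections to an independent family, and take the polar part of the family, whose components have
mutually orthogonal supports.

In general (`IsTracialVector.exists_isPVM_of_almost_commute`) the spectrum of σ is cut into cells of
dyadic size, E is pinched to the cells, and σ is replaced by an operator w ≥ σ that is constant on
each cell. Then w commutes with the pinched POVM, and wΩ is tracial where the orthogonalization
takes place. Choosing each cut point to minimize the weight it separates bounds the pinching loss by
a multiple of ∑‖f_l E_a f_k Ω‖²·|λ_k² - λ_l²|, where f_l are the spectral projections and λ_l the
levels. This is controlled by the commutator times the anticommutator with σ, hence by √d.

The resulting PVM P is close in ψ to E, to its own opposite and to B, with squared error O(√d + d).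
Passing to ℓ¹ distance of correlations (`sum_abs_vecState_sub_mul_le`) takes a further square root,
and concavity of the root averages over questions: δ^(1/4). Synchronicity of the new strategy is
O(√δ), below δ^(1/4) once δ is small; for larger δ a deterministic strategy suffices. -/

theorem inner_star_left (T : H →L[ℂ] H) (x y : H) :
    inner ℂ (star T x) y = inner ℂ x (T y) := by
  rw [ContinuousLinearMap.star_eq_adjoint, ContinuousLinearMap.adjoint_inner_left]

theorem inner_star_right (T : H →L[ℂ] H) (x y : H) :
    inner ℂ x (star T y) = inner ℂ (T x) y := by
  rw [ContinuousLinearMap.star_eq_adjoint, ContinuousLinearMap.adjoint_inner_right]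

theorem inner_selfAdjoint {T : H →L[ℂ] H} (hT : star T = T) (x y : H) :
    inner ℂ (T x) y = inner ℂ x (T y) := by
  conv_lhs => rw [← hT]
  exact inner_star_left T x y

/-! ### Operators inside a von Neumann algebra: roots, kernels, factorization, spectral cuts -/

/-- The double commutant theorem. Since the commutant is closed under adjoints, `star c` comes for
free; kernel projections need it. -/
theorem mem_of_commute (N : VonNeumannAlgebra H) {x : H →L[ℂ] H}
    (h : ∀ c ∈ N.commutant, star c ∈ N.commutant → Commute c x) : x ∈ N := by
  rw [← N.commutant_commutant, VonNeumannAlgebra.mem_commutant_iff]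
  exact fun c hc => h c hc (star_mem hc)

theorem commute_of_mem_commutant {N : VonNeumannAlgebra H} {c x : H →L[ℂ] H}
    (hc : c ∈ N.commutant) (hx : x ∈ N) : Commute c x :=
  ((VonNeumannAlgebra.mem_commutant_iff.1 hc) x hx).symm

theorem smul_mem_vonNeumann (N : VonNeumannAlgebra H) (z : ℂ) {x : H →L[ℂ] H} (hx : x ∈ N) :
    z • x ∈ N :=
  N.toStarSubalgebra.smul_mem hx z

/-- The root is a function of `T`, so whatever commutes with `T` commutes with it; this clause keeps
the root in any von Neumann algebra containing `T`. -/
theorem exists_sqrt {T : H →L[ℂ] H} (hT : T.IsPositive) :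
    ∃ R : H →L[ℂ] H, R.IsPositive ∧ R * R = T ∧ ∀ c, Commute c T → Commute c R := by
  have h0 : 0 ≤ T := (ContinuousLinearMap.nonneg_iff_isPositive T).2 hT
  refine ⟨CFC.sqrt T, (ContinuousLinearMap.nonneg_iff_isPositive _).1 (CFC.sqrt_nonneg T),
    CFC.sqrt_mul_sqrt_self T h0, fun c hc => ?_⟩
  rw [CFC.sqrt_eq_real_sqrt T h0]
  exact (hc.symm.cfcₙ_real _).symm

theorem IsPositive.star_eq {T : H →L[ℂ] H} (hT : T.IsPositive) : star T = T :=
  hT.isSelfAdjoint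

/-- The orthogonal projection onto the kernel. -/
noncomputable def kerProj (T : H →L[ℂ] H) : H →L[ℂ] H :=
  (LinearMap.ker (T : H →ₗ[ℂ] H)).starProjection

theorem isStarProjection_kerProj (T : H →L[ℂ] H) : IsStarProjection (kerProj T) :=
  isStarProjection_starProjection

theorem kerProj_apply_eq_self_iff {T : H →L[ℂ] H} {x : H} : kerProj T x = x ↔ T x = 0 := by
  rw [kerProj, Submodule.starProjection_eq_self_iff]
  exact LinearMap.mem_ker

theorem apply_kerProj (T : H →L[ℂ] H) (x : H) : T (kerProj T x) = 0 := by
  rw [← kerProj_apply_eq_self_iff]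
  exact congr($((isStarProjection_kerProj T).isIdempotentElem.eq) x)

theorem mul_kerProj (T : H →L[ℂ] H) : T * kerProj T = 0 := by
  ext x; exact apply_kerProj T x

theorem kerProj_mul_of_isSelfAdjoint {T : H →L[ℂ] H} (hT : star T = T) : kerProj T * T = 0 := by
  have h := congrArg star (mul_kerProj T)
  rwa [star_mul, hT, (isStarProjection_kerProj T).isSelfAdjoint.star_eq, star_zero] at h

/-- Both `c` and `star c` preserve the kernel of `T`, so the kernel is a reducing subspace for `c`.
-/
theorem Commute.kerProj {c T : H →L[ℂ] H} (h : Commute c T) (h' : Commute (star c) T) :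
    Commute c (kerProj T) := by
  have key : ∀ d : H →L[ℂ] H, Commute d T → TracialRounding.kerProj T * (d * TracialRounding.kerProj T)
      = d * TracialRounding.kerProj T := by
    intro d hd
    ext x
    change TracialRounding.kerProj T (d (TracialRounding.kerProj T x)) = d (TracialRounding.kerProj T x)
    rw [kerProj_apply_eq_self_iff]
    have : T (d (TracialRounding.kerProj T x)) = d (T (TracialRounding.kerProj T x)) :=
      congr($(hd.symm.eq) (TracialRounding.kerProj T x))
    rw [this, apply_kerProj, map_zero]
  have h1 := key c h
  have h2 := congrArg star (key (star c) h')
  simp only [star_mul, star_star, (isStarProjection_kerProj T).isSelfAdjoint.star_eq] at h2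
  rw [Commute, SemiconjBy, ← h1, ← mul_assoc, h2]

theorem mem_closure_range_of_kerProj_eq_zero {T : H →L[ℂ] H} (hT : star T = T) {x : H}
    (hx : kerProj T x = 0) : x ∈ closure (Set.range T) := by
  have h1 : x ∈ (LinearMap.ker (T : H →ₗ[ℂ] H))ᗮ := by
    rw [← Submodule.starProjection_apply_eq_zero_iff]; exact hx
  have h2 := ContinuousLinearMap.orthogonal_ker T
  rw [← ContinuousLinearMap.star_eq_adjoint, hT] at h2
  rw [h2] at h1
  exact h1

/-- An operator vanishing on the range and on the kernel of a self-adjoint operator is zero. -/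
theorem eq_zero_of_mul_eq_zero {T X : H →L[ℂ] H} (hT : star T = T) (h1 : X * T = 0)
    (h2 : X * kerProj T = 0) : X = 0 := by
  ext x
  have e : X x = X (x - kerProj T x) := by
    rw [map_sub]
    have : X (kerProj T x) = 0 := congr($h2 x)
    rw [this, sub_zero]
  have hm : x - kerProj T x ∈ closure (Set.range T) := by
    refine mem_closure_range_of_kerProj_eq_zero hT ?_
    rw [map_sub]
    have : kerProj T (kerProj T x) = kerProj T x :=
      congr($((isStarProjection_kerProj T).isIdempotentElem.eq) x)
    rw [this, sub_self]
  have hc : IsClosed {y | X y = 0} := isClosed_eq X.continuous continuous_const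
  have hs : Set.range T ⊆ {y | X y = 0} := by
    rintro _ ⟨y, rfl⟩
    exact congr($h1 y)
  rw [e]
  exact closure_minimal hs hc hm

/-- Douglas' factorization through a self-adjoint operator. -/
theorem exists_factorization {T Q : H →L[ℂ] H} (hT : star T = T) (h : ∀ x, ‖Q x‖ ≤ ‖T x‖) :
    ∃ V : H →L[ℂ] H, V * T = Q ∧ V * kerProj T = 0 := by
  set K : Submodule ℂ H := (LinearMap.range (T : H →ₗ[ℂ] H)).topologicalClosure with hK
  let e : H →ₗ[ℂ] K := (T : H →ₗ[ℂ] H).codRestrict K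
    fun x => Submodule.le_topologicalClosure _ (LinearMap.mem_range_self _ x)
  have he : DenseRange e := by
    intro y
    rw [closure_subtype]
    have : ((↑) '' Set.range e : Set H) = Set.range T := by
      ext z; constructor
      · rintro ⟨_, ⟨x, rfl⟩, rfl⟩; exact ⟨x, rfl⟩
      · rintro ⟨x, rfl⟩; exact ⟨e x, ⟨x, rfl⟩, rfl⟩
    rw [this]
    exact y.2
  have : CompleteSpace K := (Submodule.isClosed_topologicalClosure _).completeSpace_coe
  let V₀ : K →L[ℂ] H := (Q : H →ₗ[ℂ] H).extendOfNorm e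
  have hV₀ : ∀ x, V₀ (e x) = Q x :=
    LinearMap.extendOfNorm_eq (f := (Q : H →ₗ[ℂ] H)) he ⟨1, fun x => by rw [one_mul]; exact h x⟩
  refine ⟨V₀ ∘L K.orthogonalProjectionOnto, ?_, ?_⟩
  · ext x
    change V₀ (K.orthogonalProjectionOnto (T x)) = Q x
    rw [← hV₀ x]
    congr 1
    exact Submodule.orthogonalProjectionOnto_mem_subspace_eq_self (e x)
  · ext x
    change V₀ (K.orthogonalProjectionOnto (kerProj T x)) = 0
    have : K.orthogonalProjectionOnto (kerProj T x) = 0 := by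
      rw [Submodule.orthogonalProjectionOnto_eq_zero_iff, hK]
      have h2 := ContinuousLinearMap.orthogonal_ker T
      rw [← ContinuousLinearMap.star_eq_adjoint, hT] at h2
      rw [← h2]
      refine Submodule.le_orthogonal_orthogonal _ ?_
      exact LinearMap.mem_ker.2 (apply_kerProj T x)
    rw [this, map_zero]

/-- A spectral projection of a self-adjoint operator at the level `θ`. -/
theorem exists_spectral_cut {A : H →L[ℂ] H} (hA : star A = A) (θ : ℝ) :
    ∃ e : H →L[ℂ] H, IsStarProjection e ∧
      (∀ c, Commute c A → Commute (star c) A → Commute c e) ∧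
      (∀ x, e x = x → θ * ‖x‖ ^ 2 ≤ (inner ℂ x (A x)).re) ∧
      (∀ x, e x = 0 → (inner ℂ x (A x)).re ≤ θ * ‖x‖ ^ 2) := by
  set B : H →L[ℂ] H := A - (θ : ℂ) • 1 with hB
  have hBs : IsSelfAdjoint B := by
    change star B = B
    simp [hB, hA]
  have hcB : ∀ c, Commute c A → Commute c B := fun c hc =>
    hc.sub_right ((Commute.one_right c).smul_right _)
  have hp : (B⁺).IsPositive := (ContinuousLinearMap.nonneg_iff_isPositive _).1 (CFC.posPart_nonneg B)
  have hn : (B⁻).IsPositive := (ContinuousLinearMap.nonneg_iff_isPositive _).1 (CFC.negPart_nonneg B)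
  have hsub : B⁺ - B⁻ = B := CFC.posPart_sub_negPart B hBs
  have hmul : B⁻ * B⁺ = 0 := CFC.negPart_mul_posPart B
  have hcp : ∀ c, Commute c A → Commute c B⁺ := fun c hc => by
    rw [CFC.posPart_def]
    exact ((hcB c hc).symm.cfcₙ_real _).symm
  have hk := isStarProjection_kerProj (B⁺)
  have hin : ∀ x, (inner ℂ x (A x)).re = (inner ℂ x (B x)).re + θ * ‖x‖ ^ 2 := by
    intro x
    simp [hB, ← Complex.ofReal_pow]
  -- The cut is the support of the positive part of `A - θ`; eigenvectors at `θ` itself fall on the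
  -- side `e x = 0`.
  refine ⟨1 - kerProj B⁺, hk.one_sub, fun c h h' => ?_, fun x hx => ?_, fun x hx => ?_⟩
  · exact (Commute.one_right c).sub_right (Commute.kerProj (hcp c h) (hcp _ h'))
  · have hx0 : kerProj B⁺ x = 0 := by
      have : x - kerProj B⁺ x = x := hx
      simpa using this
    have hB0 : B⁻ x = 0 := by
      have hc : IsClosed {y | B⁻ y = 0} := isClosed_eq (B⁻).continuous continuous_const
      refine closure_minimal ?_ hc (mem_closure_range_of_kerProj_eq_zero (IsPositive.star_eq hp) hx0)
      rintro _ ⟨y, rfl⟩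
      exact congr($hmul y)
    have : B x = B⁺ x := by
      rw [← congr($hsub x)]
      change B⁺ x - B⁻ x = _
      rw [hB0, sub_zero]
    rw [hin, this]
    have := hp.re_inner_nonneg_right x
    simp only [RCLike.re_to_complex] at this
    linarith
  · have hx0 : B⁺ x = 0 := by
      rw [← kerProj_apply_eq_self_iff]
      have : x - kerProj B⁺ x = 0 := hx
      exact (sub_eq_zero.1 this).symm
    have : B x = - B⁻ x := by
      rw [← congr($hsub x)]
      change B⁺ x - B⁻ x = _
      rw [hx0, zero_sub]
    rw [hin, this]
    have := hn.re_inner_nonneg_right x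
    simp only [RCLike.re_to_complex] at this
    simp only [inner_neg_right, Complex.neg_re]
    linarith

/-! ### Vector states, tracial vectors and effects -/

/-- The real part of the vector functional `x ↦ ⟨ψ, x ψ⟩`. -/
noncomputable def vecState (ψ : H) : (H →L[ℂ] H) →ₗ[ℝ] ℝ where
  toFun x := (inner ℂ ψ (x ψ)).re
  map_add' x y := by simp
  map_smul' r x := by simp

theorem vecState_apply (ψ : H) (x : H →L[ℂ] H) : vecState ψ x = (inner ℂ ψ (x ψ)).re := rfl

theorem vecState_star_mul (ψ : H) (x y : H →L[ℂ] H) :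
    vecState ψ (star x * y) = (inner ℂ (x ψ) (y ψ)).re := by
  rw [vecState_apply, ← inner_star_right]; rfl

theorem vecState_star_mul_self (ψ : H) (x : H →L[ℂ] H) :
    vecState ψ (star x * x) = ‖x ψ‖ ^ 2 := by
  rw [vecState_star_mul]
  exact inner_self_eq_norm_sq (𝕜 := ℂ) (x ψ)

theorem vecState_mul_self (ψ : H) {x : H →L[ℂ] H} (hx : star x = x) :
    vecState ψ (x * x) = ‖x ψ‖ ^ 2 := by
  rw [← vecState_star_mul_self, hx]

theorem vecState_proj (ψ : H) {x : H →L[ℂ] H} (hx : IsStarProjection x) :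
    vecState ψ x = ‖x ψ‖ ^ 2 := by
  rw [← vecState_mul_self ψ hx.isSelfAdjoint.star_eq, hx.isIdempotentElem.eq]

theorem vecState_one (ψ : H) : vecState ψ (1 : H →L[ℂ] H) = ‖ψ‖ ^ 2 :=
  inner_self_eq_norm_sq (𝕜 := ℂ) ψ

theorem vecState_nonneg (ψ : H) {x : H →L[ℂ] H} (hx : x.IsPositive) : 0 ≤ vecState ψ x :=
  hx.re_inner_nonneg_right ψ

theorem vecState_conj (ψ : H) (x y : H →L[ℂ] H) :
    vecState ψ (star x * y * x) = vecState (x ψ) y := by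
  rw [mul_assoc, vecState_star_mul]; rfl

theorem vecState_star (ψ : H) (x : H →L[ℂ] H) : vecState ψ (star x) = vecState ψ x := by
  rw [vecState_apply, inner_star_right, vecState_apply, ← inner_conj_symm, Complex.conj_re]

/-- The vector `ψ` implements a trace on `N`. -/
def IsTracialVector (N : VonNeumannAlgebra H) (ψ : H) : Prop :=
  ∀ x ∈ N, ‖x ψ‖ = ‖star x ψ‖

/-- Polarization of the norm equality, applied to `x + y`. -/
theorem IsTracialVector.re_inner {N : VonNeumannAlgebra H} {ψ : H} (h : IsTracialVector N ψ)
    {x y : H →L[ℂ] H} (hx : x ∈ N) (hy : y ∈ N) :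
    (inner ℂ (x ψ) (y ψ)).re = (inner ℂ (star x ψ) (star y ψ)).re := by
  have h1 := h _ (add_mem hx hy)
  have h2 : ‖x ψ + y ψ‖ ^ 2 = ‖star x ψ + star y ψ‖ ^ 2 := by
    rw [star_add] at h1
    exact congrArg (· ^ 2) h1
  rw [norm_add_sq (𝕜 := ℂ), norm_add_sq (𝕜 := ℂ), h x hx, h y hy] at h2
  simp only [RCLike.re_to_complex] at h2
  linarith

theorem IsTracialVector.mul_comm {N : VonNeumannAlgebra H} {ψ : H} (h : IsTracialVector N ψ)
    {x y : H →L[ℂ] H} (hx : x ∈ N) (hy : y ∈ N) :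
    vecState ψ (x * y) = vecState ψ (y * x) := by
  have h1 := h.re_inner (star_mem hx) hy
  rw [← vecState_star_mul, star_star] at h1
  rw [h1, ← vecState_star (x := y * x), star_mul, vecState_star_mul]

theorem IsPOVM.star_eq {A : Type*} [Fintype A] {E : A → H →L[ℂ] H} (hE : IsPOVM E) (a : A) :
    star (E a) = E a := (hE.isPositive a).isSelfAdjoint

theorem IsPOVM.one_sub_isPositive {A : Type*} [Fintype A] {E : A → H →L[ℂ] H}
    (hE : IsPOVM E) (a : A) : (1 - E a).IsPositive := by
  classical
  rw [← hE.sum_eq_one, ← Finset.add_sum_erase _ _ (Finset.mem_univ a), add_sub_cancel_left]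
  exact ContinuousLinearMap.isPositive_sum _ fun i _ => hE.isPositive i

/-- E² = √E E √E ≤ √E √E = E. -/
theorem norm_sq_le_of_le_one {E : H →L[ℂ] H} (hE : E.IsPositive) (hE1 : (1 - E).IsPositive) (x : H) :
    ‖E x‖ ^ 2 ≤ vecState x E := by
  obtain ⟨D, hD, hDE, -⟩ := exists_sqrt hE
  have h := vecState_nonneg (D x) hE1
  have hs := IsPositive.star_eq hD
  rw [map_sub, vecState_one, ← vecState_mul_self x hs, ← vecState_conj, hs, hDE] at h
  rw [← vecState_mul_self x (IsPositive.star_eq hE)]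
  have : D * E * D = E * E := by rw [← hDE]; noncomm_ring
  rw [this] at h
  linarith

/-- Rounding an effect to a spectral projection. -/
theorem exists_rounding (N : VonNeumannAlgebra H) {E : H →L[ℂ] H} (hE : E.IsPositive)
    (hE1 : (1 - E).IsPositive) (hN : E ∈ N) :
    ∃ Q ∈ N, IsStarProjection Q ∧ (∀ x, ‖Q x‖ ^ 2 ≤ 2 * vecState x E) ∧
      (∀ x, ‖(E - Q) x‖ ^ 2 ≤ 2 * vecState x (E - E * E)) ∧
      (∀ x, vecState x (E - Q) ≤ 2 * vecState x (E - E * E)) ∧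
      ∀ x, vecState (Q x) (1 - E) ≤ 2 * vecState x (E - E * E) := by
  have hs := IsPositive.star_eq hE
  -- Cutting at 1/2 makes E(1 - E) at least (1 - E)/2 on the range of `Q` and at least E/2 on its
  -- complement; every factor 2 in the conclusion comes from this.
  obtain ⟨Q, hQ, hc, hhi, hlo⟩ := exists_spectral_cut hs (1 / 2)
  obtain ⟨C, hC, hCE, hcC⟩ := exists_sqrt hE1
  obtain ⟨D, hD, hDE, hcD⟩ := exists_sqrt hE
  have hCs := IsPositive.star_eq hC
  have hDs := IsPositive.star_eq hD
  have hQN : Q ∈ N := mem_of_commute N fun c h h' =>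
    hc c (commute_of_mem_commutant h hN) (commute_of_mem_commutant h' hN)
  have hQs : star Q = Q := hQ.isSelfAdjoint
  have hQi : Q * Q = Q := hQ.isIdempotentElem
  have hQE : E * Q = Q * E := hc E (Commute.refl E) (by rw [hs])
  have hEC : Commute C E := by
    have : Commute E C := hcC E ((Commute.one_right E).sub_right (Commute.refl E))
    exact this.symm
  have hED : Commute D E := (hcD E (Commute.refl E)).symm
  have hCQ : C * Q = Q * C := hc C hEC (by rw [hCs]; exact hEC)
  have hDQ : D * Q = Q * D := hc D hED (by rw [hDs]; exact hED)
  have hsplit : ∀ x, vecState x E = vecState (Q x) E + vecState ((1 - Q) x) E := by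
    intro x
    rw [← vecState_conj, ← vecState_conj, ← map_add]
    congr 1
    rw [star_sub, hQs, star_one]
    have : Q * E * Q = Q * E := by rw [mul_assoc, hQE, ← mul_assoc, hQi]
    rw [this]
    have : (1 - Q) * E * (1 - Q) = E - Q * E - E * Q + Q * E * Q := by noncomm_ring
    rw [this, hQE, mul_assoc, hQE, ← mul_assoc, hQi]
    abel
  have hQx : ∀ x, Q (Q x) = Q x := fun x => congr($hQi x)
  have hQx' : ∀ x, Q ((1 - Q) x) = 0 := fun x => by
    have : Q * (1 - Q) = 0 := by rw [mul_sub, mul_one, hQi, sub_self]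
    exact congr($this x)
  have hhi' : ∀ x, Q x = x → 1 / 2 * ‖x‖ ^ 2 ≤ vecState x E := hhi
  have hlo' : ∀ x, Q x = 0 → vecState x E ≤ 1 / 2 * ‖x‖ ^ 2 := hlo
  -- the two corners of `E - E²`
  have hsum : ∀ x, vecState (Q x) (1 - E) + vecState ((1 - Q) x) E
      ≤ 2 * vecState x (E - E * E) := by
    intro x
    have e1 : vecState (Q x) (1 - E) = ‖C (Q x)‖ ^ 2 := by
      rw [← hCE, vecState_mul_self _ hCs]
    have e2 : vecState ((1 - Q) x) E = ‖D ((1 - Q) x)‖ ^ 2 := by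
      rw [← hDE, vecState_mul_self _ hDs]
    have k1 := hhi' (C (Q x)) (by
      rw [show Q (C (Q x)) = (Q * C) (Q x) from rfl, ← hCQ]
      exact congrArg C (hQx x))
    have k2 := hlo' (D ((1 - Q) x)) (by
      rw [show Q (D ((1 - Q) x)) = (Q * D) ((1 - Q) x) from rfl, ← hDQ]
      exact (congrArg D (hQx' x)).trans (map_zero D))
    have e3 : vecState x (E - E * E) =
        vecState (C (Q x)) E + (‖D ((1 - Q) x)‖ ^ 2 - vecState (D ((1 - Q) x)) E) := by
      rw [← vecState_conj (Q x), ← vecState_conj ((1 - Q) x), ← vecState_conj x,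
        ← vecState_mul_self _ hDs, ← map_sub, ← vecState_conj x, ← map_add]
      congr 1
      rw [hCs, hDs, star_sub, hQs, star_one]
      have g1 : C * E * C = E - E * E := by
        rw [mul_assoc, ← hEC.eq, ← mul_assoc, hCE]; noncomm_ring
      have g2 : D * E * D = E * E := by
        rw [mul_assoc, ← hED.eq, ← mul_assoc, hDE]
      rw [g1, g2, hDE]
      have g3 : Q * (E - E * E) = (E - E * E) * Q := by
        rw [mul_sub, sub_mul, ← hQE, ← mul_assoc, ← hQE, mul_assoc, ← hQE, mul_assoc]
      have g4 : Q * (E - E * E) * Q = (E - E * E) * Q := by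
        rw [g3, mul_assoc, hQi]
      have g5 : (1 - Q) * (E - E * E) * (1 - Q) =
        (E - E * E) - (E - E * E) * Q - Q * (E - E * E) + Q * (E - E * E) * Q := by noncomm_ring
      rw [g5, g4, g3]
      abel
    rw [e3, e1, e2]
    linarith
  have hT1 : ∀ x, 0 ≤ vecState (Q x) (1 - E) := fun x => vecState_nonneg _ hE1
  have hT2 : ∀ x, 0 ≤ vecState ((1 - Q) x) E := fun x => vecState_nonneg _ hE
  refine ⟨Q, hQN, hQ, fun x => ?_, fun x => ?_, fun x => ?_, fun x => ?_⟩
  · have := hhi' (Q x) (hQx x)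
    rw [hsplit]
    have := hT2 x
    linarith
  · have e1 : (E - Q) x = E ((1 - Q) x) - (1 - E) (Q x) := by
      have : E - Q = E * (1 - Q) - (1 - E) * Q := by noncomm_ring
      exact congr($this x)
    have e2 : inner ℂ (E ((1 - Q) x)) ((1 - E) (Q x)) = 0 := by
      rw [inner_selfAdjoint hs, show (1 - Q) x = star (1 - Q) x by rw [star_sub, hQs, star_one],
        inner_star_left]
      have : (1 - Q) * (E * ((1 - E) * Q)) = 0 := by
        have : (1 - Q) * (E * ((1 - E) * Q)) =
          E * Q - E * (E * Q) - Q * (E * Q) + Q * (E * (E * Q)) := by noncomm_ring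
        rw [this, hQE, ← mul_assoc E Q, hQE, mul_assoc Q E E, ← mul_assoc Q Q, ← mul_assoc Q Q, hQi]
        abel
      rw [show (1 - Q) (E ((1 - E) (Q x))) = 0 from congr($this x), inner_zero_right]
    have e3 : ‖(E - Q) x‖ ^ 2 = ‖E ((1 - Q) x)‖ ^ 2 + ‖(1 - E) (Q x)‖ ^ 2 := by
      rw [e1, norm_sub_sq (𝕜 := ℂ), e2]
      simp
    have k1 := norm_sq_le_of_le_one hE hE1 ((1 - Q) x)
    have k2 := norm_sq_le_of_le_one hE1 (by simpa using hE) (Q x)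
    have := hsum x
    linarith
  · have : vecState x (E - Q) = vecState ((1 - Q) x) E - vecState (Q x) (1 - E) := by
      rw [map_sub, hsplit, map_sub, vecState_one, vecState_proj _ hQ]
      ring
    rw [this]
    have := hT1 x
    have := hsum x
    linarith
  · have := hT2 x
    have := hsum x
    linarith

/-! ### Orthogonalization in a tracial state -/

/-- The kernel of a sum of projections is the common kernel. -/
theorem sum_proj_apply_eq_zero_iff {A : Type*} (s : Finset A) {Q : A → H →L[ℂ] H}
    (hQ : ∀ a ∈ s, IsStarProjection (Q a)) (y : H) :
    (∑ a ∈ s, Q a) y = 0 ↔ ∀ a ∈ s, Q a y = 0 := by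
  constructor
  · intro h
    have h1 : vecState y (∑ a ∈ s, Q a) = 0 := by rw [vecState_apply, h, inner_zero_right]; rfl
    rw [map_sum] at h1
    rw [Finset.sum_eq_zero_iff_of_nonneg
      (fun a ha => by rw [vecState_proj _ (hQ a ha)]; positivity)] at h1
    intro a ha
    have := h1 a ha
    rw [vecState_proj _ (hQ a ha)] at this
    simpa using this
  · intro h
    rw [sum_apply]
    exact Finset.sum_eq_zero h

/-- Shrinking finitely many projections to an independent family with the same closed span. -/
theorem exists_independent_family (N : VonNeumannAlgebra H) {A : Type*}
    {Q : A → H →L[ℂ] H} (hQ : ∀ a, IsStarProjection (Q a)) (hN : ∀ a, Q a ∈ N) (s : Finset A) :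
    ∃ Q' : A → H →L[ℂ] H, (∀ a, IsStarProjection (Q' a)) ∧ (∀ a, Q' a ∈ N) ∧
      (∀ a, Q' a * Q a = Q' a) ∧
      (∀ x : A → H, ∑ a ∈ s, Q' a (x a) = 0 → ∀ a ∈ s, Q' a (x a) = 0) ∧
      (∀ y, (∀ a ∈ s, Q' a y = 0) → ∀ a ∈ s, Q a y = 0) := by
  classical
  induction s using Finset.induction_on with
  | empty => exact ⟨Q, hQ, hN, fun a => (hQ a).isIdempotentElem, by simp, by simp⟩
  | insert b s hb ih =>
    obtain ⟨Q', hp, hm, hle, hind, hker⟩ := ih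
    set T := ∑ a ∈ s, Q' a with hT
    have hTs : star T = T := by
      rw [hT, star_sum]; exact Finset.sum_congr rfl fun a _ => (hp a).isSelfAdjoint
    have hTN : T ∈ N := sum_mem fun a _ => hm a
    -- the support projection of `T`
    set R := 1 - kerProj T with hR
    have hRp : IsStarProjection R := (isStarProjection_kerProj T).one_sub
    have hRN : R ∈ N := sub_mem (one_mem N) (mem_of_commute N fun c h h' =>
      Commute.kerProj (commute_of_mem_commutant h hTN) (commute_of_mem_commutant h' hTN))
    have hRT : ∀ y, (∀ a ∈ s, Q' a y = 0) → R y = 0 := by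
      intro y hy
      have : T y = 0 := (sum_proj_apply_eq_zero_iff s (fun a _ => hp a) y).2 hy
      rw [← kerProj_apply_eq_self_iff] at this
      change y - kerProj T y = 0
      rw [this, sub_self]
    have hRQ : ∀ a ∈ s, R * Q' a = Q' a := by
      intro a ha
      have h1 : Q' a * kerProj T = 0 := by
        ext y
        exact (sum_proj_apply_eq_zero_iff s (fun a _ => hp a) _).1 (apply_kerProj T y) a ha
      have h2 := congrArg star h1
      rw [star_mul, (hp a).isSelfAdjoint.star_eq,
        (isStarProjection_kerProj T).isSelfAdjoint.star_eq, star_zero] at h2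
      rw [hR, sub_mul, h2, one_mul, sub_zero]
    -- the meet of `Q b` and `R`
    set B := (1 - Q b) + (1 - R) with hB
    have hBs : star B = B := by
      simp only [hB, star_add, star_sub, star_one, (hQ b).isSelfAdjoint.star_eq,
        hRp.isSelfAdjoint.star_eq]
    have hBN : B ∈ N := add_mem (sub_mem (one_mem N) (hN b)) (sub_mem (one_mem N) hRN)
    have hBker : ∀ y, B y = 0 ↔ Q b y = y ∧ R y = y := by
      intro y
      constructor
      · intro h
        have h1 : vecState y B = 0 := by rw [vecState_apply, h, inner_zero_right]; rfl
        rw [hB, map_add, vecState_proj _ (hQ b).one_sub, vecState_proj _ hRp.one_sub] at h1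
        have n1 : (1 - Q b) y = 0 := by
          have := sq_nonneg ‖(1 - R) y‖
          have := sq_nonneg ‖(1 - Q b) y‖
          have : ‖(1 - Q b) y‖ ^ 2 = 0 := by linarith
          simpa using this
        have n2 : (1 - R) y = 0 := by
          have := sq_nonneg ‖(1 - R) y‖
          have := sq_nonneg ‖(1 - Q b) y‖
          have : ‖(1 - R) y‖ ^ 2 = 0 := by linarith
          rwa [pow_eq_zero_iff two_ne_zero, norm_eq_zero] at this
        exact ⟨(sub_eq_zero.1 n1).symm, (sub_eq_zero.1 n2).symm⟩
      · rintro ⟨h1, h2⟩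
        change (y - Q b y) + (y - R y) = 0
        rw [h1, h2]; simp
    set c := kerProj B with hc
    have hcp : IsStarProjection c := isStarProjection_kerProj B
    have hcN : c ∈ N := mem_of_commute N fun c h h' =>
      Commute.kerProj (commute_of_mem_commutant h hBN) (commute_of_mem_commutant h' hBN)
    have hQc : Q b * c = c := by
      ext y; exact ((hBker _).1 (apply_kerProj B y)).1
    have hRc : R * c = c := by
      ext y; exact ((hBker _).1 (apply_kerProj B y)).2
    have hcQ : c * Q b = c := by
      have h2 := congrArg star hQc
      rwa [star_mul, (hQ b).isSelfAdjoint.star_eq, hcp.isSelfAdjoint.star_eq] at h2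
    have hcR : c * R = c := by
      have h2 := congrArg star hRc
      rwa [star_mul, hRp.isSelfAdjoint.star_eq, hcp.isSelfAdjoint.star_eq] at h2
    have hnew : IsStarProjection (Q b - c) := by
      refine ⟨?_, (hQ b).isSelfAdjoint.sub hcp.isSelfAdjoint⟩
      change (Q b - c) * (Q b - c) = Q b - c
      rw [sub_mul, mul_sub, mul_sub, (hQ b).isIdempotentElem.eq, hcp.isIdempotentElem.eq, hQc, hcQ]
      abel
    have hne : ∀ a ∈ s, a ≠ b := fun a ha h => hb (h ▸ ha)
    -- A vector in the range of `Q b - c` that is also a combination of the others is fixed by `Q b`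
    -- and `R`, hence by their meet `c`; but `c` kills it, so it vanishes. Since `c` lies below `R`,
    -- removing it does not enlarge the common kernel.
    refine ⟨Function.update Q' b (Q b - c), fun a => ?_, fun a => ?_, fun a => ?_, ?_, ?_⟩
    · rcases eq_or_ne a b with rfl | h
      · simpa using hnew
      · simpa [Function.update_of_ne h] using hp a
    · rcases eq_or_ne a b with rfl | h
      · simpa using sub_mem (hN a) hcN
      · simpa [Function.update_of_ne h] using hm a
    · rcases eq_or_ne a b with rfl | h
      · simp only [Function.update_self]
        rw [sub_mul, (hQ a).isIdempotentElem.eq, hcQ]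
      · simpa [Function.update_of_ne h] using hle a
    · intro x hx
      rw [Finset.sum_insert hb, Function.update_self] at hx
      have hs : ∑ a ∈ s, (Function.update Q' b (Q b - c)) a (x a) = ∑ a ∈ s, Q' a (x a) :=
        Finset.sum_congr rfl fun a ha => by rw [Function.update_of_ne (hne a ha)]
      rw [hs] at hx
      set z := (Q b - c) (x b) with hz
      have hz1 : z = - ∑ a ∈ s, Q' a (x a) := eq_neg_of_add_eq_zero_left hx
      have hRz : R z = z := by
        rw [hz1, map_neg, map_sum]
        congr 1
        exact Finset.sum_congr rfl fun a ha => congr($(hRQ a ha) (x a))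
      have hQz : Q b z = z := by
        have : Q b * (Q b - c) = Q b - c := by
          rw [mul_sub, (hQ b).isIdempotentElem.eq, hQc]
        exact congr($this (x b))
      have hcz : c z = z := kerProj_apply_eq_self_iff.2 ((hBker z).2 ⟨hQz, hRz⟩)
      have hcz0 : c z = 0 := by
        have : c * (Q b - c) = 0 := by rw [mul_sub, hcQ, hcp.isIdempotentElem.eq, sub_self]
        exact congr($this (x b))
      have hz0 : z = 0 := by rw [← hcz, hcz0]
      have hrest := hind x (by rw [hz0, zero_add] at hx; exact hx)
      intro a ha
      rcases Finset.mem_insert.1 ha with rfl | ha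
      · rw [Function.update_self]; exact hz0
      · rw [Function.update_of_ne (hne a ha)]; exact hrest a ha
    · intro y hy
      have hys : ∀ a ∈ s, Q' a y = 0 := fun a ha => by
        have := hy a (Finset.mem_insert_of_mem ha)
        rwa [Function.update_of_ne (hne a ha)] at this
      have hyb := hy b (Finset.mem_insert_self _ _)
      rw [Function.update_self] at hyb
      have hcy : c y = 0 := by
        rw [← hcR]
        change c (R y) = 0
        rw [hRT y hys, map_zero]
      intro a ha
      rcases Finset.mem_insert.1 ha with rfl | ha
      · have : Q a y - c y = 0 := hyb
        rwa [hcy, sub_zero] at this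
      · exact hker y hys a ha

/-- Symmetric orthogonalization of an independent family of projections: the components `V a` of
the partial isometry in the polar decomposition of the row `(Q a)`. -/
theorem exists_polar_row (N : VonNeumannAlgebra H) {A : Type*} [Fintype A] [DecidableEq A]
    {Q : A → H →L[ℂ] H} (hQ : ∀ a, IsStarProjection (Q a)) (hN : ∀ a, Q a ∈ N)
    (hind : ∀ x : A → H, ∑ a, Q a (x a) = 0 → ∀ a, Q a (x a) = 0) :
    ∃ (R : H →L[ℂ] H) (V : A → H →L[ℂ] H), R.IsPositive ∧ R ∈ N ∧ R * R = ∑ a, Q a ∧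
      (∀ a, V a ∈ N) ∧ (∀ a, V a * R = Q a) ∧ (∀ a, Q a * V a = V a) ∧
      ∑ a, star (V a) * V a = 1 - kerProj (∑ a, Q a) ∧
      kerProj (∑ a, Q a) * R = 0 ∧ (∀ a, V a * kerProj (∑ a, Q a) = 0) ∧
      ∀ a b, V a * star (V b) = if a = b then Q b else 0 := by
  have hSpos : (∑ a, Q a).IsPositive :=
    ContinuousLinearMap.isPositive_sum _ fun a _ =>
      ContinuousLinearMap.IsPositive.of_isStarProjection (hQ a)
  have hSN : (∑ a, Q a) ∈ N := sum_mem fun a _ => hN a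
  obtain ⟨R, hR, hRS, hRc⟩ := exists_sqrt hSpos
  have hRs := IsPositive.star_eq hR
  have hRN : R ∈ N := mem_of_commute N fun c h _ => hRc c (commute_of_mem_commutant h hSN)
  have hQR : ∀ a x, ‖Q a x‖ ≤ ‖R x‖ := by
    intro a x
    refine le_of_sq_le_sq ?_ (norm_nonneg _)
    rw [← vecState_mul_self x hRs, hRS, map_sum, ← vecState_proj x (hQ a)]
    exact Finset.single_le_sum (f := fun a => vecState x (Q a))
      (fun b _ => by rw [vecState_proj x (hQ b)]; positivity) (Finset.mem_univ a)
  choose V hVR hVk using fun a => exists_factorization hRs (hQR a)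
  have hkR : kerProj R = kerProj (∑ a, Q a) := by
    have : LinearMap.ker (R : H →ₗ[ℂ] H) = LinearMap.ker ((∑ a, Q a : H →L[ℂ] H) : H →ₗ[ℂ] H) := by
      ext x
      rw [LinearMap.mem_ker, LinearMap.mem_ker]
      change R x = 0 ↔ (∑ a, Q a) x = 0
      rw [← hRS]
      constructor
      · intro h
        change R (R x) = 0
        rw [h, map_zero]
      · intro h
        have := vecState_mul_self x hRs
        rw [vecState_apply, h, inner_zero_right] at this
        simpa using this.symm
    simp only [kerProj, this]
  have hVN : ∀ a, V a ∈ N := by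
    intro a
    -- `V a` is determined by its action on the range and on the kernel of `R`; the commutator with
    -- `c` vanishes on both.
    refine mem_of_commute N fun c h h' => ?_
    have hcR := commute_of_mem_commutant h hRN
    have hcR' := commute_of_mem_commutant h' hRN
    have hck := Commute.kerProj hcR hcR'
    have hcQ := commute_of_mem_commutant h (hN a)
    refine sub_eq_zero.1 (eq_zero_of_mul_eq_zero hRs ?_ ?_)
    · rw [sub_mul, mul_assoc, hVR, mul_assoc, hcR.eq, ← mul_assoc, hVR, hcQ.eq, sub_self]
    · rw [sub_mul, mul_assoc, hVk, mul_assoc, hck.eq, ← mul_assoc, hVk, mul_zero, zero_mul, sub_self]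
  have hQV : ∀ a, Q a * V a = V a := by
    intro a
    refine sub_eq_zero.1 (eq_zero_of_mul_eq_zero hRs ?_ ?_)
    · rw [sub_mul, mul_assoc, hVR, (hQ a).isIdempotentElem.eq, sub_self]
    · rw [sub_mul, mul_assoc, hVk, mul_zero, sub_self]
  have hRV : ∀ a, R * star (V a) = Q a := by
    intro a
    have h := congrArg star (hVR a)
    rwa [star_mul, hRs, (hQ a).isSelfAdjoint.star_eq] at h
  have hkp := isStarProjection_kerProj R
  have hsum : ∑ a, star (V a) * V a = 1 - kerProj R := by
    set X := ∑ a, star (V a) * V a - (1 - kerProj R) with hX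
    have hXs : star X = X := by
      simp only [hX, star_sub, star_sum, star_mul, star_star, star_one, hkp.isSelfAdjoint.star_eq]
    have hXk : X * kerProj R = 0 := by
      rw [hX, sub_mul, Finset.sum_mul, sub_mul, one_mul, hkp.isIdempotentElem.eq, sub_self, sub_zero]
      exact Finset.sum_eq_zero fun a _ => by rw [mul_assoc, hVk, mul_zero]
    have hRXR : R * X * R = 0 := by
      have h1 : R * (∑ a, star (V a) * V a) * R = R * R := by
        rw [Finset.mul_sum, Finset.sum_mul, hRS]
        refine Finset.sum_congr rfl fun a _ => ?_
        rw [← mul_assoc, hRV, mul_assoc, hVR, (hQ a).isIdempotentElem.eq]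
      rw [hX, mul_sub, sub_mul, h1, mul_sub, mul_one, mul_kerProj, sub_zero, sub_self]
    have hRX : R * X = 0 :=
      eq_zero_of_mul_eq_zero hRs hRXR (by rw [mul_assoc, hXk, mul_zero])
    have hXR : X * R = 0 := by
      have h := congrArg star hRX
      rwa [star_mul, hXs, hRs, star_zero] at h
    exact sub_eq_zero.1 (eq_zero_of_mul_eq_zero hRs hXR hXk)
  refine ⟨R, V, hR, hRN, hRS, hVN, hVR, hQV, by rw [hsum, hkR],
    by rw [← hkR, kerProj_mul_of_isSelfAdjoint hRs], fun a => by rw [← hkR, hVk], ?_⟩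
  intro a b
  have hVk' : kerProj R * star (V b) = 0 := by
    have h := congrArg star (hVk b)
    rwa [star_mul, hkp.isSelfAdjoint.star_eq, star_zero] at h
  -- ∑ Q_a Z_a = R (∑ V_a* V_a) V_b* - Q_b = 0, so independence forces every Z_a to vanish. This is
  -- where the absence of a kernel of the row is used.
  set Z : A → H →L[ℂ] H := fun a => V a * star (V b) - if a = b then Q b else 0 with hZ
  have hQZ : ∀ a, Q a * Z a = Z a := by
    intro a
    simp only [hZ]
    rw [mul_sub, ← mul_assoc, hQV]
    split_ifs with h
    · rw [h, (hQ b).isIdempotentElem.eq]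
    · rw [mul_zero]
  have hZsum : ∑ a, Q a * Z a = 0 := by
    have h1 : ∀ a, Q a * Z a = R * (star (V a) * V a) * star (V b) - if a = b then Q b else 0 := by
      intro a
      rw [hQZ]
      simp only [hZ]
      rw [← mul_assoc R, hRV, hQV]
    rw [Finset.sum_congr rfl fun a _ => h1 a, Finset.sum_sub_distrib, ← Finset.sum_mul,
      ← Finset.mul_sum, hsum, Finset.sum_ite_eq' , if_pos (Finset.mem_univ b), mul_assoc, sub_mul,
      hVk', sub_zero, one_mul, hRV, sub_self]
  have hZ0 : Z a = 0 := by
    ext y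
    have := hind (fun a => Z a y) (by
      have := congr($hZsum y)
      rw [sum_apply] at this
      exact this) a
    rw [← hQZ]
    exact this
  exact sub_eq_zero.1 hZ0

theorem norm_proj_apply_le {Q : H →L[ℂ] H} (hQ : IsStarProjection Q) (x : H) : ‖Q x‖ ≤ ‖x‖ := by
  refine le_of_sq_le_sq ?_ (norm_nonneg _)
  have h := vecState_proj x hQ.one_sub
  rw [map_sub, vecState_one, vecState_proj x hQ] at h
  have := sq_nonneg ‖(1 - Q) x‖
  linarith

theorem IsTracialVector.proj_mul_proj {N : VonNeumannAlgebra H} {ψ : H} (h : IsTracialVector N ψ)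
    {P Q : H →L[ℂ] H} (hP : IsStarProjection P) (hQ : IsStarProjection Q) (hPN : P ∈ N)
    (hQN : Q ∈ N) : vecState ψ (P * Q) = ‖P (Q ψ)‖ ^ 2 := by
  have h1 := vecState_star_mul_self ψ (P * Q)
  rw [star_mul, hP.isSelfAdjoint.star_eq, hQ.isSelfAdjoint.star_eq, mul_assoc, ← mul_assoc P,
    hP.isIdempotentElem.eq, h.mul_comm hQN (mul_mem hPN hQN), mul_assoc,
    hQ.isIdempotentElem.eq] at h1
  exact h1

/-- The diagonal terms of the square give back the sum, so the excess of ψ(S²) over ψ(S) is the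
off-diagonal mass, which measures the failure of orthogonality. -/
theorem IsTracialVector.vecState_sum_mul_sum {N : VonNeumannAlgebra H} {ψ : H}
    (h : IsTracialVector N ψ) {A : Type*} [Fintype A] [DecidableEq A]
    {Q : A → H →L[ℂ] H} (hQ : ∀ a, IsStarProjection (Q a)) (hN : ∀ a, Q a ∈ N) :
    vecState ψ ((∑ a, Q a) * ∑ a, Q a) =
      vecState ψ (∑ a, Q a) + ∑ a, ∑ b ∈ Finset.univ.erase a, ‖Q b (Q a ψ)‖ ^ 2 := by
  rw [Finset.sum_mul, map_sum, map_sum, ← Finset.sum_add_distrib]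
  refine Finset.sum_congr rfl fun a _ => ?_
  rw [h.mul_comm (hN a) (sum_mem fun b _ => hN b), Finset.sum_mul, map_sum,
    ← Finset.add_sum_erase _ _ (Finset.mem_univ a), (hQ a).isIdempotentElem.eq]
  congr 1
  exact Finset.sum_congr rfl fun b _ => h.proj_mul_proj (hQ b) (hQ a) (hN b) (hN a)

theorem norm_add_sq_le_two (x y : H) : ‖x + y‖ ^ 2 ≤ 2 * ‖x‖ ^ 2 + 2 * ‖y‖ ^ 2 := by
  have h := norm_add_le x y
  have : ‖x + y‖ ^ 2 ≤ (‖x‖ + ‖y‖) ^ 2 := by gcongr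
  nlinarith [sq_nonneg (‖x‖ - ‖y‖)]

theorem norm_add_sq_le_three (x y z : H) :
    ‖x + y + z‖ ^ 2 ≤ 3 * ‖x‖ ^ 2 + 3 * ‖y‖ ^ 2 + 3 * ‖z‖ ^ 2 := by
  have h := norm_add₃_le (a := x) (b := y) (c := z)
  have : ‖x + y + z‖ ^ 2 ≤ (‖x‖ + ‖y‖ + ‖z‖) ^ 2 := by gcongr
  nlinarith [sq_nonneg (‖x‖ - ‖y‖), sq_nonneg (‖y‖ - ‖z‖), sq_nonneg (‖x‖ - ‖z‖)]

/-- Orthogonalization of a POVM that is almost projective in a tracial vector state. -/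
theorem IsTracialVector.exists_isPVM {N : VonNeumannAlgebra H} {ψ : H} (h : IsTracialVector N ψ)
    {A : Type*} [Fintype A] [DecidableEq A] (a₀ : A) {E : A → H →L[ℂ] H} (hE : IsPOVM E)
    (hEN : ∀ a, E a ∈ N) :
    ∃ P : A → H →L[ℂ] H, IsPVM P ∧ (∀ a, P a ∈ N) ∧
      ∑ a, ‖(E a - P a) ψ‖ ^ 2 ≤ 144 * ∑ a, vecState ψ (E a - E a * E a) := by
  set e := ∑ a, vecState ψ (E a - E a * E a) with he
  choose Q hQN hQ hQE hEQ hEQ' hQE' using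
    fun a => exists_rounding N (hE.isPositive a) (IsPOVM.one_sub_isPositive hE a) (hEN a)
  obtain ⟨Q', hQ'p, hQ'N, hQ'Q, hind, hker⟩ := exists_independent_family N hQ hQN Finset.univ
  have hQQ' : ∀ a, Q a * Q' a = Q' a := fun a => by
    have := congrArg star (hQ'Q a)
    rwa [star_mul, (hQ a).isSelfAdjoint.star_eq, (hQ'p a).isSelfAdjoint.star_eq] at this
  obtain ⟨R, V, hR, hRN, hRS, hVN, hVR, hQV, hVV, hkR, hVk, hVVs⟩ :=
    exists_polar_row N hQ'p hQ'N fun x hx a => hind x hx a (Finset.mem_univ a)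
  have hRs := IsPositive.star_eq hR
  set S := ∑ a, Q a with hS
  set S' := ∑ a, Q' a with hS'
  have hSs : star S = S := by
    rw [hS, star_sum]; exact Finset.sum_congr rfl fun a _ => (hQ a).isSelfAdjoint
  set k := kerProj S' with hk
  have hkp : IsStarProjection k := isStarProjection_kerProj S'
  -- the off-diagonal mass
  set D := ∑ a, ∑ b ∈ Finset.univ.erase a, ‖Q b (Q a ψ)‖ ^ 2 with hD
  set D' := ∑ a, ∑ b ∈ Finset.univ.erase a, ‖Q' b (Q' a ψ)‖ ^ 2 with hD'
  -- Since Q_b ≤ 2 E_b, summing over b ≠ a leaves 2(1 - E_a), tested on Q_a ψ.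
  have hDe : D ≤ 4 * e := by
    rw [hD, he, Finset.mul_sum]
    refine Finset.sum_le_sum fun a _ => ?_
    have h1 : ∑ b ∈ Finset.univ.erase a, ‖Q b (Q a ψ)‖ ^ 2 ≤
        ∑ b ∈ Finset.univ.erase a, 2 * vecState (Q a ψ) (E b) :=
      Finset.sum_le_sum fun b _ => hQE b _
    have h2 : ∑ b ∈ Finset.univ.erase a, vecState (Q a ψ) (E b) = vecState (Q a ψ) (1 - E a) := by
      rw [← map_sum, ← hE.sum_eq_one, ← Finset.add_sum_erase _ _ (Finset.mem_univ a),
        add_sub_cancel_left]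
    rw [← Finset.mul_sum, h2] at h1
    have := hQE' a ψ
    linarith
  -- Traciality reverses a product of two projections, so each factor can be shrunk while it stands
  -- on the left.
  have hDD : D' ≤ D := by
    refine Finset.sum_le_sum fun a _ => Finset.sum_le_sum fun b _ => ?_
    have e1 : ‖Q' b (Q' a ψ)‖ ≤ ‖Q b (Q' a ψ)‖ := by
      rw [← congr($(hQ'Q b) (Q' a ψ))]
      exact norm_proj_apply_le (hQ'p b) _
    have e2 : ‖Q b (Q' a ψ)‖ = ‖Q' a (Q b ψ)‖ := by
      have := h _ (mul_mem (hQN b) (hQ'N a))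
      rwa [star_mul, (hQ b).isSelfAdjoint.star_eq, (hQ'p a).isSelfAdjoint.star_eq] at this
    have e3 : ‖Q' a (Q b ψ)‖ ≤ ‖Q a (Q b ψ)‖ := by
      rw [← congr($(hQ'Q a) (Q b ψ))]
      exact norm_proj_apply_le (hQ'p a) _
    have e4 : ‖Q a (Q b ψ)‖ = ‖Q b (Q a ψ)‖ := by
      have := h _ (mul_mem (hQN a) (hQN b))
      rwa [star_mul, (hQ b).isSelfAdjoint.star_eq, (hQ a).isSelfAdjoint.star_eq] at this
    gcongr
    linarith
  have hSS : vecState ψ (S * S) = vecState ψ S + D := h.vecState_sum_mul_sum hQ hQN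
  have hSS' : vecState ψ (S' * S') = vecState ψ S' + D' := h.vecState_sum_mul_sum hQ'p hQ'N
  -- supports
  have hSk : S * k = 0 := by
    ext y
    refine (sum_proj_apply_eq_zero_iff _ (fun a _ => hQ a) _).2 (hker _ ?_)
    exact (sum_proj_apply_eq_zero_iff _ (fun a _ => hQ'p a) _).1 (apply_kerProj S' y)
  have hkS : k * S = 0 := by
    have := congrArg star hSk
    rwa [star_mul, hSs, hkp.isSelfAdjoint.star_eq, star_zero] at this
  -- Expand ‖(S - (1 - k))ψ‖² ≥ 0, where 1 - k acts as a unit for S. With the trace identity `hS'p`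
  -- below, this bounds the mass lost in shrinking Q to Q'.
  have hSp : vecState ψ S - vecState ψ (1 - k) ≤ D := by
    have h1 := vecState_mul_self ψ (x := S - (1 - k)) (by
      rw [star_sub, hSs, hkp.one_sub.isSelfAdjoint.star_eq])
    have h2 : (S - (1 - k)) * (S - (1 - k)) = S * S - S - S + (1 - k) := by
      have : (S - (1 - k)) * (S - (1 - k)) =
        S * S - S - S + S * k + k * S + 1 - k - k + k * k := by noncomm_ring
      rw [this, hSk, hkS, hkp.isIdempotentElem.eq]
      abel
    rw [h2, map_add, map_sub, map_sub, hSS] at h1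
    have := sq_nonneg ‖(S - (1 - k)) ψ‖
    linarith
  have hRV : ∀ a, R * star (V a) = Q' a := by
    intro a
    have h := congrArg star (hVR a)
    rwa [star_mul, hRs, (hQ'p a).isSelfAdjoint.star_eq] at h
  -- Independent projections have total trace equal to that of their joint support: compare V_a* V_a
  -- with V_a V_a*.
  have hS'p : vecState ψ S' = vecState ψ (1 - k) := by
    rw [← hVV, hS', map_sum, map_sum]
    refine Finset.sum_congr rfl fun a _ => ?_
    rw [h.mul_comm (star_mem (hVN a)) (hVN a), hVVs, if_pos rfl]
  -- the polar row is close to the row of projections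
  have hVcross : ∑ a, vecState ψ (V a) = vecState ψ R := by
    have h1 : ∀ a, vecState ψ (V a) = vecState ψ (star (V a) * V a * R) := by
      intro a
      have : vecState ψ (V a) = vecState ψ (V a * Q' a) := by
        rw [← h.mul_comm (hQ'N a) (hVN a), hQV]
      rw [this, ← hRV, ← mul_assoc, h.mul_comm (mul_mem (hVN a) hRN) (star_mem (hVN a)), mul_assoc]
    rw [Finset.sum_congr rfl fun a _ => h1 a, ← map_sum, ← Finset.sum_mul, hVV, sub_mul, hkR,
      one_mul, sub_zero]
  have hVQ : ∑ a, ‖(V a - Q' a) ψ‖ ^ 2 ≤ D' := by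
    have h1 : ∀ a, ‖(V a - Q' a) ψ‖ ^ 2 =
        vecState ψ (star (V a) * V a) + vecState ψ (Q' a) - 2 * vecState ψ (V a) := by
      intro a
      rw [← vecState_star_mul_self, star_sub, (hQ'p a).isSelfAdjoint.star_eq, sub_mul, mul_sub,
        mul_sub, hQV, (hQ'p a).isIdempotentElem.eq]
      have : star (V a) * Q' a = star (V a) := by
        have := congrArg star (hQV a)
        rwa [star_mul, (hQ'p a).isSelfAdjoint.star_eq] at this
      rw [this, map_sub, map_sub, map_sub, vecState_star]
      ring
    rw [Finset.sum_congr rfl fun a _ => h1 a, Finset.sum_sub_distrib, Finset.sum_add_distrib,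
      ← Finset.mul_sum, hVcross, ← map_sum, ← map_sum, hVV, ← hS'p, ← hS']
    -- The bound is (R⁴ - R²) - 2(R² - R) = (R² - R)² + 2(R - 1)R(R - 1) ≥ 0, read with R² = S'.
    have h2 := vecState_nonneg ((R - 1) ψ) hR
    have h3 := vecState_mul_self ψ (x := R * R - R) (by rw [star_sub, star_mul, hRs])
    rw [← vecState_conj, star_sub, hRs, star_one] at h2
    have h4 : (R - 1) * R * (R - 1) = R * R * R - R * R - R * R + R := by noncomm_ring
    have h5 : (R * R - R) * (R * R - R) =
      (R * R) * (R * R) - R * R * R - R * R * R + R * R := by noncomm_ring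
    rw [h4, map_add, map_sub, map_sub] at h2
    rw [h5, hRS, map_add, map_sub, map_sub, hSS'] at h3
    rw [hRS] at h2
    have := sq_nonneg ‖(S' - R) ψ‖
    linarith
  set W : A → H →L[ℂ] H := fun a => star (V a) * V a with hW
  have hWQ : ∀ a, ‖(W a - Q' a) ψ‖ ^ 2 ≤ 4 * ‖(V a - Q' a) ψ‖ ^ 2 := by
    intro a
    have hVQs : star (V a) * Q' a = star (V a) := by
      have := congrArg star (hQV a)
      rwa [star_mul, (hQ'p a).isSelfAdjoint.star_eq] at this
    have e1 : (W a - Q' a) ψ = star (V a) ((V a - Q' a) ψ) + star (V a - Q' a) ψ := by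
      have : W a - Q' a = star (V a) * (V a - Q' a) + star (V a - Q' a) := by
        rw [star_sub, mul_sub, hVQs, (hQ'p a).isSelfAdjoint.star_eq]
        simp only [hW]; abel
      exact congr($this ψ)
    have e2 : ∀ y, ‖star (V a) y‖ ≤ ‖y‖ := by
      intro y
      have h1 := vecState_star_mul_self y (star (V a))
      rw [star_star, hVVs, if_pos rfl, vecState_proj y (hQ'p a)] at h1
      have h2 := norm_proj_apply_le (hQ'p a) y
      have h3 : ‖star (V a) y‖ = ‖Q' a y‖ :=
        ((sq_eq_sq₀ (norm_nonneg _) (norm_nonneg _)).1 h1).symm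
      rw [h3]; exact h2
    have e3 := h _ (sub_mem (hVN a) (hQ'N a))
    have e4 := norm_add_sq_le_two (star (V a) ((V a - Q' a) ψ)) (star (V a - Q' a) ψ)
    rw [← e1, ← e3] at e4
    have e5 : ‖star (V a) ((V a - Q' a) ψ)‖ ^ 2 ≤ ‖(V a - Q' a) ψ‖ ^ 2 := by
      gcongr; exact e2 _
    linarith
  have hQQ'n : ∑ a, ‖(Q a - Q' a) ψ‖ ^ 2 ≤ D := by
    have h1 : ∀ a, ‖(Q a - Q' a) ψ‖ ^ 2 = vecState ψ (Q a) - vecState ψ (Q' a) := by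
      intro a
      rw [← vecState_star_mul_self, star_sub, (hQ'p a).isSelfAdjoint.star_eq,
        (hQ a).isSelfAdjoint.star_eq, sub_mul, mul_sub, mul_sub, (hQ a).isIdempotentElem.eq,
        (hQ'p a).isIdempotentElem.eq, hQQ', hQ'Q, sub_self, sub_zero, map_sub]
    rw [Finset.sum_congr rfl fun a _ => h1 a, Finset.sum_sub_distrib, ← map_sum, ← map_sum, ← hS,
      ← hS', hS'p]
    exact hSp
  have hEQs : ∑ a, ‖(E a - Q a) ψ‖ ^ 2 ≤ 2 * e := by
    rw [he, Finset.mul_sum]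
    exact Finset.sum_le_sum fun a _ => hEQ a ψ
  have hkψ : ‖k ψ‖ ^ 2 ≤ 6 * e := by
    have h1 : vecState ψ (1 - k) = ‖ψ‖ ^ 2 - ‖k ψ‖ ^ 2 := by
      rw [map_sub, vecState_one, vecState_proj ψ hkp]
    have h2 : ∑ a, vecState ψ (E a - Q a) ≤ 2 * e := by
      rw [he, Finset.mul_sum]
      exact Finset.sum_le_sum fun a _ => hEQ' a ψ
    rw [← map_sum, Finset.sum_sub_distrib, hE.sum_eq_one, map_sub, vecState_one, ← hS] at h2
    linarith
  -- 66 = 3·2 + 3·4 + 3·4·4, from E to Q, Q to Q', and Q' to W.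
  have hEW : ∑ a, ‖(E a - W a) ψ‖ ^ 2 ≤ 66 * e := by
    have h1 : ∀ a, ‖(E a - W a) ψ‖ ^ 2 ≤ 3 * ‖(E a - Q a) ψ‖ ^ 2 + 3 * ‖(Q a - Q' a) ψ‖ ^ 2 +
        3 * (4 * ‖(V a - Q' a) ψ‖ ^ 2) := by
      intro a
      have e1 : (E a - W a) ψ = (E a - Q a) ψ + (Q a - Q' a) ψ + (Q' a - W a) ψ := by
        have : E a - W a = (E a - Q a) + (Q a - Q' a) + (Q' a - W a) := by abel
        exact congr($this ψ)
      have e2 := norm_add_sq_le_three ((E a - Q a) ψ) ((Q a - Q' a) ψ) ((Q' a - W a) ψ)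
      rw [← e1] at e2
      have e3 : ‖(Q' a - W a) ψ‖ = ‖(W a - Q' a) ψ‖ := by
        rw [← norm_neg, ← neg_apply, neg_sub]
      rw [e3] at e2
      have := hWQ a
      linarith
    refine (Finset.sum_le_sum fun a _ => h1 a).trans ?_
    rw [Finset.sum_add_distrib, Finset.sum_add_distrib, ← Finset.mul_sum, ← Finset.mul_sum,
      ← Finset.mul_sum, ← Finset.mul_sum]
    linarith
  -- completing to a PVM
  have hWW : ∀ a, W a * W a = W a := by
    intro a
    simp only [hW]
    rw [mul_assoc, ← mul_assoc (V a), hVVs, if_pos rfl, hQV]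
  have hWk : ∀ a, W a * k = 0 := fun a => by
    simp only [hW]; rw [mul_assoc, hVk, mul_zero]
  have hWs : ∀ a, star (W a) = W a := fun a => by simp only [hW]; rw [star_mul, star_star]
  have hkW : ∀ a, k * W a = 0 := fun a => by
    have := congrArg star (hWk a)
    rwa [star_mul, hWs, hkp.isSelfAdjoint.star_eq, star_zero] at this
  have hkN : k ∈ N := by
    have h1 : k = 1 - ∑ a, W a := by
      simp only [hW]
      rw [hVV, sub_sub_cancel]
    rw [h1]
    exact sub_mem (one_mem N) (sum_mem fun a _ => mul_mem (star_mem (hVN a)) (hVN a))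
  set P : A → H →L[ℂ] H := fun a => W a + if a = a₀ then k else 0 with hP
  have hPi : ∀ a, P a * P a = P a := by
    intro a
    simp only [hP]
    split_ifs with ha
    · rw [add_mul, mul_add, mul_add, hWW, hWk, hkW, hkp.isIdempotentElem.eq]
      abel
    · simpa using hWW a
  have hPs : ∀ a, star (P a) = P a := by
    intro a
    simp only [hP]
    split_ifs with ha
    · rw [star_add, hWs, hkp.isSelfAdjoint.star_eq]
    · simpa using hWs a
  refine ⟨P, ⟨⟨fun a => ?_, ?_⟩, hPi⟩, fun a => ?_, ?_⟩
  · exact ContinuousLinearMap.IsPositive.of_isStarProjection ⟨hPi a, hPs a⟩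
  · simp only [hP]
    rw [Finset.sum_add_distrib, Finset.sum_ite_eq' , if_pos (Finset.mem_univ a₀)]
    simp only [hW]
    rw [hVV, sub_add_cancel]
  · simp only [hP]
    refine add_mem (mul_mem (star_mem (hVN a)) (hVN a)) ?_
    split_ifs
    · exact hkN
    · exact zero_mem N
  · have h1 : ∀ a, ‖(E a - P a) ψ‖ ^ 2 ≤ 2 * ‖(E a - W a) ψ‖ ^ 2 +
        2 * (if a = a₀ then ‖k ψ‖ ^ 2 else 0) := by
      intro a
      have e1 : (E a - P a) ψ = (E a - W a) ψ + -((if a = a₀ then k else 0 : H →L[ℂ] H) ψ) := by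
        have : E a - P a = (E a - W a) + -(if a = a₀ then k else 0) := by simp only [hP]; abel
        exact congr($this ψ)
      rw [e1]
      refine (norm_add_sq_le_two _ _).trans ?_
      rw [norm_neg]
      split_ifs <;> simp
    refine (Finset.sum_le_sum fun a _ => h1 a).trans ?_
    rw [Finset.sum_add_distrib, ← Finset.mul_sum, ← Finset.mul_sum, Finset.sum_ite_eq',
      if_pos (Finset.mem_univ a₀)]
    -- 144 = 2·66 + 2·6, the second term being the unused projection `k`, assigned to `a₀`.
    linarith

/-! ### Dyadic coarsening of the levels -/

theorem sum_Ioc_id_le {l k : ℕ} (h : l ≤ k) :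
    ∑ j ∈ Finset.Ioc l k, (j : ℝ) ≤ (k : ℝ) ^ 2 - (l : ℝ) ^ 2 := by
  induction k, h using Nat.le_induction with
  | base => simp
  | succ k hk ih =>
    rw [← Finset.insert_Ioc_right_eq_Ioc_add_one hk, Finset.sum_insert (by simp)]
    push_cast
    have : (0 : ℝ) ≤ k := Nat.cast_nonneg k
    nlinarith

theorem sum_sum_Ico_two_pow (f : ℕ → ℝ) (m : ℕ) :
    ∑ i ∈ Finset.range m, ∑ j ∈ Finset.Ico (2 ^ i) (2 ^ (i + 1)), f j =
      ∑ j ∈ Finset.Ico 1 (2 ^ m), f j := by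
  induction m with
  | zero => simp
  | succ m ih =>
    rw [Finset.sum_range_succ, ih, Finset.sum_Ico_consecutive _ Nat.one_le_two_pow]
    exact Nat.pow_le_pow_right two_pos (Nat.le_succ m)

/-- `j` separates `l` from `k`. -/
def Separates (j l k : ℕ) : Prop := (l < j ∧ j ≤ k) ∨ (k < j ∧ j ≤ l)

instance (j l k : ℕ) : Decidable (Separates j l k) := by unfold Separates; infer_instance

theorem sum_separates_le (l k M : ℕ) :
    ∑ j ∈ Finset.Ico 1 M, (if Separates j l k then (j : ℝ) else 0) ≤ |(k : ℝ) ^ 2 - (l : ℝ) ^ 2| := by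
  rw [← Finset.sum_filter]
  rcases le_total l k with h | h
  · refine le_trans (Finset.sum_le_sum_of_subset_of_nonneg (t := Finset.Ioc l k) ?_ ?_)
      ((sum_Ioc_id_le h).trans (le_abs_self _))
    · intro j hj
      have hj' := (Finset.mem_filter.1 hj).2
      simp only [Separates, Finset.mem_Ioc] at hj' ⊢
      omega
    · intros; positivity
  · rw [abs_sub_comm]
    refine le_trans (Finset.sum_le_sum_of_subset_of_nonneg (t := Finset.Ioc k l) ?_ ?_)
      ((sum_Ioc_id_le h).trans (le_abs_self _))
    · intro j hj
      have hj' := (Finset.mem_filter.1 hj).2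
      simp only [Separates, Finset.mem_Ioc] at hj' ⊢
      omega
    · intros; positivity

/-- Coarsening: the right end point of the cell of `l` in the partition of `ℕ` with cut points
`J 0 < J 1 < ⋯`, where `2 ^ i ≤ J i < 2 ^ (i + 1)`. -/
def cellEnd (J : ℕ → ℕ) (l : ℕ) : ℕ :=
  if l < J (Nat.log 2 l) then J (Nat.log 2 l) else J (Nat.log 2 l + 1)

section cellEnd

variable {J : ℕ → ℕ} (hJ : ∀ i, 2 ^ i ≤ J i ∧ J i < 2 ^ (i + 1))
include hJ

/-- The cell from `J i` to `J (i + 1)` straddles the dyadic boundary `2 ^ (i + 1)`, so its points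
have two possible logarithms. -/
theorem cellEnd_of_lt {i l : ℕ} (h1 : J i ≤ l) (h2 : l < J (i + 1)) : cellEnd J l = J (i + 1) := by
  have a1 := hJ i
  have a2 := hJ (i + 1)
  have hl : l ≠ 0 := by have := Nat.one_le_two_pow (n := i); omega
  rcases lt_or_ge l (2 ^ (i + 1)) with h | h
  · have : Nat.log 2 l = i := Nat.log_eq_of_pow_le_of_lt_pow (by omega) h
    rw [cellEnd, this, if_neg (by omega)]
  · have : Nat.log 2 l = i + 1 := Nat.log_eq_of_pow_le_of_lt_pow h (by omega)
    rw [cellEnd, this, if_pos h2]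

theorem lt_cellEnd (l : ℕ) : l < cellEnd J l := by
  rw [cellEnd]
  split_ifs with h
  · exact h
  · exact (Nat.lt_pow_succ_log_self one_lt_two l).trans_le (hJ _).1

theorem cellEnd_le (l : ℕ) : cellEnd J l ≤ 4 * l + 1 := by
  rcases Nat.eq_zero_or_pos l with rfl | hl
  · have := hJ 0
    -- The first block contains only 1. With the convention `Nat.log 2 0 = 0`, level 0 becomes a
    -- cell by itself, ending at 1.
    have h0 : J 0 = 1 := by simp at this; omega
    simp [cellEnd, h0]
  · have h1 := Nat.pow_log_le_self 2 hl.ne'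
    have h2 := (hJ (Nat.log 2 l)).2
    have h3 := (hJ (Nat.log 2 l + 1)).2
    rw [pow_succ] at h2
    rw [pow_succ, pow_succ] at h3
    rw [cellEnd]
    split_ifs <;> omega

/-- Different cells are separated by a cut point, and one adjacent to the cell of `k` can be chosen;
consecutive cut points differ by a factor less than 4, which gives the second clause. -/
theorem exists_separates {l k : ℕ} (h : cellEnd J l ≠ cellEnd J k) :
    ∃ i, Separates (J i) l k ∧ cellEnd J k ≤ 4 * J i := by
  have h0 : J 0 = 1 := by have := hJ 0; simp at this; omega
  set i := Nat.log 2 k with hi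
  have hk : cellEnd J k = if k < J i then J i else J (i + 1) := rfl
  have b1 := hJ i
  have b2 := hJ (i + 1)
  have p1 : 2 ^ (i + 1) = 2 * 2 ^ i := by ring
  have p2 : 2 ^ (i + 1 + 1) = 4 * 2 ^ i := by ring
  have hk2 : k < 2 ^ (i + 1) := Nat.lt_pow_succ_log_self one_lt_two k
  split_ifs at hk with hlt
  · by_cases hl : J i ≤ l
    · exact ⟨i, Or.inr ⟨hlt, hl⟩, by omega⟩
    · rcases Nat.eq_zero_or_pos i with hi0 | hi0
      · rw [hi0, h0] at hlt hl
        exact absurd (by rw [show l = k by omega]) h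
      · obtain ⟨i', hi'⟩ : ∃ i', i = i' + 1 := ⟨i - 1, by omega⟩
        have b0 := hJ i'
        have hk1 : 2 ^ i ≤ k := Nat.pow_log_le_self 2 (by
          rintro rfl
          simp at hi; omega)
        rw [hi'] at hk hl b1 hk1
        have p3 : 2 ^ (i' + 1 + 1) = 4 * 2 ^ i' := by ring
        by_cases hl' : J i' ≤ l
        · exact absurd ((cellEnd_of_lt hJ hl' (by omega)).trans hk.symm) h
        · exact ⟨i', Or.inl ⟨by omega, by omega⟩, by omega⟩
  · by_cases hl : J i ≤ l
    · by_cases hl' : J (i + 1) ≤ l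
      · exact ⟨i + 1, Or.inr ⟨by omega, hl'⟩, by omega⟩
      · exact absurd ((cellEnd_of_lt hJ hl (by omega)).trans hk.symm) h
    · exact ⟨i, Or.inl ⟨by omega, by omega⟩, by omega⟩

end cellEnd

/-- Given nonnegative weights `n l k`, the levels `l < m` can be grouped into dyadic cells such that
little weight is cut. -/
theorem exists_coarsening (m : ℕ) (n : ℕ → ℕ → ℝ) (hn : ∀ l k, 0 ≤ n l k) :
    ∃ h : ℕ → ℕ, (∀ l, l < h l) ∧ (∀ l, h l ≤ 4 * l + 1) ∧
      ∑ l ∈ Finset.range m, ∑ k ∈ Finset.range m,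
          (if h l = h k then 0 else n l k * (h k : ℝ) ^ 2) ≤
        64 * ∑ l ∈ Finset.range m, ∑ k ∈ Finset.range m, n l k * |(k : ℝ) ^ 2 - (l : ℝ) ^ 2| := by
  set b : ℕ → ℝ := fun j => ∑ l ∈ Finset.range m, ∑ k ∈ Finset.range m,
    if Separates j l k then n l k else 0 with hb
  have hb0 : ∀ j, 0 ≤ b j := fun j => Finset.sum_nonneg fun l _ => Finset.sum_nonneg fun k _ => by
    split_ifs
    · exact hn l k
    · exact le_rfl
  -- In each dyadic block the cut point is one that separates the least weight.
  have hex : ∀ i : ℕ, ∃ j ∈ Finset.Ico (2 ^ i) (2 ^ (i + 1)),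
      ∀ j' ∈ Finset.Ico (2 ^ i) (2 ^ (i + 1)), b j ≤ b j' := fun i =>
    Finset.exists_min_image _ _ ⟨2 ^ i, Finset.mem_Ico.2
      ⟨le_rfl, Nat.pow_lt_pow_right one_lt_two (Nat.lt_succ_self i)⟩⟩
  choose J hJm hJmin using hex
  have hJ : ∀ i, 2 ^ i ≤ J i ∧ J i < 2 ^ (i + 1) := fun i => Finset.mem_Ico.1 (hJm i)
  refine ⟨cellEnd J, lt_cellEnd hJ, cellEnd_le hJ, ?_⟩
  have step1 : ∀ l ∈ Finset.range m, ∀ k ∈ Finset.range m,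
      (if cellEnd J l = cellEnd J k then 0 else n l k * (cellEnd J k : ℝ) ^ 2) ≤
        16 * ∑ i ∈ Finset.range m, (J i : ℝ) ^ 2 * if Separates (J i) l k then n l k else 0 := by
    intro l hl k hk
    have hnn : ∀ i ∈ Finset.range m,
        0 ≤ (J i : ℝ) ^ 2 * if Separates (J i) l k then n l k else 0 := fun i _ => by
      split_ifs
      · exact mul_nonneg (by positivity) (hn l k)
      · simp
    split_ifs with heq
    · exact mul_nonneg (by norm_num) (Finset.sum_nonneg hnn)
    · obtain ⟨i, hsep, hle⟩ := exists_separates hJ heq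
      have him : i ∈ Finset.range m := by
        rw [Finset.mem_range] at hl hk ⊢
        have h1 := (hJ i).1
        have h2 : i < 2 ^ i := Nat.lt_two_pow_self
        rcases hsep with h | h <;> omega
      have h1 := Finset.single_le_sum hnn him
      rw [if_pos hsep] at h1
      have h2 : (cellEnd J k : ℝ) ^ 2 ≤ (4 * J i) ^ 2 := by
        gcongr
        exact_mod_cast hle
      have := mul_le_mul_of_nonneg_left h2 (hn l k)
      nlinarith
  -- The minimum is at most the average: the block has `2 ^ i` points, each at least `2 ^ i`, while
  -- `J i` is at most twice that.
  have step2 : ∀ i, (J i : ℝ) ^ 2 * b (J i) ≤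
      4 * ∑ j ∈ (Finset.Ico (2 ^ i) (2 ^ (i + 1)) : Finset ℕ), (j : ℝ) * b j := by
    intro i
    have h1 : ∑ j ∈ (Finset.Ico (2 ^ i) (2 ^ (i + 1)) : Finset ℕ), (2 : ℝ) ^ i * b (J i) ≤
        ∑ j ∈ (Finset.Ico (2 ^ i) (2 ^ (i + 1)) : Finset ℕ), (j : ℝ) * b j := by
      refine Finset.sum_le_sum fun j hj => ?_
      refine mul_le_mul ?_ (hJmin i j hj) (hb0 _) (Nat.cast_nonneg j)
      exact_mod_cast (Finset.mem_Ico.1 hj).1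
    rw [Finset.sum_const, Nat.card_Ico, nsmul_eq_mul] at h1
    have h2 : ((2 ^ (i + 1) - 2 ^ i : ℕ) : ℝ) = 2 ^ i := by
      have : 2 ^ (i + 1) - 2 ^ i = 2 ^ i := by rw [pow_succ]; omega
      rw [this]; push_cast; rfl
    rw [h2] at h1
    have h3 : (J i : ℝ) ≤ 2 * 2 ^ i := by
      have := (hJ i).2
      rw [pow_succ] at this
      have : J i ≤ 2 * 2 ^ i := by omega
      exact_mod_cast this
    have h4 : (J i : ℝ) ^ 2 ≤ (2 * 2 ^ i) ^ 2 := by gcongr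
    have := mul_le_mul_of_nonneg_right h4 (hb0 (J i))
    nlinarith
  calc _ ≤ ∑ l ∈ Finset.range m, ∑ k ∈ Finset.range m,
        16 * ∑ i ∈ Finset.range m, (J i : ℝ) ^ 2 * (if Separates (J i) l k then n l k else 0) :=
        Finset.sum_le_sum fun l hl => Finset.sum_le_sum fun k hk => step1 l hl k hk
    _ = 16 * ∑ i ∈ Finset.range m, (J i : ℝ) ^ 2 * b (J i) := by
        simp only [hb, Finset.mul_sum]
        rw [Finset.sum_comm' (t' := Finset.range m) (s' := fun _ => Finset.range m) (by tauto)]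
        rw [Finset.sum_congr rfl fun k _ => Finset.sum_comm, Finset.sum_comm]
        refine Finset.sum_congr rfl fun i _ => ?_
        rw [Finset.sum_comm]
    _ ≤ 16 * ∑ i ∈ Finset.range m,
          (4 * ∑ j ∈ (Finset.Ico (2 ^ i) (2 ^ (i + 1)) : Finset ℕ), (j : ℝ) * b j) := by
        exact mul_le_mul_of_nonneg_left (Finset.sum_le_sum fun i _ => step2 i) (by norm_num)
    _ = 64 * ∑ j ∈ (Finset.Ico 1 (2 ^ m) : Finset ℕ), (j : ℝ) * b j := by
        rw [← Finset.mul_sum, sum_sum_Ico_two_pow]; ring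
    _ = 64 * ∑ l ∈ Finset.range m, ∑ k ∈ Finset.range m,
          n l k * ∑ j ∈ Finset.Ico 1 (2 ^ m), (if Separates j l k then (j : ℝ) else 0) := by
        congr 1
        simp only [hb, Finset.mul_sum]
        rw [Finset.sum_comm]
        refine Finset.sum_congr rfl fun l _ => ?_
        rw [Finset.sum_comm]
        refine Finset.sum_congr rfl fun k _ => Finset.sum_congr rfl fun j _ => ?_
        split_ifs <;> ring
    _ ≤ _ := by
        gcongr with l _ k _
        · exact hn l k
        · exact sum_separates_le l k _

/-! ### Orthogonal partitions and discretization of a positive operator -/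

/-- A finite partition of unity into mutually orthogonal projections. -/
structure IsPartition {ι : Type*} (s : Finset ι) (f : ι → H →L[ℂ] H) : Prop where
  proj : ∀ l, IsStarProjection (f l)
  ortho : ∀ l k, l ≠ k → f l * f k = 0
  sum : ∑ l ∈ s, f l = 1

/-- The operator with eigenvalue `w l` on the range of `f l`. -/
noncomputable def diag {ι : Type*} (s : Finset ι) (f : ι → H →L[ℂ] H) (w : ι → ℝ) : H →L[ℂ] H :=
  ∑ l ∈ s, (w l : ℂ) • f l

section Partition

variable {ι : Type*} [DecidableEq ι] {s : Finset ι} {f : ι → H →L[ℂ] H} (hf : IsPartition s f)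
include hf

theorem IsPartition.norm_sq (x : H) : ‖x‖ ^ 2 = ∑ l ∈ s, ‖f l x‖ ^ 2 := by
  rw [← vecState_one, ← hf.sum, map_sum]
  exact Finset.sum_congr rfl fun l _ => vecState_proj x (hf.proj l)

theorem IsPartition.mul_diag {k : ι} (hk : k ∈ s) (w : ι → ℝ) :
    f k * diag s f w = (w k : ℂ) • f k := by
  rw [diag, Finset.mul_sum, Finset.sum_eq_single_of_mem k hk]
  · rw [mul_smul_comm, (hf.proj k).isIdempotentElem.eq]
  · intro l _ hl
    rw [mul_smul_comm, hf.ortho k l hl.symm, smul_zero]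

theorem IsPartition.diag_mul {k : ι} (hk : k ∈ s) (w : ι → ℝ) :
    diag s f w * f k = (w k : ℂ) • f k := by
  rw [diag, Finset.sum_mul, Finset.sum_eq_single_of_mem k hk]
  · rw [smul_mul_assoc, (hf.proj k).isIdempotentElem.eq]
  · intro l _ hl
    rw [smul_mul_assoc, hf.ortho l k hl, smul_zero]

theorem IsPartition.star_diag (w : ι → ℝ) : star (diag s f w) = diag s f w := by
  rw [diag, star_sum]
  refine Finset.sum_congr rfl fun l _ => ?_
  rw [star_smul, (hf.proj l).isSelfAdjoint.star_eq]
  simp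

theorem IsPartition.norm_diag_sq (w : ι → ℝ) (x : H) :
    ‖diag s f w x‖ ^ 2 = ∑ l ∈ s, w l ^ 2 * ‖f l x‖ ^ 2 := by
  rw [hf.norm_sq]
  refine Finset.sum_congr rfl fun l hl => ?_
  rw [show f l (diag s f w x) = (w l : ℂ) • f l x from congr($(hf.mul_diag hl w) x), norm_smul,
    mul_pow]
  simp

theorem diag_mem {M : VonNeumannAlgebra H} (hM : ∀ l, f l ∈ M) (w : ι → ℝ) : diag s f w ∈ M :=
  sum_mem fun l _ => smul_mem_vonNeumann M _ (hM l)

/-- Pythagoras applies directly on the left; traciality passes to the adjoint, where it applies to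
the right-hand projections too. -/
theorem IsPartition.norm_sq_blocks {M : VonNeumannAlgebra H} {Ω : H} (hΩ : IsTracialVector M Ω)
    (hM : ∀ l, f l ∈ M) {y : H →L[ℂ] H} (hy : y ∈ M) :
    ‖y Ω‖ ^ 2 = ∑ l ∈ s, ∑ k ∈ s, ‖(f l * y * f k) Ω‖ ^ 2 := by
  rw [hf.norm_sq]
  refine Finset.sum_congr rfl fun l _ => ?_
  have h1 := hΩ _ (mul_mem (hM l) hy)
  rw [show f l (y Ω) = (f l * y) Ω from rfl, h1, hf.norm_sq]
  refine Finset.sum_congr rfl fun k _ => ?_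
  rw [hΩ _ (mul_mem (mul_mem (hM l) hy) (hM k)), star_mul (f l * y) (f k),
    (hf.proj k).isSelfAdjoint.star_eq]
  rfl

end Partition

/-- ‖Tx‖² is the form of T at √T x, so the bound on the form is used twice. -/
theorem norm_le_of_vecState_le {T : H →L[ℂ] H} (hT : T.IsPositive) {c : ℝ} (hc : 0 ≤ c)
    (h : ∀ x, vecState x T ≤ c * ‖x‖ ^ 2) (x : H) : ‖T x‖ ≤ c * ‖x‖ := by
  obtain ⟨D, hD, hDT, -⟩ := exists_sqrt hT
  have hs := IsPositive.star_eq hD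
  refine le_of_sq_le_sq ?_ (by positivity)
  have h1 : ‖T x‖ ^ 2 = vecState (D x) T := by
    rw [← vecState_mul_self x (IsPositive.star_eq hT), ← vecState_conj, hs, ← hDT]
    congr 1
  have h2 : ‖D x‖ ^ 2 = vecState x T := by rw [← hDT, vecState_mul_self x hs]
  have h3 := h (D x)
  have h4 := h x
  rw [h2] at h3
  calc ‖T x‖ ^ 2 ≤ c * vecState x T := by rw [h1]; exact h3
    _ ≤ c * (c * ‖x‖ ^ 2) := by gcongr
    _ = (c * ‖x‖) ^ 2 := by ring

/-- Discretization of a positive operator: spectral projections for the intervals of length `η`. -/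
theorem exists_spectral_partition {σ : H →L[ℂ] H} (hσ : σ.IsPositive) {η : ℝ} (hη : 0 < η) :
    ∃ (m : ℕ) (f : ℕ → H →L[ℂ] H), IsPartition (Finset.range m) f ∧
      (∀ l c, Commute c σ → Commute (star c) σ → Commute c (f l)) ∧
      (∀ l x, ‖σ (f l x) - ((l * η : ℝ) : ℂ) • f l x‖ ≤ η * ‖f l x‖) ∧
      ∀ l x, l * η * ‖f l x‖ ≤ ‖σ (f l x)‖ := by
  have hs := IsPositive.star_eq hσ
  choose p hp hpc hhi hlo using fun j : ℕ => exists_spectral_cut hs (j * η)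
  have hhi' : ∀ (j : ℕ) x, p j x = x → j * η * ‖x‖ ^ 2 ≤ vecState x σ := hhi
  have hlo' : ∀ (j : ℕ) x, p j x = 0 → vecState x σ ≤ j * η * ‖x‖ ^ 2 := hlo
  have hpσ : ∀ j, Commute (p j) σ := fun j =>
    (hpc j σ (Commute.refl σ) (by rw [hs])).symm
  have hpp : ∀ i j, Commute (p i) (p j) := fun i j =>
    hpc j (p i) (hpσ i) (by rw [(hp i).isSelfAdjoint.star_eq]; exact hpσ i)
  have hmono : ∀ i j, i < j → p i * p j = p j := by
    intro i j hij
    have h0 : (1 - p i) * p j = 0 := by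
      ext y
      set x := ((1 - p i) * p j) y with hx
      have h1 : p j x = x := by
        have : p j * ((1 - p i) * p j) = (1 - p i) * p j := by
          rw [← mul_assoc, ((Commute.one_right _).sub_right (hpp j i)).eq, mul_assoc,
            (hp j).isIdempotentElem.eq]
        exact congr($this y)
      have h2 : p i x = 0 := by
        have : p i * ((1 - p i) * p j) = 0 := by
          rw [← mul_assoc, mul_sub, mul_one, (hp i).isIdempotentElem.eq, sub_self, zero_mul]
        exact congr($this y)
      have h3 := hhi' j x h1
      have h4 := hlo' i x h2
      have h5 : (i : ℝ) * η < j * η := by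
        have : (i : ℝ) < j := by exact_mod_cast hij
        nlinarith
      have h6 : ‖x‖ ^ 2 = 0 := by
        by_contra hne
        have : 0 < ‖x‖ ^ 2 := lt_of_le_of_ne (sq_nonneg _) (Ne.symm hne)
        nlinarith
      simpa using h6
    rw [sub_mul, one_mul] at h0
    exact (sub_eq_zero.1 h0).symm
  -- At level 0 the identity replaces `p 0`, which would omit the kernel of σ and spoil the sum to
  -- 1.
  set e : ℕ → H →L[ℂ] H := fun j => if j = 0 then 1 else p j with he
  have e0 : e 0 = 1 := by simp [he]
  have eS : ∀ j, e (j + 1) = p (j + 1) := fun j => by simp [he]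
  have hep : ∀ j, IsStarProjection (e j) := by
    intro j
    cases j with
    | zero => rw [e0]; exact .one _
    | succ j => rw [eS]; exact hp _
  have hee : ∀ i j, i ≤ j → e i * e j = e j := by
    intro i j hij
    rcases hij.eq_or_lt with rfl | hlt
    · exact (hep i).isIdempotentElem
    · cases i with
      | zero => rw [e0, one_mul]
      | succ i =>
        obtain ⟨j, rfl⟩ : ∃ j', j = j' + 1 := ⟨j - 1, by omega⟩
        rw [eS, eS]; exact hmono _ _ hlt
  have hee' : ∀ i j, i ≤ j → e j * e i = e j := by
    intro i j hij
    have := congrArg star (hee i j hij)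
    rwa [star_mul, (hep i).isSelfAdjoint.star_eq, (hep j).isSelfAdjoint.star_eq] at this
  have hec : ∀ j c, Commute c σ → Commute (star c) σ → Commute c (e j) := by
    intro j c h h'
    cases j with
    | zero => rw [e0]; exact Commute.one_right c
    | succ j => rw [eS]; exact hpc _ c h h'
  obtain ⟨m, hm⟩ := exists_nat_gt (‖σ‖ / η)
  have hem : e m = 0 := by
    have hm0 : 0 < m := by
      have : (0 : ℝ) ≤ ‖σ‖ / η := by positivity
      exact_mod_cast this.trans_lt hm
    obtain ⟨m, rfl⟩ : ∃ m', m = m' + 1 := ⟨m - 1, by omega⟩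
    rw [eS]
    ext y
    set x := p (m + 1) y with hx
    have h1 : p (m + 1) x = x := congr($((hp (m + 1)).isIdempotentElem.eq) y)
    have h2 := hhi' _ x h1
    have h3 : vecState x σ ≤ ‖σ‖ * ‖x‖ ^ 2 := by
      have a1 : vecState x σ ≤ ‖x‖ * ‖σ x‖ := re_inner_le_norm (𝕜 := ℂ) x (σ x)
      have a2 := σ.le_opNorm x
      nlinarith [norm_nonneg x]
    rw [div_lt_iff₀ hη] at hm
    have h6 : ‖x‖ ^ 2 = 0 := by
      by_contra hne
      have : 0 < ‖x‖ ^ 2 := lt_of_le_of_ne (sq_nonneg _) (Ne.symm hne)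
      nlinarith
    simpa using h6
  set f : ℕ → H →L[ℂ] H := fun l => e l - e (l + 1) with hf
  have hfp : ∀ l, IsStarProjection (f l) := by
    intro l
    refine ⟨?_, (hep l).isSelfAdjoint.sub (hep (l + 1)).isSelfAdjoint⟩
    change (e l - e (l + 1)) * (e l - e (l + 1)) = e l - e (l + 1)
    rw [sub_mul, mul_sub, mul_sub, (hep l).isIdempotentElem.eq,
      (hep (l + 1)).isIdempotentElem.eq, hee _ _ (Nat.le_succ l), hee' _ _ (Nat.le_succ l)]
    abel
  have hfσ : ∀ l, Commute σ (f l) := fun l =>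
    (hec l σ (Commute.refl σ) (by rw [hs])).sub_right
      (hec (l + 1) σ (Commute.refl σ) (by rw [hs]))
  have hff : ∀ l x, f l (f l x) = f l x := fun l x =>
    congr($((hfp l).isIdempotentElem.eq) x)
  have hlow : ∀ l x, l * η * ‖f l x‖ ^ 2 ≤ vecState (f l x) σ := by
    intro l x
    cases l with
    | zero => simpa using vecState_nonneg _ hσ
    | succ l =>
      refine hhi' (l + 1) _ ?_
      have : p (l + 1) * f (l + 1) = f (l + 1) := by
        rw [← eS]
        simp only [hf]
        rw [mul_sub, hee _ _ le_rfl, hee _ _ (Nat.le_succ _)]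
      exact congr($this x)
  have hupp : ∀ l x, vecState (f l x) σ ≤ (l + 1) * η * ‖f l x‖ ^ 2 := by
    intro l x
    have h1 := hlo' (l + 1) (f l x) (by
      have : p (l + 1) * f l = 0 := by
        rw [← eS]
        simp only [hf]
        rw [mul_sub, hee' _ _ (Nat.le_succ _), (hep (l + 1)).isIdempotentElem.eq, sub_self]
      exact congr($this x))
    push_cast at h1
    exact h1
  refine ⟨m, f, ⟨hfp, ?_, ?_⟩, fun l c h h' => (hec l c h h').sub_right (hec _ c h h'),
    fun l x => ?_, fun l x => ?_⟩
  · have key : ∀ l k, l < k → f l * f k = 0 := by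
      intro l k hlk
      simp only [hf]
      rw [sub_mul, mul_sub, mul_sub, hee _ _ hlk.le, hee _ _ (by omega), hee _ _ (by omega),
        hee _ _ (by omega), sub_self]
    intro l k hlk
    rcases lt_or_gt_of_ne hlk with h | h
    · exact key l k h
    · have := congrArg star (key k l h)
      rwa [star_mul, (hfp l).isSelfAdjoint.star_eq, (hfp k).isSelfAdjoint.star_eq,
        star_zero] at this
  · simp only [hf]
    rw [Finset.sum_range_sub', e0, hem, sub_zero]
  · set T : H →L[ℂ] H := σ * f l - ((l * η : ℝ) : ℂ) • f l with hT
    have hvT : ∀ y, vecState y T = vecState (f l y) σ - l * η * ‖f l y‖ ^ 2 := by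
      intro y
      have a1 : T = star (f l) * σ * f l - (l * η : ℝ) • f l := by
        rw [(hfp l).isSelfAdjoint.star_eq, ← (hfσ l).eq, mul_assoc,
          (hfp l).isIdempotentElem.eq, hT, Complex.coe_smul]
      rw [a1, map_sub, vecState_conj, map_smul, vecState_proj y (hfp l), smul_eq_mul]
    have hTs : IsSelfAdjoint T := by
      change star T = T
      rw [hT, star_sub, star_mul, hs, (hfp l).isSelfAdjoint.star_eq, star_smul,
        (hfp l).isSelfAdjoint.star_eq, (hfσ l).eq]
      simp
    have hTp : T.IsPositive := by
      rw [ContinuousLinearMap.isPositive_def']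
      refine ⟨hTs, fun y => ?_⟩
      have : T.reApplyInnerSelf y = vecState y T := by
        rw [ContinuousLinearMap.reApplyInnerSelf, vecState_apply, inner_selfAdjoint hTs]; rfl
      rw [this, hvT]
      have := hlow l y
      linarith
    have h1 := norm_le_of_vecState_le hTp hη.le (fun y => by
      rw [hvT]
      have a1 := hupp l y
      have a2 : ‖f l y‖ ^ 2 ≤ ‖y‖ ^ 2 := by
        gcongr
        exact norm_proj_apply_le (hfp l) y
      nlinarith) (f l x)
    have h2 : T (f l x) = σ (f l x) - ((l * η : ℝ) : ℂ) • f l x := by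
      rw [hT]
      change σ (f l (f l x)) - ((l * η : ℝ) : ℂ) • f l (f l x) = _
      rw [hff]
    rwa [h2] at h1
  · have h1 := hlow l x
    have h2 : vecState (f l x) σ ≤ ‖f l x‖ * ‖σ (f l x)‖ :=
      re_inner_le_norm (𝕜 := ℂ) (f l x) (σ (f l x))
    rcases (norm_nonneg (f l x)).eq_or_lt with h | h
    · rw [← h]; simp
    · nlinarith

/-! ### Relative commutants and pinching -/

/-- The von Neumann subalgebra of `M` of the elements commuting with `h`. -/
noncomputable def relativeCommutant (M : VonNeumannAlgebra H) (h : H →L[ℂ] H) :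
    VonNeumannAlgebra H where
  toStarSubalgebra := StarSubalgebra.centralizer ℂ ((M.commutant : Set (H →L[ℂ] H)) ∪ {h})
  centralizer_centralizer' := by simp

theorem mem_relativeCommutant {M : VonNeumannAlgebra H} {h x : H →L[ℂ] H} (hs : star h = h) :
    x ∈ relativeCommutant M h ↔ x ∈ M ∧ h * x = x * h := by
  change x ∈ StarSubalgebra.centralizer ℂ ((M.commutant : Set (H →L[ℂ] H)) ∪ {h}) ↔ _
  rw [StarSubalgebra.mem_centralizer_iff]
  constructor
  · intro hx
    refine ⟨mem_of_commute M fun c hc _ => (hx c (Or.inl hc)).1, (hx h (Or.inr rfl)).1⟩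
  · rintro ⟨hxM, hxh⟩ g (hg | hg)
    · exact ⟨commute_of_mem_commutant hg hxM, commute_of_mem_commutant (star_mem hg) hxM⟩
    · rw [Set.mem_singleton_iff] at hg
      rw [hg, hs]
      exact ⟨hxh, hxh⟩

/-- ‖x h Ω‖ = ‖h x* Ω‖ = ‖x* h Ω‖. Thus orthogonalization is available in the generally non-tracial
state of `h Ω`, for operators that commute with `h`. -/
theorem IsTracialVector.relativeCommutant {M : VonNeumannAlgebra H} {Ω : H}
    (hΩ : IsTracialVector M Ω) {h : H →L[ℂ] H} (hs : star h = h) (hM : h ∈ M) :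
    IsTracialVector (relativeCommutant M h) (h Ω) := by
  intro x hx
  have hx' := (mem_relativeCommutant hs).1 (star_mem hx)
  have hx := (mem_relativeCommutant hs).1 hx
  have h1 := hΩ _ (mul_mem hx.1 hM)
  rw [star_mul, hs, hx'.2] at h1
  exact h1

theorem IsPOVM.sum_vecState {A : Type*} [Fintype A] {E : A → H →L[ℂ] H} (hE : IsPOVM E) (x : H) :
    ∑ a, vecState x (E a) = ‖x‖ ^ 2 := by
  rw [← map_sum, hE.sum_eq_one, vecState_one]

theorem IsPOVM.norm_sq_le {A : Type*} [Fintype A] {E : A → H →L[ℂ] H} (hE : IsPOVM E) (a : A)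
    (x : H) : ‖E a x‖ ^ 2 ≤ vecState x (E a) :=
  norm_sq_le_of_le_one (hE.isPositive a) (IsPOVM.one_sub_isPositive hE a) x

theorem IsPOVM.sum_norm_sq_le {A : Type*} [Fintype A] {E : A → H →L[ℂ] H} (hE : IsPOVM E) (x : H) :
    ∑ a, ‖E a x‖ ^ 2 ≤ ‖x‖ ^ 2 := by
  rw [← IsPOVM.sum_vecState hE x]
  exact Finset.sum_le_sum fun a _ => IsPOVM.norm_sq_le hE a x

theorem IsPOVM.sum_vecState_sub_mul_self {A : Type*} [Fintype A] {E : A → H →L[ℂ] H}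
    (hE : IsPOVM E) (x : H) :
    ∑ a, vecState x (E a - E a * E a) = ‖x‖ ^ 2 - ∑ a, ‖E a x‖ ^ 2 := by
  rw [← IsPOVM.sum_vecState hE x, ← Finset.sum_sub_distrib]
  refine Finset.sum_congr rfl fun a _ => ?_
  rw [map_sub, vecState_mul_self x (IsPOVM.star_eq hE a)]

/-- E - E² = √E (1 - E) √E. -/
theorem isPositive_sub_mul_self {E : H →L[ℂ] H} (hE : E.IsPositive) (hE1 : (1 - E).IsPositive) :
    (E - E * E).IsPositive := by
  obtain ⟨D, hD, hDE, -⟩ := exists_sqrt hE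
  have h := hE1.conj_adjoint D
  rw [← ContinuousLinearMap.star_eq_adjoint, IsPositive.star_eq hD] at h
  have : E - E * E = D * ((1 - E) * D) := by rw [← hDE]; noncomm_ring
  rw [this]
  exact h

theorem IsPartition.isPOVM_pinch {ι : Type*} {t : Finset ι} {g : ι → H →L[ℂ] H}
    (hg : IsPartition t g) {A : Type*} [Fintype A] {E : A → H →L[ℂ] H} (hE : IsPOVM E) :
    IsPOVM fun a => ∑ r ∈ t, g r * E a * g r where
  isPositive a := by
    refine ContinuousLinearMap.isPositive_sum _ fun r _ => ?_
    have h := (hE.isPositive a).conj_adjoint (g r)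
    rw [← ContinuousLinearMap.star_eq_adjoint, (hg.proj r).isSelfAdjoint.star_eq] at h
    rw [mul_assoc]
    exact h
  sum_eq_one := by
    rw [Finset.sum_comm, ← hg.sum]
    refine Finset.sum_congr rfl fun r _ => ?_
    rw [← Finset.sum_mul, ← Finset.mul_sum, hE.sum_eq_one, mul_one, (hg.proj r).isIdempotentElem.eq]

/-- Merging the members of a partition with the same label. -/
noncomputable def merge {ι κ : Type*} [DecidableEq κ] (s : Finset ι) (f : ι → H →L[ℂ] H) (h : ι → κ)
    (r : κ) : H →L[ℂ] H :=
  ∑ l ∈ s, if h l = r then f l else 0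

section merge

variable {ι κ : Type*} [DecidableEq ι] [DecidableEq κ] {s : Finset ι} {f : ι → H →L[ℂ] H}
  (hf : IsPartition s f) (h : ι → κ)
include hf

theorem IsPartition.mul_merge {l : ι} (hl : l ∈ s) (r : κ) :
    f l * merge s f h r = if h l = r then f l else 0 := by
  rw [merge, Finset.mul_sum, Finset.sum_eq_single_of_mem l hl]
  · split_ifs
    · exact (hf.proj l).isIdempotentElem
    · exact mul_zero _
  · intro k _ hk
    split_ifs
    · exact hf.ortho l k hk.symm
    · exact mul_zero _

theorem IsPartition.star_merge (r : κ) : star (merge s f h r) = merge s f h r := by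
  rw [merge, star_sum]
  refine Finset.sum_congr rfl fun l _ => ?_
  split_ifs
  · exact (hf.proj l).isSelfAdjoint
  · exact star_zero _

theorem IsPartition.merge_mul {l : ι} (hl : l ∈ s) (r : κ) :
    merge s f h r * f l = if h l = r then f l else 0 := by
  have := congrArg star (hf.mul_merge h hl r)
  rw [star_mul, (hf.proj l).isSelfAdjoint.star_eq, hf.star_merge] at this
  rw [this]
  split_ifs
  · exact (hf.proj l).isSelfAdjoint
  · exact star_zero _

theorem IsPartition.merge_mul_merge (r r' : κ) :
    merge s f h r * merge s f h r' = if r = r' then merge s f h r else 0 := by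
  conv_lhs => rw [merge, Finset.sum_mul]
  have : ∀ l ∈ s, (if h l = r then f l else 0) * merge s f h r' =
      if r = r' then (if h l = r then f l else 0) else 0 := by
    intro l hl
    by_cases h1 : h l = r
    · rw [if_pos h1, hf.mul_merge h hl, h1]
    · rw [if_neg h1, zero_mul, ite_self]
  rw [Finset.sum_congr rfl this]
  split_ifs
  · rfl
  · exact Finset.sum_const_zero

theorem IsPartition.merge : IsPartition (s.image h) (merge s f h) where
  proj r := ⟨by
    change TracialRounding.merge s f h r * TracialRounding.merge s f h r = _
    rw [hf.merge_mul_merge, if_pos rfl], hf.star_merge h r⟩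
  ortho r r' hr := by rw [hf.merge_mul_merge, if_neg hr]
  sum := by
    simp only [TracialRounding.merge]
    rw [Finset.sum_comm, ← hf.sum]
    refine Finset.sum_congr rfl fun l hl => ?_
    rw [Finset.sum_ite_eq, if_pos (Finset.mem_image_of_mem h hl)]

theorem IsPartition.mul_pinch_mul (E : H →L[ℂ] H) {l k : ι} (hl : l ∈ s) (hk : k ∈ s) :
    f l * (∑ r ∈ s.image h, TracialRounding.merge s f h r * E * TracialRounding.merge s f h r) * f k =
      if h l = h k then f l * E * f k else 0 := by
  rw [Finset.mul_sum, Finset.sum_mul,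
    Finset.sum_eq_single_of_mem (h l) (Finset.mem_image_of_mem h hl)]
  · rw [← mul_assoc, ← mul_assoc, hf.mul_merge h hl, if_pos rfl, mul_assoc _ _ (f k),
      hf.merge_mul h hk]
    split_ifs with h1 h2 h2
    · rfl
    · exact absurd h1.symm h2
    · exact absurd h2.symm h1
    · exact mul_zero _
  · intro r _ hr
    rw [← mul_assoc, ← mul_assoc, hf.mul_merge h hl, if_neg hr.symm, zero_mul, zero_mul, zero_mul]

end merge

/-! ### Orthogonalization in a non-tracial state -/

/-- Orthogonalization of a POVM that almost commutes with the density `σ²` of the state and is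
almost projective in that state. -/
theorem IsTracialVector.exists_isPVM_of_almost_commute {M : VonNeumannAlgebra H} {Ω : H}
    (hΩ : IsTracialVector M Ω) (hΩ1 : ‖Ω‖ = 1) {σ : H →L[ℂ] H} (hσ : σ.IsPositive) (hσM : σ ∈ M)
    (hσ1 : ‖σ Ω‖ = 1) {A : Type*} [Fintype A] [DecidableEq A] (a₀ : A) {E : A → H →L[ℂ] H}
    (hE : IsPOVM E) (hEM : ∀ a, E a ∈ M) {η : ℝ} (hη : 0 < η)
    (hcomm : ∑ a, ‖(E a * σ - σ * E a) Ω‖ ^ 2 ≤ η ^ 2)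
    (hproj : ∑ a, vecState (σ Ω) (E a - E a * E a) ≤ η ^ 2) :
    ∃ P : A → H →L[ℂ] H, IsPVM P ∧ (∀ a, P a ∈ M) ∧
      ∑ a, ‖(E a - P a) (σ Ω)‖ ^ 2 ≤ 5000000 * (η + η ^ 2) := by
  have hs := IsPositive.star_eq hσ
  have hEs := IsPOVM.star_eq hE
  obtain ⟨m, f, hf, hfc, hfσ, hfσ'⟩ := exists_spectral_partition hσ hη
  set s := Finset.range m with hs_def
  have hfM : ∀ l, f l ∈ M := fun l => mem_of_commute M fun c hc hc' =>
    hfc l c (commute_of_mem_commutant hc hσM) (commute_of_mem_commutant hc' hσM)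
  have hfcσ : ∀ l, σ * f l = f l * σ := fun l => hfc l σ (Commute.refl σ) (by rw [hs])
  have hfσx : ∀ l x, f l (σ x) = σ (f l x) := fun l x => congr($((hfcσ l).symm) x)
  set n : ℕ → ℕ → ℝ := fun l k => ∑ a, ‖(f l * E a * f k) Ω‖ ^ 2 with hn
  have hn0 : ∀ l k, 0 ≤ n l k := fun l k => Finset.sum_nonneg fun a _ => sq_nonneg _
  -- The bound l < h l yields σ² ≤ w², so errors measured in wΩ control those in σΩ; the bound h l ≤
  -- 4l + 1 yields w² ≤ 32σ² + 2η², so the projectivity defect passes the other way.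
  obtain ⟨h, hh1, hh2, hcut⟩ := exists_coarsening m n hn0
  -- the discretization `v ≤ σ` and the coarse majorant `w ≥ σ`
  set v := diag s f (fun l => l * η) with hv
  set w := diag s f (fun l => η * h l) with hw
  have hvs : star v = v := hf.star_diag _
  have hws : star w = w := hf.star_diag _
  have hvM : v ∈ M := diag_mem hf hfM _
  have hwM : w ∈ M := diag_mem hf hfM _
  have hσv : ∀ x, ‖(σ - v) x‖ ^ 2 ≤ η ^ 2 * ‖x‖ ^ 2 := by
    intro x
    rw [hf.norm_sq, hf.norm_sq x, Finset.mul_sum]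
    refine Finset.sum_le_sum fun l hl => ?_
    have e1 : f l ((σ - v) x) = σ (f l x) - ((l * η : ℝ) : ℂ) • f l x := by
      rw [← hfσx]
      change f l (σ x - v x) = _
      rw [map_sub]
      congr 1
      exact congr($(hf.mul_diag hl (fun l => l * η)) x)
    rw [e1, ← mul_pow]
    gcongr
    exact hfσ l x
  have hvσ : ∀ x, ‖v x‖ ^ 2 ≤ ‖σ x‖ ^ 2 := by
    intro x
    rw [hv, hf.norm_diag_sq, hf.norm_sq (σ x)]
    refine Finset.sum_le_sum fun l _ => ?_
    rw [← mul_pow, hfσx]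
    gcongr
    exact hfσ' l x
  have hσf : ∀ l x, ‖σ (f l x)‖ ≤ (l + 1) * η * ‖f l x‖ := by
    intro l x
    have h1 := norm_le_norm_add_norm_sub' (σ (f l x)) (((l * η : ℝ) : ℂ) • f l x)
    have h2 := hfσ l x
    rw [norm_smul, Complex.norm_real, Real.norm_of_nonneg (by positivity)] at h1
    linarith
  have hσw : ∀ x, ‖σ x‖ ^ 2 ≤ ‖w x‖ ^ 2 := by
    intro x
    rw [hw, hf.norm_diag_sq, hf.norm_sq (σ x)]
    refine Finset.sum_le_sum fun l _ => ?_
    rw [← mul_pow, hfσx]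
    have h1 : ((l : ℝ) + 1) ≤ h l := by exact_mod_cast hh1 l
    have h2 : ((l : ℝ) + 1) * η * ‖f l x‖ ≤ η * h l * ‖f l x‖ := by
      rw [_root_.mul_comm ((l : ℝ) + 1)]; gcongr
    have := (hσf l x).trans h2
    gcongr
  have hwσ : ∀ x, ‖w x‖ ^ 2 ≤ 32 * ‖σ x‖ ^ 2 + 2 * η ^ 2 * ‖x‖ ^ 2 := by
    intro x
    rw [hw, hf.norm_diag_sq, hf.norm_sq (σ x), hf.norm_sq x, Finset.mul_sum, Finset.mul_sum,
      ← Finset.sum_add_distrib]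
    refine Finset.sum_le_sum fun l _ => ?_
    rw [hfσx]
    have h1 : (h l : ℝ) ≤ 4 * l + 1 := by exact_mod_cast hh2 l
    have h2 : (h l : ℝ) ^ 2 ≤ (4 * l + 1) ^ 2 := by gcongr
    have h3 : (l * η * ‖f l x‖) ^ 2 ≤ ‖σ (f l x)‖ ^ 2 := by
      have := hfσ' l x
      gcongr
    have h4 : (h l : ℝ) ^ 2 ≤ 32 * (l : ℝ) ^ 2 + 2 := by nlinarith [sq_nonneg (4 * (l : ℝ) - 1)]
    have h5 : (h l : ℝ) ^ 2 * (η ^ 2 * ‖f l x‖ ^ 2) ≤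
        (32 * (l : ℝ) ^ 2 + 2) * (η ^ 2 * ‖f l x‖ ^ 2) := by gcongr
    nlinarith
  -- commutator and anticommutator with `v`
  have hblock : ∀ l ∈ s, ∀ k ∈ s, ∀ a, ∀ z : ℝ,
      ‖(f l * (E a * v + (z : ℂ) • (v * E a)) * f k) Ω‖ ^ 2 =
        (k * η + z * (l * η)) ^ 2 * ‖(f l * E a * f k) Ω‖ ^ 2 := by
    intro l hl k hk a z
    have : f l * (E a * v + (z : ℂ) • (v * E a)) * f k =
        ((k * η + z * (l * η) : ℝ) : ℂ) • (f l * E a * f k) := by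
      have e1 : f l * (E a * v + (z : ℂ) • (v * E a)) * f k =
          f l * E a * (v * f k) + (z : ℂ) • ((f l * v) * E a * f k) := by
        rw [mul_add, add_mul, mul_smul_comm, smul_mul_assoc]
        simp only [mul_assoc]
      rw [e1, hf.diag_mul hk, hf.mul_diag hl, mul_smul_comm, smul_mul_assoc, smul_mul_assoc,
        smul_smul, ← add_smul]
      push_cast
      rfl
    rw [this, smul_apply, norm_smul, mul_pow, Complex.norm_real, Real.norm_eq_abs, sq_abs]
  have hEvM : ∀ a, ∀ z : ℝ, E a * v + (z : ℂ) • (v * E a) ∈ M := fun a z =>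
    add_mem (mul_mem (hEM a) hvM) (smul_mem_vonNeumann M _ (mul_mem hvM (hEM a)))
  have hblocks : ∀ z : ℝ,
      ∑ l ∈ s, ∑ k ∈ s, n l k * (k * η + z * (l * η)) ^ 2 =
        ∑ a, ‖(E a * v + (z : ℂ) • (v * E a)) Ω‖ ^ 2 := by
    intro z
    rw [Finset.sum_congr rfl fun a _ => hf.norm_sq_blocks hΩ hfM (hEvM a z)]
    symm
    rw [Finset.sum_comm]
    refine Finset.sum_congr rfl fun l hl => ?_
    rw [Finset.sum_comm]
    refine Finset.sum_congr rfl fun k hk => ?_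
    rw [hn, Finset.sum_mul]
    refine Finset.sum_congr rfl fun a _ => ?_
    rw [hblock l hl k hk a z]
    ring
  have hswap : ∀ a, ∀ x ∈ M, star x = x → ‖(x * E a) Ω‖ = ‖E a (x Ω)‖ := by
    intro a x hx hxs
    rw [hΩ _ (mul_mem hx (hEM a)), star_mul, hEs, hxs]
    rfl
  -- The case z = -1 is the commutator; replacing σ by `v` on either side costs another η².
  have hX : ∑ a, ‖(E a * v + ((-1 : ℝ) : ℂ) • (v * E a)) Ω‖ ^ 2 ≤ 9 * η ^ 2 := by
    have h1 : ∀ a, ‖(E a * v + ((-1 : ℝ) : ℂ) • (v * E a)) Ω‖ ^ 2 ≤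
        3 * ‖(E a * σ - σ * E a) Ω‖ ^ 2 + 3 * ‖E a ((σ - v) Ω)‖ ^ 2 +
          3 * ‖E a ((σ - v) Ω)‖ ^ 2 := by
      intro a
      have e1 : (E a * v + ((-1 : ℝ) : ℂ) • (v * E a)) Ω =
          (E a * σ - σ * E a) Ω + -(E a ((σ - v) Ω)) + ((σ - v) * E a) Ω := by
        have : E a * v + ((-1 : ℝ) : ℂ) • (v * E a) =
            (E a * σ - σ * E a) + -(E a * (σ - v)) + (σ - v) * E a := by
          have : ((-1 : ℝ) : ℂ) • (v * E a) = -(v * E a) := by simp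
          rw [this]
          noncomm_ring
        exact congr($this Ω)
      have e2 := norm_add_sq_le_three ((E a * σ - σ * E a) Ω) (-(E a ((σ - v) Ω)))
        (((σ - v) * E a) Ω)
      rw [← e1, norm_neg, hswap a _ (sub_mem hσM hvM) (by rw [star_sub, hs, hvs])] at e2
      exact e2
    refine (Finset.sum_le_sum fun a _ => h1 a).trans ?_
    rw [Finset.sum_add_distrib, Finset.sum_add_distrib, ← Finset.mul_sum, ← Finset.mul_sum]
    have h2 := IsPOVM.sum_norm_sq_le hE ((σ - v) Ω)
    have h3 := hσv Ω
    rw [hΩ1] at h3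
    linarith
  have hY : ∑ a, ‖(E a * v + ((1 : ℝ) : ℂ) • (v * E a)) Ω‖ ^ 2 ≤ 4 := by
    have h1 : ∀ a, ‖(E a * v + ((1 : ℝ) : ℂ) • (v * E a)) Ω‖ ^ 2 ≤
        2 * ‖E a (v Ω)‖ ^ 2 + 2 * ‖E a (v Ω)‖ ^ 2 := by
      intro a
      have e2 := norm_add_sq_le_two ((E a * v) Ω) ((v * E a) Ω)
      rw [hswap a _ hvM hvs] at e2
      have e1 : (E a * v + ((1 : ℝ) : ℂ) • (v * E a)) Ω = (E a * v) Ω + (v * E a) Ω := by simp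
      rw [e1]
      exact e2
    refine (Finset.sum_le_sum fun a _ => h1 a).trans ?_
    rw [Finset.sum_add_distrib, ← Finset.mul_sum]
    have h2 := IsPOVM.sum_norm_sq_le hE (v Ω)
    have h3 := hvσ Ω
    rw [hσ1] at h3
    linarith
  rw [← hblocks (-1)] at hX
  rw [← hblocks 1] at hY
  -- Factor |k² - l²| = |k - l|(k + l) and apply the arithmetic-geometric inequality with weight η:
  -- half the commutator bound 9η² plus η²/2 times the anticommutator bound 4 is below 7η².
  have hZ : η ^ 2 * ∑ l ∈ s, ∑ k ∈ s, n l k * |(k : ℝ) ^ 2 - (l : ℝ) ^ 2| ≤ 7 * η := by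
    have h1 : η * (η ^ 2 * ∑ l ∈ s, ∑ k ∈ s, n l k * |(k : ℝ) ^ 2 - (l : ℝ) ^ 2|) ≤
        1 / 2 * ∑ l ∈ s, ∑ k ∈ s, n l k * (k * η + -1 * (l * η)) ^ 2 +
        η ^ 2 / 2 * ∑ l ∈ s, ∑ k ∈ s, n l k * (k * η + 1 * (l * η)) ^ 2 := by
      simp only [Finset.mul_sum]
      rw [← Finset.sum_add_distrib]
      refine Finset.sum_le_sum fun l _ => ?_
      rw [← Finset.sum_add_distrib]
      refine Finset.sum_le_sum fun k _ => ?_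
      have h2 : |(k : ℝ) ^ 2 - (l : ℝ) ^ 2| = |(k : ℝ) - l| * (k + l) := by
        rw [sq_sub_sq, abs_mul, _root_.mul_comm, abs_of_nonneg (by positivity : (0 : ℝ) ≤ k + l)]
      have h3 : η * |(k : ℝ) ^ 2 - (l : ℝ) ^ 2| ≤
          1 / 2 * ((k : ℝ) - l) ^ 2 + η ^ 2 / 2 * (k + l) ^ 2 := by
        rw [h2]
        have := sq_nonneg (|(k : ℝ) - l| - η * (k + l))
        have e := sq_abs ((k : ℝ) - l)
        nlinarith
      have h4 := mul_le_mul_of_nonneg_left h3 (mul_nonneg (hn0 l k) (sq_nonneg η))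
      nlinarith
    have h5 : η * (η ^ 2 * ∑ l ∈ s, ∑ k ∈ s, n l k * |(k : ℝ) ^ 2 - (l : ℝ) ^ 2|) ≤ η * (7 * η) := by
      nlinarith [sq_nonneg η]
    exact le_of_mul_le_mul_left h5 hη
  -- the pinched POVM
  set E' : A → H →L[ℂ] H :=
    fun a => ∑ r ∈ s.image h, merge s f h r * E a * merge s f h r with hE'
  have hE'P : IsPOVM E' := (hf.merge h).isPOVM_pinch hE
  have hmM : ∀ r, merge s f h r ∈ M := fun r => sum_mem fun l _ => by
    split_ifs
    · exact hfM l
    · exact zero_mem M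
  have hE'M : ∀ a, E' a ∈ M := fun a =>
    sum_mem fun r _ => mul_mem (mul_mem (hmM r) (hEM a)) (hmM r)
  -- On the cell labelled `r` the operator `w` is the scalar η r, and `E' a` is block diagonal for
  -- the cells.
  have hwE' : ∀ a, w * E' a = E' a * w := by
    have h1 : ∀ r, w * merge s f h r = ((η * r : ℝ) : ℂ) • merge s f h r := by
      intro r
      rw [merge, Finset.mul_sum, Finset.smul_sum]
      refine Finset.sum_congr rfl fun l hl => ?_
      split_ifs with hr
      · rw [hf.diag_mul hl, hr]
      · simp
    have h2 : ∀ r, merge s f h r * w = ((η * r : ℝ) : ℂ) • merge s f h r := by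
      intro r
      have := congrArg star (h1 r)
      rw [star_mul, hws, hf.star_merge, star_smul, hf.star_merge] at this
      rw [this]
      simp
    intro a
    rw [hE', Finset.mul_sum, Finset.sum_mul]
    refine Finset.sum_congr rfl fun r _ => ?_
    rw [← mul_assoc, ← mul_assoc, h1, mul_assoc _ _ w, h2, smul_mul_assoc, smul_mul_assoc,
      mul_smul_comm]
  have hbl : ∀ l ∈ s, ∀ k ∈ s, ∀ a, (f l * (E' a * σ) * f k) Ω =
      if h l = h k then (f l * (E a * σ) * f k) Ω else 0 := by
    intro l hl k hk a
    have e1 : ∀ X : H →L[ℂ] H, f l * (X * σ) * f k = f l * X * f k * σ := by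
      intro X
      rw [← mul_assoc, mul_assoc, hfcσ, ← mul_assoc]
    rw [e1, e1, hf.mul_pinch_mul h (E a) hl hk]
    split_ifs
    · rfl
    · simp
  have hpy : ∀ a, ‖E a (σ Ω)‖ ^ 2 = ‖E' a (σ Ω)‖ ^ 2 + ‖(E a - E' a) (σ Ω)‖ ^ 2 := by
    intro a
    have e1 := hf.norm_sq_blocks hΩ hfM (mul_mem (hEM a) hσM)
    have e2 := hf.norm_sq_blocks hΩ hfM (mul_mem (hE'M a) hσM)
    have e3 := hf.norm_sq_blocks hΩ hfM (mul_mem (sub_mem (hEM a) (hE'M a)) hσM)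
    change ‖E a (σ Ω)‖ ^ 2 = _ at e1
    change ‖E' a (σ Ω)‖ ^ 2 = _ at e2
    change ‖(E a - E' a) (σ Ω)‖ ^ 2 = _ at e3
    rw [e1, e2, e3, ← Finset.sum_add_distrib]
    refine Finset.sum_congr rfl fun l hl => ?_
    rw [← Finset.sum_add_distrib]
    refine Finset.sum_congr rfl fun k hk => ?_
    have e4 : (f l * ((E a - E' a) * σ) * f k) Ω =
        (f l * (E a * σ) * f k) Ω - (f l * (E' a * σ) * f k) Ω := by
      rw [sub_mul, mul_sub, sub_mul]; rfl
    rw [e4, hbl l hl k hk]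
    split_ifs <;> simp
  -- Only blocks between different cells survive in E - E'; 448 = 64·7.
  have hdiff : ∑ a, ‖(E a - E' a) (σ Ω)‖ ^ 2 ≤ 448 * η := by
    have h1 : ∑ a, ‖(E a - E' a) (σ Ω)‖ ^ 2 ≤
        η ^ 2 * ∑ l ∈ s, ∑ k ∈ s, (if h l = h k then 0 else n l k * (h k : ℝ) ^ 2) := by
      have e3 : ∀ a, ‖(E a - E' a) (σ Ω)‖ ^ 2 = _ := fun a =>
        hf.norm_sq_blocks hΩ hfM (mul_mem (sub_mem (hEM a) (hE'M a)) hσM)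
      rw [Finset.sum_congr rfl fun a _ => e3 a, Finset.sum_comm, Finset.mul_sum]
      refine Finset.sum_le_sum fun l hl => ?_
      rw [Finset.sum_comm, Finset.mul_sum]
      refine Finset.sum_le_sum fun k hk => ?_
      have e4 : ∀ a, (f l * ((E a - E' a) * σ) * f k) Ω =
          (f l * (E a * σ) * f k) Ω - (f l * (E' a * σ) * f k) Ω := fun a => by
        rw [sub_mul, mul_sub, sub_mul]; rfl
      split_ifs with hlk
      · rw [mul_zero]
        refine (Finset.sum_eq_zero fun a _ => ?_).le
        rw [e4, hbl l hl k hk, if_pos hlk, sub_self, norm_zero]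
        ring
      · rw [hn, Finset.sum_mul, Finset.mul_sum]
        refine Finset.sum_le_sum fun a _ => ?_
        rw [e4, hbl l hl k hk, if_neg hlk, sub_zero]
        have e5 : ‖(f l * (E a * σ) * f k) Ω‖ = ‖σ (f k ((E a * f l) Ω))‖ := by
          rw [hΩ _ (mul_mem (mul_mem (hfM l) (mul_mem (hEM a) hσM)) (hfM k))]
          rw [star_mul, star_mul, star_mul, hEs, hs, (hf.proj l).isSelfAdjoint.star_eq,
            (hf.proj k).isSelfAdjoint.star_eq, ← mul_assoc, ← mul_assoc, ← hfcσ]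
          rfl
        have e6 : ‖(f l * E a * f k) Ω‖ = ‖f k ((E a * f l) Ω)‖ := by
          rw [hΩ _ (mul_mem (mul_mem (hfM l) (hEM a)) (hfM k))]
          rw [star_mul, star_mul, hEs, (hf.proj l).isSelfAdjoint.star_eq,
            (hf.proj k).isSelfAdjoint.star_eq]
          rfl
        have e7 := hσf k ((E a * f l) Ω)
        rw [← e5, ← e6] at e7
        have e8 : ((k : ℝ) + 1) ≤ h k := by exact_mod_cast hh1 k
        have e9 : ‖(f l * (E a * σ) * f k) Ω‖ ≤ h k * η * ‖(f l * E a * f k) Ω‖ :=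
          e7.trans (by gcongr)
        calc _ ≤ (h k * η * ‖(f l * E a * f k) Ω‖) ^ 2 := by gcongr
          _ = _ := by ring
    have h2 := mul_le_mul_of_nonneg_left hcut (sq_nonneg η)
    linarith
  -- `E'` is almost projective in the trace `w Ω` of the relative commutant of `w`
  have hproj' : ∑ a, vecState (w Ω) (E' a - E' a * E' a) ≤ 34 * η ^ 2 + 14336 * η := by
    have h1 : ∀ a, vecState (w Ω) (E' a - E' a * E' a) ≤
        32 * vecState (σ Ω) (E' a - E' a * E' a) + 2 * η ^ 2 * vecState Ω (E' a - E' a * E' a) := by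
      intro a
      -- With E' - E'² = D², traciality turns ‖D w Ω‖ into ‖w D Ω‖, to which w² ≤ 32σ² + 2η²
      -- applies.
      obtain ⟨D, hD, hDE, hDc⟩ := exists_sqrt
        (isPositive_sub_mul_self (hE'P.isPositive a) (IsPOVM.one_sub_isPositive hE'P a))
      have hDs := IsPositive.star_eq hD
      have hDM : D ∈ M := mem_of_commute M fun c hc _ =>
        hDc c (commute_of_mem_commutant hc (sub_mem (hE'M a) (mul_mem (hE'M a) (hE'M a))))
      rw [← hDE, vecState_mul_self _ hDs, vecState_mul_self _ hDs, vecState_mul_self _ hDs]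
      have sw : ∀ x ∈ M, star x = x → ‖D (x Ω)‖ = ‖x (D Ω)‖ := by
        intro x hx hxs
        have := hΩ _ (mul_mem hDM hx)
        rwa [star_mul, hDs, hxs] at this
      rw [sw w hwM hws, sw σ hσM hs]
      exact hwσ (D Ω)
    refine (Finset.sum_le_sum fun a _ => h1 a).trans ?_
    rw [Finset.sum_add_distrib, ← Finset.mul_sum, ← Finset.mul_sum,
      IsPOVM.sum_vecState_sub_mul_self hE'P, IsPOVM.sum_vecState_sub_mul_self hE'P, hΩ1, hσ1]
    rw [IsPOVM.sum_vecState_sub_mul_self hE, hσ1,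
      Finset.sum_congr rfl fun a _ => hpy a, Finset.sum_add_distrib] at hproj
    have h2 : 0 ≤ ∑ a, ‖E' a Ω‖ ^ 2 := Finset.sum_nonneg fun a _ => sq_nonneg _
    have h3 : 0 ≤ η ^ 2 * ∑ a, ‖E' a Ω‖ ^ 2 := by positivity
    nlinarith
  obtain ⟨P, hP, hPN, hPE⟩ := (hΩ.relativeCommutant hws hwM).exists_isPVM a₀ hE'P
    fun a => (mem_relativeCommutant hws).2 ⟨hE'M a, hwE' a⟩
  have hPM : ∀ a, P a ∈ M := fun a => ((mem_relativeCommutant hws).1 (hPN a)).1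
  refine ⟨P, hP, hPM, ?_⟩
  have hPs := IsPOVM.star_eq hP.toIsPOVM
  have h1 : ∀ a, ‖(E a - P a) (σ Ω)‖ ^ 2 ≤
      2 * ‖(E a - E' a) (σ Ω)‖ ^ 2 + 2 * ‖(E' a - P a) (w Ω)‖ ^ 2 := by
    intro a
    have e1 : (E a - P a) (σ Ω) = (E a - E' a) (σ Ω) + (E' a - P a) (σ Ω) := by
      have : E a - P a = (E a - E' a) + (E' a - P a) := by abel
      exact congr($this (σ Ω))
    have e2 := norm_add_sq_le_two ((E a - E' a) (σ Ω)) ((E' a - P a) (σ Ω))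
    rw [← e1] at e2
    have sw : ∀ x ∈ M, star x = x → ‖(E' a - P a) (x Ω)‖ = ‖x ((E' a - P a) Ω)‖ := by
      intro x hx hxs
      have := hΩ _ (mul_mem (sub_mem (hE'M a) (hPM a)) hx)
      rwa [star_mul, star_sub, IsPOVM.star_eq hE'P, hPs, hxs] at this
    have e3 := hσw ((E' a - P a) Ω)
    rw [← sw σ hσM hs, ← sw w hwM hws] at e3
    linarith
  refine (Finset.sum_le_sum fun a _ => h1 a).trans ?_
  rw [Finset.sum_add_distrib, ← Finset.mul_sum, ← Finset.mul_sum]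
  -- The coefficient of η is 2·448 + 2·144·14336, below 5000000.
  nlinarith [sq_nonneg η]

/-! ### Standard form and opposite operators -/

section StandardForm

variable (T : TracialStandardForm H)

theorem isTracialVector : IsTracialVector T.M T.Ω := by
  intro x hx
  have h := T.tracial (star x) (star_mem hx) x hx
  have h1 := vecState_star_mul_self T.Ω x
  have h2 := vecState_star_mul_self T.Ω (star x)
  rw [star_star, vecState_apply, ← h, ← vecState_apply, h1] at h2
  exact (sq_eq_sq₀ (norm_nonneg _) (norm_nonneg _)).1 h2

theorem eq_of_forall_apply {x y : H →L[ℂ] H} (h : ∀ s ∈ T.M, x (s T.Ω) = y (s T.Ω)) : x = y := by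
  have hd := T.cyclic
  ext ξ
  have hc : IsClosed {ξ | x ξ = y ξ} := isClosed_eq x.continuous y.continuous
  have hs : {ξ : H | ∃ a ∈ T.M, ξ = a T.Ω} ⊆ {ξ | x ξ = y ξ} := by
    rintro _ ⟨a, ha, rfl⟩; exact h a ha
  exact closure_minimal hs hc (hd ξ)

theorem apply_comm {s x : H →L[ℂ] H} (hs : s ∈ T.M) (hx : x ∈ T.M.commutant) (ξ : H) :
    x (s ξ) = s (x ξ) :=
  congr($((commute_of_mem_commutant hx hs).eq) ξ)

/-- For a in M, Re⟨a*Ω, x*Ω⟩ = Re⟨xΩ, aΩ⟩ and ‖a*Ω‖ = ‖aΩ‖. Expand ‖a*Ω - x*Ω‖² ≥ 0 and let aΩ tend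
to xΩ, by cyclicity; then exchange x and x*. -/
theorem isTracialVector_commutant : IsTracialVector T.M.commutant T.Ω := by
  have key : ∀ x ∈ T.M.commutant, ‖x T.Ω‖ ^ 2 ≤ ‖star x T.Ω‖ ^ 2 := by
    intro x hx
    have h1 : ∀ a ∈ T.M, 0 ≤ ‖a T.Ω‖ ^ 2 + ‖star x T.Ω‖ ^ 2 - 2 * (inner ℂ (x T.Ω) (a T.Ω)).re := by
      intro a ha
      have e1 : (inner ℂ (star a T.Ω) (star x T.Ω)).re = (inner ℂ (x T.Ω) (a T.Ω)).re := by
        rw [inner_star_right, apply_comm T (star_mem ha) hx, inner_star_left]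
      have e2 := norm_sub_sq (𝕜 := ℂ) (star a T.Ω) (star x T.Ω)
      rw [← isTracialVector T a ha, RCLike.re_to_complex, e1] at e2
      have := sq_nonneg ‖star a T.Ω - star x T.Ω‖
      linarith
    have hc : IsClosed {ξ : H | 0 ≤ ‖ξ‖ ^ 2 + ‖star x T.Ω‖ ^ 2 - 2 * (inner ℂ (x T.Ω) ξ).re} := by
      refine isClosed_le continuous_const ?_
      fun_prop
    have hs : {ξ : H | ∃ a ∈ T.M, ξ = a T.Ω} ⊆
        {ξ : H | 0 ≤ ‖ξ‖ ^ 2 + ‖star x T.Ω‖ ^ 2 - 2 * (inner ℂ (x T.Ω) ξ).re} := by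
      rintro _ ⟨a, ha, rfl⟩; exact h1 a ha
    have h2 : 0 ≤ ‖x T.Ω‖ ^ 2 + ‖star x T.Ω‖ ^ 2 - 2 * (inner ℂ (x T.Ω) (x T.Ω)).re :=
      closure_minimal hs hc (T.cyclic (x T.Ω))
    have h3 : (inner ℂ (x T.Ω) (x T.Ω)).re = ‖x T.Ω‖ ^ 2 := inner_self_eq_norm_sq (𝕜 := ℂ) _
    rw [h3] at h2
    linarith
  intro x hx
  have h1 := key x hx
  have h2 := key (star x) (star_mem hx)
  rw [star_star] at h2
  exact (sq_eq_sq₀ (norm_nonneg _) (norm_nonneg _)).1 (le_antisymm h1 h2)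

/-- The linear map `s ↦ s Ω` on the von Neumann algebra. -/
def cyclicMap : T.M.toStarSubalgebra →ₗ[ℂ] H where
  toFun s := (s : H →L[ℂ] H) T.Ω
  map_add' _ _ := rfl
  map_smul' _ _ := rfl

theorem denseRange_cyclicMap : DenseRange (cyclicMap T) := by
  have : Set.range (cyclicMap T) = {ξ : H | ∃ a ∈ T.M, ξ = a T.Ω} := by
    ext ξ; constructor
    · rintro ⟨s, rfl⟩; exact ⟨s, s.2, rfl⟩
    · rintro ⟨a, ha, rfl⟩; exact ⟨⟨a, ha⟩, rfl⟩
  rw [DenseRange, this]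
  exact T.cyclic

/-- The linear map `s ↦ s a Ω` on the von Neumann algebra. -/
def cyclicMulMap (a : H →L[ℂ] H) : T.M.toStarSubalgebra →ₗ[ℂ] H where
  toFun s := (s : H →L[ℂ] H) (a T.Ω)
  map_add' _ _ := rfl
  map_smul' _ _ := rfl

/-- Right multiplication by `a`. -/
noncomputable def opp (a : H →L[ℂ] H) : H →L[ℂ] H :=
  (cyclicMulMap T a).extendOfNorm (cyclicMap T)

theorem isOpposite_opp {a : H →L[ℂ] H} (ha : a ∈ T.M) : T.IsOpposite a (opp T a) := by
  intro s hs
  refine LinearMap.extendOfNorm_eq (f := cyclicMulMap T a) (e := cyclicMap T)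
    (denseRange_cyclicMap T) ⟨‖star a‖, fun s => ?_⟩ ⟨s, hs⟩
  change ‖((s : H →L[ℂ] H) * a) T.Ω‖ ≤ ‖star a‖ * ‖(s : H →L[ℂ] H) T.Ω‖
  have hsM : (s : H →L[ℂ] H) ∈ T.M := s.2
  -- Traciality turns right multiplication into left multiplication: ‖s a Ω‖ = ‖a* s* Ω‖, which is
  -- at most ‖a*‖ ‖sΩ‖.
  rw [isTracialVector T _ (mul_mem hsM ha), isTracialVector T _ hsM, star_mul]
  exact (star a).le_opNorm _

theorem opp_apply {a s : H →L[ℂ] H} (ha : a ∈ T.M) (hs : s ∈ T.M) :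
    opp T a (s T.Ω) = s (a T.Ω) :=
  isOpposite_opp T ha s hs

theorem opp_apply_cyclic {a : H →L[ℂ] H} (ha : a ∈ T.M) : opp T a T.Ω = a T.Ω :=
  opp_apply T ha (one_mem _)

theorem opp_mem {a : H →L[ℂ] H} (ha : a ∈ T.M) : opp T a ∈ T.M.commutant := by
  rw [VonNeumannAlgebra.mem_commutant_iff]
  intro g hg
  refine eq_of_forall_apply T fun s hs => ?_
  change g (opp T a (s T.Ω)) = opp T a ((g * s) T.Ω)
  rw [opp_apply T ha hs, opp_apply T ha (mul_mem hg hs)]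
  rfl

theorem opp_mul {a b : H →L[ℂ] H} (ha : a ∈ T.M) (hb : b ∈ T.M) :
    opp T (a * b) = opp T b * opp T a := by
  refine eq_of_forall_apply T fun s hs => ?_
  change _ = opp T b (opp T a (s T.Ω))
  rw [opp_apply T (mul_mem ha hb) hs, opp_apply T ha hs, ← mul_apply_eq_comp s a,
    opp_apply T hb (mul_mem hs ha)]
  rfl

theorem opp_sum {A : Type*} (t : Finset A) {P : A → H →L[ℂ] H} (hP : ∀ a, P a ∈ T.M) :
    opp T (∑ a ∈ t, P a) = ∑ a ∈ t, opp T (P a) := by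
  refine eq_of_forall_apply T fun s hs => ?_
  rw [opp_apply T (sum_mem fun a _ => hP a) hs, sum_apply, sum_apply, map_sum]
  exact Finset.sum_congr rfl fun a _ => (opp_apply T (hP a) hs).symm

theorem opp_one : opp T 1 = 1 :=
  eq_of_forall_apply T fun _ hs => opp_apply T (one_mem _) hs

/-- Traciality identifies the two operators on Ω; both lie in the commutant, so cyclicity extends
the equality. -/
theorem star_opp {a : H →L[ℂ] H} (ha : a ∈ T.M) : star (opp T a) = opp T (star a) := by
  have h1 : opp T (star a) T.Ω = star (opp T a) T.Ω := by
    rw [opp_apply_cyclic T (star_mem ha)]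
    refine ext_inner_left ℂ fun v => ?_
    have hc : IsClosed {v : H | inner ℂ v (star a T.Ω) = inner ℂ v (star (opp T a) T.Ω)} :=
      isClosed_eq (by fun_prop) (by fun_prop)
    have hs : {ξ : H | ∃ a ∈ T.M, ξ = a T.Ω} ⊆
        {v : H | inner ℂ v (star a T.Ω) = inner ℂ v (star (opp T a) T.Ω)} := by
      rintro _ ⟨s, hs, rfl⟩
      change inner ℂ (s T.Ω) (star a T.Ω) = inner ℂ (s T.Ω) (star (opp T a) T.Ω)
      rw [inner_star_right, inner_star_right, opp_apply T ha hs]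
      have h := T.tracial (star a) (star_mem ha) (star s) (star_mem hs)
      have h' := congrArg (starRingEnd ℂ) h
      rw [inner_conj_symm, inner_conj_symm] at h'
      change inner ℂ (star a (star s T.Ω)) T.Ω = inner ℂ (star s (star a T.Ω)) T.Ω at h'
      rw [inner_star_left, inner_star_left, inner_star_left, inner_star_left] at h'
      have h2 := congrArg (starRingEnd ℂ) h'
      rw [inner_conj_symm, inner_conj_symm] at h2
      exact h2.symm
    exact closure_minimal hs hc (T.cyclic v)
  refine eq_of_forall_apply T fun s hs => ?_
  rw [apply_comm T hs (star_mem (opp_mem T ha)), apply_comm T hs (opp_mem T (star_mem ha)), h1]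

theorem isPVM_opp {A : Type*} [Fintype A] {P : A → H →L[ℂ] H} (hP : IsPVM P)
    (hM : ∀ a, P a ∈ T.M) : IsPVM fun a => opp T (P a) := by
  have hi : ∀ a, opp T (P a) * opp T (P a) = opp T (P a) := fun a => by
    rw [← opp_mul T (hM a) (hM a), hP.idempotent]
  refine ⟨⟨fun a => ContinuousLinearMap.IsPositive.of_isStarProjection ⟨hi a, ?_⟩, ?_⟩, hi⟩
  · change star _ = _
    rw [star_opp T (hM a), IsPOVM.star_eq hP.toIsPOVM]
  · rw [← opp_sum T _ hM, hP.sum_eq_one, opp_one]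

end StandardForm

/-! ### Rounding the measurements of one question -/

variable {T : TracialStandardForm H} {σ : H →L[ℂ] H}

/-- Cauchy-Schwarz for the self-polar form `(a, b) ↦ τ(σ a σ b)`. -/
theorem re_inner_mul_le (hσ : σ.IsPositive) (hσM : σ ∈ T.M) {A B : H →L[ℂ] H} (hA : star A = A)
    (hAM : A ∈ T.M) (hB : star B = B) (hBM : B ∈ T.M.commutant) :
    2 * vecState (σ T.Ω) (A * B) ≤
      (inner ℂ (A (σ T.Ω)) (σ (A T.Ω))).re + ‖B (σ T.Ω)‖ ^ 2 := by
  -- With s = √σ and y = s^op, σΩ = s y Ω. Half of the density is moved to each factor: ⟨σΩ, A B σΩ⟩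
  -- = ⟨sAsΩ, yByΩ⟩.
  obtain ⟨s, hs, hss, hsc⟩ := exists_sqrt hσ
  have hsM : s ∈ T.M := mem_of_commute T.M fun c hc _ => hsc c (commute_of_mem_commutant hc hσM)
  have hsa := IsPositive.star_eq hs
  have hσa := IsPositive.star_eq hσ
  set y := opp T s with hy
  have hyM : y ∈ T.M.commutant := opp_mem T hsM
  have hya : star y = y := by rw [hy, star_opp T hsM, hsa]
  have hyΩ : y T.Ω = s T.Ω := opp_apply_cyclic T hsM
  have hsy : s (y T.Ω) = σ T.Ω := by rw [hyΩ, ← hss]; rfl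
  have hyy : y (y T.Ω) = σ T.Ω := by rw [hyΩ, apply_comm T hsM hyM, hsy]
  have e1 : vecState (σ T.Ω) (A * B) = (inner ℂ ((s * A * s) T.Ω) ((y * B * y) T.Ω)).re := by
    rw [vecState_apply, ← hsy]
    change (inner ℂ (s (y T.Ω)) (A (B (s (y T.Ω))))).re =
      (inner ℂ (s (A (s T.Ω))) (y (B (y T.Ω)))).re
    rw [apply_comm T hsM hBM, inner_selfAdjoint hsa, ← inner_selfAdjoint hya,
      apply_comm T hsM hyM, apply_comm T hAM hyM, apply_comm T hsM hyM, inner_selfAdjoint hsa,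
      inner_selfAdjoint hA, inner_selfAdjoint hsa]
  have e2 : ‖(s * A * s) T.Ω‖ ^ 2 = (inner ℂ (A (σ T.Ω)) (σ (A T.Ω))).re := by
    have hsAs : star (s * A * s) = s * A * s := by rw [star_mul, star_mul, hsa, hA, mul_assoc]
    rw [← vecState_mul_self _ hsAs]
    have : s * A * s * (s * A * s) = s * (A * (s * s) * A * s) := by simp only [mul_assoc]
    rw [this, hss, (isTracialVector T).mul_comm hsM
      (mul_mem (mul_mem (mul_mem hAM hσM) hAM) hsM)]
    have : A * σ * A * s * s = star (σ * A) * (A * σ) := by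
      rw [star_mul, hσa, hA, mul_assoc, hss]; simp only [mul_assoc]
    rw [this, vecState_star_mul, ← inner_conj_symm, Complex.conj_re]
    rfl
  have e3 : ‖(y * B * y) T.Ω‖ ^ 2 ≤ ‖B (σ T.Ω)‖ ^ 2 := by
    have hyBy : star (y * B * y) = y * B * y := by rw [star_mul, star_mul, hya, hB, mul_assoc]
    rw [← vecState_mul_self _ hyBy]
    have : y * B * y * (y * B * y) = y * (B * (y * y) * B * y) := by simp only [mul_assoc]
    rw [this, (isTracialVector_commutant T).mul_comm hyM
      (mul_mem (mul_mem (mul_mem hBM (mul_mem hyM hyM)) hBM) hyM)]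
    have : B * (y * y) * B * y * y = star (y * y * B) * (B * (y * y)) := by
      rw [star_mul, star_mul, hya, hB]; simp only [mul_assoc]
    rw [this, vecState_star_mul]
    refine (re_inner_le_norm (𝕜 := ℂ) _ _).trans ?_
    rw [isTracialVector_commutant T _ (mul_mem (mul_mem hyM hyM) hBM), star_mul, star_mul, hya, hB]
    change ‖B (y (y T.Ω))‖ * ‖B (y (y T.Ω))‖ ≤ _
    rw [hyy, sq]
  have e4 : (inner ℂ ((s * A * s) T.Ω) ((y * B * y) T.Ω)).re ≤
      ‖(s * A * s) T.Ω‖ * ‖(y * B * y) T.Ω‖ := re_inner_le_norm (𝕜 := ℂ) _ _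
  rw [e1]
  nlinarith [sq_nonneg (‖(s * A * s) T.Ω‖ - ‖(y * B * y) T.Ω‖)]

/-- Rounding the measurements for one question to a PVM whose opposite approximates the other
player's measurement. -/
theorem exists_isPVM_symmetric (hσ : σ.IsPositive) (hσM : σ ∈ T.M) (hσ1 : ‖σ T.Ω‖ = 1)
    {A : Type*} [Fintype A] [DecidableEq A] (a₀ : A) {E B : A → H →L[ℂ] H} (hE : IsPOVM E)
    (hEM : ∀ a, E a ∈ T.M) (hB : IsPOVM B) (hBM : ∀ a, B a ∈ T.M.commutant) {δ : ℝ}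
    (hδ : δ = 1 - ∑ a, vecState (σ T.Ω) (E a * B a)) :
    0 ≤ δ ∧ ∃ P : A → H →L[ℂ] H, IsPVM P ∧ (∀ a, P a ∈ T.M) ∧
      ∑ a, ‖(E a - P a) (σ T.Ω)‖ ^ 2 ≤ 500000000 * (√δ + δ) ∧
      ∑ a, ‖(P a - opp T (P a)) (σ T.Ω)‖ ^ 2 ≤ 500000000 * (√δ + δ) ∧
      ∑ a, ‖(B a - opp T (P a)) (σ T.Ω)‖ ^ 2 ≤ 500000000 * (√δ + δ) := by
  have hΩ := isTracialVector T
  have hσs := IsPositive.star_eq hσ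
  have hEs := IsPOVM.star_eq hE
  have hBs := IsPOVM.star_eq hB
  set ξ := σ T.Ω with hξ
  set p := ∑ a, (inner ℂ (E a ξ) (σ (E a T.Ω))).re with hp
  have hEξ : ∑ a, ‖E a ξ‖ ^ 2 ≤ 1 := by
    have := IsPOVM.sum_norm_sq_le hE ξ
    rwa [hσ1, one_pow] at this
  have hBξ : ∑ a, ‖B a ξ‖ ^ 2 ≤ 1 := by
    have := IsPOVM.sum_norm_sq_le hB ξ
    rwa [hσ1, one_pow] at this
  have hsw : ∀ x ∈ T.M, star x = x → ‖σ (x T.Ω)‖ = ‖x ξ‖ := by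
    intro x hx hxs
    have := hΩ _ (mul_mem hσM hx)
    rwa [star_mul, hσs, hxs] at this
  -- Summed over outcomes, the self-polar bound reads 2(1 - δ) ≤ p + 1.
  have hpq : 1 - p ≤ 2 * δ := by
    have h1 : 2 * ∑ a, vecState ξ (E a * B a) ≤ p + ∑ a, ‖B a ξ‖ ^ 2 := by
      rw [Finset.mul_sum, hp, ← Finset.sum_add_distrib]
      exact Finset.sum_le_sum fun a _ => re_inner_mul_le hσ hσM (hEs a) (hEM a) (hBs a) (hBM a)
    linarith
  have hp1 : p ≤ ∑ a, ‖E a ξ‖ ^ 2 := by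
    refine Finset.sum_le_sum fun a _ => ?_
    refine (re_inner_le_norm (𝕜 := ℂ) _ _).trans ?_
    rw [hsw _ (hEM a) (hEs a), sq]
  have hδ0 : 0 ≤ δ := by linarith
  refine ⟨hδ0, ?_⟩
  have hcomm : ∑ a, ‖(E a * σ - σ * E a) T.Ω‖ ^ 2 ≤ 4 * δ := by
    have h1 : ∀ a, ‖(E a * σ - σ * E a) T.Ω‖ ^ 2 =
        2 * ‖E a ξ‖ ^ 2 - 2 * (inner ℂ (E a ξ) (σ (E a T.Ω))).re := by
      intro a
      change ‖E a ξ - σ (E a T.Ω)‖ ^ 2 = _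
      rw [norm_sub_sq (𝕜 := ℂ), hsw _ (hEM a) (hEs a), RCLike.re_to_complex]
      ring
    rw [Finset.sum_congr rfl fun a _ => h1 a, Finset.sum_sub_distrib, ← Finset.mul_sum,
      ← Finset.mul_sum]
    linarith
  have hproj : ∑ a, vecState ξ (E a - E a * E a) ≤ 2 * δ := by
    rw [IsPOVM.sum_vecState_sub_mul_self hE, hσ1]
    linarith
  obtain ⟨P, hP, hPM, hEP⟩ : ∃ P : A → H →L[ℂ] H, IsPVM P ∧ (∀ a, P a ∈ T.M) ∧
      ∑ a, ‖(E a - P a) ξ‖ ^ 2 ≤ 20000000 * (√δ + δ) := by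
    -- The discretization needs η > 0. If δ = 0, separation gives exact commutation with σ and no
    -- coarsening is needed.
    rcases hδ0.eq_or_lt with h0 | h0
    · have hc : ∀ a, σ * E a = E a * σ := by
        intro a
        rw [← h0, mul_zero] at hcomm
        have h1 := (Finset.sum_eq_zero_iff_of_nonneg (fun a _ => sq_nonneg _)).1
          (le_antisymm hcomm (Finset.sum_nonneg fun a _ => sq_nonneg _)) a (Finset.mem_univ a)
        have h2 : (E a * σ - σ * E a) T.Ω = 0 := by simpa using h1
        exact (sub_eq_zero.1 (T.separating _ (sub_mem (mul_mem (hEM a) hσM)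
          (mul_mem hσM (hEM a))) h2)).symm
      obtain ⟨P, hP, hPN, hPE⟩ := (hΩ.relativeCommutant hσs hσM).exists_isPVM a₀ hE
        fun a => (mem_relativeCommutant hσs).2 ⟨hEM a, hc a⟩
      refine ⟨P, hP, fun a => ((mem_relativeCommutant hσs).1 (hPN a)).1, hPE.trans ?_⟩
      have := Real.sqrt_nonneg δ
      nlinarith
    · have hs2 := Real.sq_sqrt hδ0
      obtain ⟨P, hP, hPM, hPE⟩ := hΩ.exists_isPVM_of_almost_commute T.norm_Ω hσ hσM hσ1 a₀ hE hEM
        (η := 2 * √δ) (by positivity) (by rw [mul_pow, hs2]; linarith)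
        (by rw [mul_pow, hs2]; linarith)
      refine ⟨P, hP, hPM, hPE.trans ?_⟩
      rw [mul_pow, hs2]
      have := Real.sqrt_nonneg δ
      linarith
  have hPs := IsPOVM.star_eq hP.toIsPOVM
  have hPo : ∑ a, ‖(P a - opp T (P a)) ξ‖ ^ 2 ≤
      6 * ∑ a, ‖(E a - P a) ξ‖ ^ 2 + 12 * δ := by
    have h1 : ∀ a, ‖(P a - opp T (P a)) ξ‖ ^ 2 ≤
        3 * ‖(E a * σ - σ * E a) T.Ω‖ ^ 2 + 3 * ‖(E a - P a) ξ‖ ^ 2 + 3 * ‖(E a - P a) ξ‖ ^ 2 := by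
      intro a
      have e1 : (P a - opp T (P a)) ξ =
          (E a * σ - σ * E a) T.Ω + -((E a - P a) ξ) + σ ((E a - P a) T.Ω) := by
        change P a ξ - opp T (P a) (σ T.Ω) =
          (E a ξ - σ (E a T.Ω)) + -(E a ξ - P a ξ) + σ (E a T.Ω - P a T.Ω)
        rw [opp_apply T (hPM a) hσM, map_sub]
        abel
      have e2 := norm_add_sq_le_three ((E a * σ - σ * E a) T.Ω) (-((E a - P a) ξ))
        (σ ((E a - P a) T.Ω))
      rw [← e1, norm_neg, hsw _ (sub_mem (hEM a) (hPM a)) (by rw [star_sub, hEs, hPs])] at e2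
      exact e2
    refine (Finset.sum_le_sum fun a _ => h1 a).trans ?_
    rw [Finset.sum_add_distrib, Finset.sum_add_distrib, ← Finset.mul_sum, ← Finset.mul_sum]
    linarith
  have hBo : ∑ a, ‖(B a - opp T (P a)) ξ‖ ^ 2 ≤ 6 * δ + 3 * ∑ a, ‖(E a - P a) ξ‖ ^ 2 +
      3 * ∑ a, ‖(P a - opp T (P a)) ξ‖ ^ 2 := by
    have h0 : ∑ a, ‖(B a - E a) ξ‖ ^ 2 ≤ 2 * δ := by
      have h1 : ∀ a, ‖(B a - E a) ξ‖ ^ 2 =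
          ‖B a ξ‖ ^ 2 + ‖E a ξ‖ ^ 2 - 2 * vecState ξ (E a * B a) := by
        intro a
        change ‖B a ξ - E a ξ‖ ^ 2 = _
        rw [norm_sub_sq (𝕜 := ℂ), RCLike.re_to_complex, ← vecState_star_mul, hBs,
          (commute_of_mem_commutant (hBM a) (hEM a)).eq]
        ring
      rw [Finset.sum_congr rfl fun a _ => h1 a, Finset.sum_sub_distrib, Finset.sum_add_distrib,
        ← Finset.mul_sum]
      linarith
    have h1 : ∀ a, ‖(B a - opp T (P a)) ξ‖ ^ 2 ≤
        3 * ‖(B a - E a) ξ‖ ^ 2 + 3 * ‖(E a - P a) ξ‖ ^ 2 + 3 * ‖(P a - opp T (P a)) ξ‖ ^ 2 := by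
      intro a
      have e1 : (B a - opp T (P a)) ξ =
          (B a - E a) ξ + (E a - P a) ξ + (P a - opp T (P a)) ξ := by
        have : B a - opp T (P a) = (B a - E a) + (E a - P a) + (P a - opp T (P a)) := by abel
        exact congr($this ξ)
      rw [e1]
      exact norm_add_sq_le_three _ _ _
    refine (Finset.sum_le_sum fun a _ => h1 a).trans ?_
    rw [Finset.sum_add_distrib, Finset.sum_add_distrib, ← Finset.mul_sum, ← Finset.mul_sum,
      ← Finset.mul_sum]
    linarith
  have := Real.sqrt_nonneg δ
  exact ⟨P, hP, hPM, by linarith, by linarith, by linarith⟩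

/-! ### Comparison of correlations -/

/-- EB = √B E √B. -/
theorem vecState_mul_nonneg {E B : H →L[ℂ] H} (hE : E.IsPositive) (hB : B.IsPositive)
    (h : Commute E B) (ξ : H) : 0 ≤ vecState ξ (E * B) := by
  obtain ⟨D, hD, hDB, hDc⟩ := exists_sqrt hB
  have hs := IsPositive.star_eq hD
  have h1 := vecState_nonneg (D ξ) hE
  rw [← vecState_conj, hs, ← (hDc E h).eq, mul_assoc, hDB] at h1
  exact h1

theorem sum_vecState_mul {A A' : Type*} [Fintype A] [Fintype A'] {E : A → H →L[ℂ] H}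
    {B : A' → H →L[ℂ] H} (hE : IsPOVM E) (hB : IsPOVM B) (ξ : H) :
    ∑ a, ∑ b, vecState ξ (E a * B b) = ‖ξ‖ ^ 2 := by
  simp only [← map_sum, ← Finset.mul_sum, ← Finset.sum_mul, hE.sum_eq_one, hB.sum_eq_one, one_mul,
    vecState_one]

theorem sum_ne_vecState_mul {A : Type*} [Fintype A] [DecidableEq A] {E B : A → H →L[ℂ] H}
    (hE : IsPOVM E) (hB : IsPOVM B) (ξ : H) :
    ∑ a, ∑ b, (if a = b then 0 else vecState ξ (E a * B b)) =
      ‖ξ‖ ^ 2 - ∑ a, vecState ξ (E a * B a) := by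
  rw [← sum_vecState_mul hE hB, ← Finset.sum_sub_distrib]
  refine Finset.sum_congr rfl fun a _ => ?_
  rw [eq_sub_iff_add_eq, ← Finset.add_sum_erase _ _ (Finset.mem_univ a),
    ← Finset.add_sum_erase (a := a) _ (fun b => vecState ξ (E a * B b)) (Finset.mem_univ a),
    if_pos rfl, zero_add, add_comm]
  congr 1
  exact Finset.sum_congr rfl fun b hb => if_neg (Finset.ne_of_mem_erase hb).symm

theorem IsPVM.sum_norm_sq {A : Type*} [Fintype A] {P : A → H →L[ℂ] H} (hP : IsPVM P) (ξ : H) :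
    ∑ a, ‖P a ξ‖ ^ 2 = ‖ξ‖ ^ 2 := by
  rw [← IsPOVM.sum_vecState hP.toIsPOVM ξ]
  exact Finset.sum_congr rfl fun a _ =>
    (vecState_proj ξ ⟨hP.idempotent a, IsPOVM.star_eq hP.toIsPOVM a⟩).symm

/-- For a PVM the squared norms of the P_a ξ add up to ‖ξ‖² exactly, so expanding the square turns
synchronicity into a distance. -/
theorem IsPVM.sum_ne_vecState_mul {A : Type*} [Fintype A] [DecidableEq A] {P Q : A → H →L[ℂ] H}
    (hP : IsPVM P) (hQ : IsPVM Q) (ξ : H) :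
    ∑ a, ∑ b, (if a = b then 0 else vecState ξ (P a * Q b)) =
      1 / 2 * ∑ a, ‖(P a - Q a) ξ‖ ^ 2 := by
  rw [TracialRounding.sum_ne_vecState_mul hP.toIsPOVM hQ.toIsPOVM]
  have h1 : ∀ a, ‖(P a - Q a) ξ‖ ^ 2 =
      ‖P a ξ‖ ^ 2 + ‖Q a ξ‖ ^ 2 - 2 * vecState ξ (P a * Q a) := by
    intro a
    change ‖P a ξ - Q a ξ‖ ^ 2 = _
    rw [norm_sub_sq (𝕜 := ℂ), RCLike.re_to_complex, ← vecState_star_mul,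
      IsPOVM.star_eq hP.toIsPOVM]
    ring
  rw [Finset.sum_congr rfl fun a _ => h1 a, Finset.sum_sub_distrib, Finset.sum_add_distrib,
    IsPVM.sum_norm_sq hP, IsPVM.sum_norm_sq hQ, ← Finset.mul_sum]
  ring

/-- Replacing a POVM by a nearby PVM changes the joint outcome distribution little. -/
theorem sum_abs_vecState_sub_mul_le {A A' : Type*} [Fintype A] [Fintype A'] {E F : A → H →L[ℂ] H}
    {B : A' → H →L[ℂ] H} (hE : IsPOVM E) (hF : IsPVM F) (hB : IsPOVM B)
    (hEB : ∀ a b, Commute (E a) (B b)) (hFB : ∀ a b, Commute (F a) (B b)) {ξ : H} (hξ : ‖ξ‖ = 1) :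
    ∑ a, ∑ b, |vecState ξ ((E a - F a) * B b)| ≤ 4 * √(∑ a, ‖(E a - F a) ξ‖ ^ 2) := by
  have hEs := IsPOVM.star_eq hE
  have hFs := IsPOVM.star_eq hF.toIsPOVM
  choose D hD hDB hDc using fun b => exists_sqrt (hB.isPositive b)
  have hDs : ∀ b, star (D b) = D b := fun b => IsPositive.star_eq (hD b)
  have hDsum : ∀ x : H, ∑ b, ‖D b x‖ ^ 2 = ‖x‖ ^ 2 := by
    intro x
    rw [← IsPOVM.sum_vecState hB x]
    refine Finset.sum_congr rfl fun b _ => ?_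
    rw [← hDB b, vecState_mul_self x (hDs b)]
  set α := ∑ a, ‖(E a - F a) ξ‖ ^ 2 with hα
  have hEξ : ∑ a, ‖E a ξ‖ ^ 2 ≤ 1 := by
    have := IsPOVM.sum_norm_sq_le hE ξ
    rwa [hξ, one_pow] at this
  have hFξ : ∑ a, ‖F a ξ‖ ^ 2 = 1 := by rw [IsPVM.sum_norm_sq hF, hξ, one_pow]
  have hcs : ∀ x : A → H, ∑ a, ‖x a‖ ^ 2 ≤ 1 →
      ∑ a, ∑ b, ‖D b ((E a - F a) ξ)‖ * ‖D b (x a)‖ ≤ √α := by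
    intro x hx
    rw [← Finset.sum_product']
    refine (Real.sum_mul_le_sqrt_mul_sqrt _ _ _).trans ?_
    rw [Finset.sum_product, Finset.sum_product]
    simp only [hDsum]
    rw [← hα]
    have : √(∑ a, ‖x a‖ ^ 2) ≤ 1 := Real.sqrt_le_one.2 hx
    have := Real.sqrt_nonneg α
    nlinarith
  have hmid : ∀ b (x y : H), |(inner ℂ x (B b y)).re| ≤ ‖D b x‖ * ‖D b y‖ := by
    intro b x y
    rw [← hDB b]
    change |(inner ℂ x (D b (D b y))).re| ≤ _
    rw [← inner_selfAdjoint (hDs b)]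
    exact (Complex.abs_re_le_norm _).trans (norm_inner_le_norm _ _)
  have hterm : ∀ a b, |vecState ξ ((E a - F a) * B b)| ≤ vecState ξ ((E a - E a * E a) * B b) +
      ‖D b ((E a - F a) ξ)‖ * ‖D b (E a ξ)‖ + ‖D b ((E a - F a) ξ)‖ * ‖D b (F a ξ)‖ := by
    intro a b
    -- Idempotency of F gives (E - F)B = (E - E²)B + E B (E - F) + (E - F) B F. The first term is
    -- nonnegative in every vector state, so its absolute values sum without loss; the others carry
    -- a factor (E - F)ξ, ready for Cauchy-Schwarz.
    have e1 : (E a - F a) * B b = (E a - E a * E a) * B b + star (E a) * (B b * (E a - F a)) +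
        star (E a - F a) * (B b * F a) := by
      rw [star_sub, hEs, hFs, ← (hFB a b).eq, mul_sub (B b), ← (hEB a b).eq, ← (hFB a b).eq]
      have : F a * (F a * B b) = F a * B b := by rw [← mul_assoc, hF.idempotent]
      rw [sub_mul (E a) (F a) (F a * B b), this]
      noncomm_ring
    have e2 : 0 ≤ vecState ξ ((E a - E a * E a) * B b) :=
      vecState_mul_nonneg (isPositive_sub_mul_self (hE.isPositive a) (IsPOVM.one_sub_isPositive hE a))
        (hB.isPositive b) ((hEB a b).sub_left ((hEB a b).mul_left (hEB a b))) ξ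
    rw [e1, map_add, map_add, vecState_star_mul, vecState_star_mul]
    have e3 := hmid b (E a ξ) ((E a - F a) ξ)
    have e4 := hmid b ((E a - F a) ξ) (F a ξ)
    rw [mul_comm] at e3
    refine (abs_add_three _ _ _).trans ?_
    rw [abs_of_nonneg e2]
    exact add_le_add (add_le_add le_rfl e3) e4
  -- Summing over b leaves the defect 1 - ∑‖E_a ξ‖², and 1 equals ∑‖F_a ξ‖² because F is projective.
  have hfirst : ∑ a, ∑ b, vecState ξ ((E a - E a * E a) * B b) ≤ 2 * √α := by
    have e1 : ∑ a, ∑ b, vecState ξ ((E a - E a * E a) * B b) =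
        ∑ a, (‖F a ξ‖ ^ 2 - ‖E a ξ‖ ^ 2) := by
      rw [Finset.sum_sub_distrib, hFξ]
      have := IsPOVM.sum_vecState_sub_mul_self hE ξ
      rw [hξ, one_pow] at this
      rw [← this]
      refine Finset.sum_congr rfl fun a _ => ?_
      rw [← map_sum, ← Finset.mul_sum, hB.sum_eq_one, mul_one]
    rw [e1]
    have e2 : ∀ a, ‖F a ξ‖ ^ 2 - ‖E a ξ‖ ^ 2 ≤ ‖(E a - F a) ξ‖ * (‖E a ξ‖ + ‖F a ξ‖) := by
      intro a
      have h1 : ‖F a ξ‖ ≤ ‖E a ξ‖ + ‖(E a - F a) ξ‖ := by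
        have := norm_le_norm_add_norm_sub (E a ξ) (F a ξ)
        exact this
      nlinarith [norm_nonneg (E a ξ), norm_nonneg (F a ξ)]
    refine (Finset.sum_le_sum fun a _ => e2 a).trans ((Real.sum_mul_le_sqrt_mul_sqrt _ _ _).trans ?_)
    have e3 : ∑ a, (‖E a ξ‖ + ‖F a ξ‖) ^ 2 ≤ 2 ^ 2 := by
      have : ∀ a, (‖E a ξ‖ + ‖F a ξ‖) ^ 2 ≤ 2 * ‖E a ξ‖ ^ 2 + 2 * ‖F a ξ‖ ^ 2 := fun a => by
        nlinarith [sq_nonneg (‖E a ξ‖ - ‖F a ξ‖)]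
      refine (Finset.sum_le_sum fun a _ => this a).trans ?_
      rw [Finset.sum_add_distrib, ← Finset.mul_sum, ← Finset.mul_sum]
      linarith
    have e4 : √(∑ a, (‖E a ξ‖ + ‖F a ξ‖) ^ 2) ≤ 2 := Real.sqrt_le_iff.2 ⟨by norm_num, e3⟩
    have := Real.sqrt_nonneg α
    nlinarith
  refine (Finset.sum_le_sum fun a _ => Finset.sum_le_sum fun b _ => hterm a b).trans ?_
  simp only [Finset.sum_add_distrib]
  have h1 := hcs (fun a => E a ξ) hEξ
  have h2 := hcs (fun a => F a ξ) hFξ.le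
  linarith

/-- Hybrid argument: pass from E to P against B, then from B to Q against P. -/
theorem sum_abs_vecState_mul_sub_mul_le {A : Type*} [Fintype A] {E B P Q : A → H →L[ℂ] H}
    (hE : IsPOVM E) (hB : IsPOVM B) (hP : IsPVM P) (hQ : IsPVM Q)
    (hEB : ∀ a b, Commute (E a) (B b)) (hPB : ∀ a b, Commute (P a) (B b))
    (hPQ : ∀ a b, Commute (P a) (Q b)) {ξ : H} (hξ : ‖ξ‖ = 1) :
    ∑ a, ∑ b, |vecState ξ (E a * B b) - vecState ξ (P a * Q b)| ≤
      4 * √(∑ a, ‖(E a - P a) ξ‖ ^ 2) + 4 * √(∑ a, ‖(B a - Q a) ξ‖ ^ 2) := by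
  have h1 := sum_abs_vecState_sub_mul_le hE hP hB hEB hPB hξ
  have h2 := sum_abs_vecState_sub_mul_le hB hQ hP.toIsPOVM (fun b a => (hPB a b).symm)
    (fun b a => (hPQ a b).symm) hξ
  rw [Finset.sum_comm] at h2
  refine le_trans ?_ (add_le_add h1 h2)
  rw [← Finset.sum_add_distrib]
  refine Finset.sum_le_sum fun a _ => ?_
  rw [← Finset.sum_add_distrib]
  refine Finset.sum_le_sum fun b _ => ?_
  refine le_trans (le_of_eq ?_) (abs_add_le _ _)
  rw [← map_sub, ← map_add, sub_mul, sub_mul, (hPB a b).eq, ← (hPQ a b).eq]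
  congr 2
  abel

/-- Concavity of the square root, as Cauchy-Schwarz. -/
theorem sum_mul_sqrt_le {X : Type*} [Fintype X] {ν f : X → ℝ} (hν : ∀ x, 0 ≤ ν x)
    (hν1 : ∑ x, ν x = 1) (hf : ∀ x, 0 ≤ f x) : ∑ x, ν x * √(f x) ≤ √(∑ x, ν x * f x) := by
  have h1 : ∀ x, ν x * √(f x) = √(ν x) * √(ν x * f x) := fun x => by
    rw [Real.sqrt_mul (hν x), ← mul_assoc, Real.mul_self_sqrt (hν x)]
  rw [Finset.sum_congr rfl fun x _ => h1 x]
  refine (Real.sum_mul_le_sqrt_mul_sqrt _ _ _).trans ?_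
  rw [Finset.sum_congr rfl fun x _ => Real.sq_sqrt (hν x), hν1, Real.sqrt_one, one_mul,
    Finset.sum_congr rfl fun x _ => Real.sq_sqrt (mul_nonneg (hν x) (hf x))]

/-! ### Reduction to a positive density -/

section Reduction

variable {M : VonNeumannAlgebra H} {σ u σp : H →L[ℂ] H} (h : IsPolarDecomposition M σ u σp)
include h

theorem isStarProjection_of_isPolarDecomposition : IsStarProjection (star u * u) := by
  refine ⟨?_, ?_⟩
  · change star u * u * (star u * u) = star u * u
    rw [mul_assoc, ← mul_assoc u, h.partialIsometry]
  · change star (star u * u) = star u * u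
    rw [star_mul, star_star]

/-- `u` kills the range of 1 - u*u, so by equality of kernels `σp` does too; take adjoints. -/
theorem star_mul_mul_of_isPolarDecomposition : star u * u * σp = σp := by
  have hp := (isStarProjection_of_isPolarDecomposition h).one_sub
  have h1 : σp * (1 - star u * u) = 0 := by
    ext x
    refine (h.ker_eq _).1 ?_
    have : u * (1 - star u * u) = 0 := by
      rw [mul_sub, mul_one, ← mul_assoc, h.partialIsometry, sub_self]
    exact congr($this x)
  have h2 := congrArg star h1
  rw [star_mul, hp.isSelfAdjoint.star_eq, IsPositive.star_eq h.isPositive, star_zero, sub_mul,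
    one_mul] at h2
  exact (sub_eq_zero.1 h2).symm

/-- Compression of a POVM by the partial isometry of the polar decomposition. -/
theorem isPOVM_compress {A : Type*} [Fintype A] [DecidableEq A] (a₀ : A) {E : A → H →L[ℂ] H}
    (hE : IsPOVM E) :
    IsPOVM fun a => star u * E a * u + if a = a₀ then 1 - star u * u else 0 where
  isPositive a := by
    have h1 := (hE.isPositive a).adjoint_conj u
    rw [← ContinuousLinearMap.star_eq_adjoint] at h1
    refine ContinuousLinearMap.IsPositive.add (by rw [mul_assoc]; exact h1) ?_
    split_ifs
    · exact .of_isStarProjection (isStarProjection_of_isPolarDecomposition h).one_sub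
    · exact ContinuousLinearMap.isPositive_zero
  sum_eq_one := by
    rw [Finset.sum_add_distrib, ← Finset.sum_mul, ← Finset.mul_sum, hE.sum_eq_one, mul_one,
      Finset.sum_ite_eq', if_pos (Finset.mem_univ a₀), add_sub_cancel]

/-- The added projection is killed by `σp`, and `u` commutes with `B`, so it moves past `B` to
recombine with `σp` into `σ`. -/
theorem vecState_compress {A : Type*} [DecidableEq A] (a₀ : A) {E : A → H →L[ℂ] H}
    {B : H →L[ℂ] H} (hB : B ∈ M.commutant) (Ω : H) (a : A) :
    vecState (σp Ω) ((star u * E a * u + if a = a₀ then 1 - star u * u else 0) * B) =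
      vecState (σ Ω) (E a * B) := by
  have hσps := IsPositive.star_eq h.isPositive
  have hBu := commute_of_mem_commutant hB h.mem_partialIsometry
  have hp := star_mul_mul_of_isPolarDecomposition h
  have h0 : σp * (1 - star u * u) = 0 := by
    have h2 := congrArg star hp
    rw [star_mul, star_mul, star_star, hσps] at h2
    rw [mul_sub, mul_one, h2, sub_self]
  rw [← vecState_conj Ω σp, ← vecState_conj Ω σ, h.eq_mul, star_mul, hσps]
  congr 1
  have h1 : σp * ((star u * E a * u + if a = a₀ then 1 - star u * u else 0) * B) * σp =
      σp * star u * E a * (u * B) * σp + (if a = a₀ then σp * (1 - star u * u) else 0) * B * σp := by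
    split_ifs <;> noncomm_ring
  rw [h1, h0, ite_self, zero_mul, zero_mul, add_zero, ← hBu.eq]
  simp only [mul_assoc]

theorem norm_of_isPolarDecomposition (Ω : H) : ‖σp Ω‖ = ‖σ Ω‖ := by
  refine (sq_eq_sq₀ (norm_nonneg _) (norm_nonneg _)).1 ?_
  rw [← vecState_star_mul_self, ← vecState_star_mul_self, h.eq_mul, star_mul, mul_assoc,
    ← mul_assoc (star u), star_mul_mul_of_isPolarDecomposition h]

end Reduction

/-! ### Symmetric strategies and assembly -/

/-- The symmetric projective strategy on the state `σ Ω` given by PVMs in the algebra. -/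
noncomputable def symmetricStrategy (T : TracialStandardForm H) {X A : Type*} [Fintype A]
    {σ : H →L[ℂ] H} (hσ1 : ‖σ T.Ω‖ = 1) {P : X → A → H →L[ℂ] H} (hP : ∀ x, IsPVM (P x))
    (hM : ∀ x a, P x a ∈ T.M) : CommutingStrategy X A H where
  ψ := σ T.Ω
  norm_ψ := hσ1
  alice := P
  bob y b := opp T (P y b)
  alice_povm x := (hP x).toIsPOVM
  bob_povm y := (isPVM_opp T (hP y) (hM y)).toIsPOVM
  commute x y a b := (commute_of_mem_commutant (opp_mem T (hM y b)) (hM x a)).symm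

theorem synchronicity_symmetricStrategy (T : TracialStandardForm H) {X A : Type*} [Fintype X]
    [Fintype A] [DecidableEq A] {σ : H →L[ℂ] H} (hσ1 : ‖σ T.Ω‖ = 1) {P : X → A → H →L[ℂ] H}
    (hP : ∀ x, IsPVM (P x)) (hM : ∀ x a, P x a ∈ T.M) (ν : X → ℝ) :
    synchronicity ν (symmetricStrategy T hσ1 hP hM).corr =
      ∑ x, ν x * (1 / 2 * ∑ a, ‖(P x a - opp T (P x a)) (σ T.Ω)‖ ^ 2) :=
  Finset.sum_congr rfl fun x _ => congrArg (ν x * ·)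
    (IsPVM.sum_ne_vecState_mul (hP x) (isPVM_opp T (hP x) (hM x)) (σ T.Ω))

/-- Deterministic measurement. -/
theorem isPVM_const {A : Type*} [Fintype A] [DecidableEq A] (a₀ : A) :
    IsPVM fun a => (if a = a₀ then 1 else 0 : H →L[ℂ] H) where
  isPositive a := by
    split_ifs
    · exact ContinuousLinearMap.isPositive_one
    · exact ContinuousLinearMap.isPositive_zero
  sum_eq_one := by rw [Finset.sum_ite_eq', if_pos (Finset.mem_univ a₀)]
  idempotent a := by split_ifs <;> simp

theorem opp_zero (T : TracialStandardForm H) : opp T 0 = 0 :=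
  eq_of_forall_apply T fun s hs => by rw [opp_apply T (zero_mem _) hs]; simp

theorem sum_abs_corr_sub_corr_le_two {X A : Type*} [Fintype A] (S S' : CommutingStrategy X A H)
    (x y : X) : ∑ a, ∑ b, |S.corr x y a b - S'.corr x y a b| ≤ 2 := by
  have key : ∀ S : CommutingStrategy X A H, (∀ a b, 0 ≤ S.corr x y a b) ∧
      ∑ a, ∑ b, S.corr x y a b = 1 := by
    intro S
    refine ⟨fun a b => vecState_mul_nonneg ((S.alice_povm x).isPositive a)
      ((S.bob_povm y).isPositive b) (S.commute x y a b) S.ψ, ?_⟩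
    have := sum_vecState_mul (S.alice_povm x) (S.bob_povm y) S.ψ
    rw [S.norm_ψ, one_pow] at this
    exact this
  obtain ⟨h1, h2⟩ := key S
  obtain ⟨h3, h4⟩ := key S'
  calc ∑ a, ∑ b, |S.corr x y a b - S'.corr x y a b|
      ≤ ∑ a, ∑ b, (S.corr x y a b + S'.corr x y a b) := by
        refine Finset.sum_le_sum fun a _ => Finset.sum_le_sum fun b _ => ?_
        have := h1 a b
        have := h3 a b
        rw [abs_le]
        constructor <;> linarith
    _ = 2 := by
        simp only [Finset.sum_add_distrib]
        rw [h2, h4]; norm_num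

end TracialRounding

open TracialRounding in
theorem corollary3p6 :
    ∃ K : ℝ, ∀ (X A : Type*) [Fintype X] [Fintype A] [DecidableEq A]
      (H : Type*) [NormedAddCommGroup H] [InnerProductSpace ℂ H] [CompleteSpace H]
      (G : SynchronousGame X A) (T : TracialStandardForm H) (S : CommutingStrategy X A H)
      (σ u σp : H →L[ℂ] H) (δ : ℝ),
      S.IsTracialEmbedded T σ →
      IsPolarDecomposition T.M σ u σp →
      S.IsSynchronous G δ →
      S.IsSynchronousSnd G δ →
      ∃ S' : CommutingStrategy X A H,
        S'.IsTracialEmbedded T σp ∧ S'.IsSymmetric T ∧ S'.IsProjective ∧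
        S'.IsSynchronous G (δ ^ (1 / 4 : ℝ)) ∧
        S'.IsSynchronousSnd G (δ ^ (1 / 4 : ℝ)) ∧
        ∑ x, ∑ y, G.μ x y * ∑ a, ∑ b, |S.corr x y a b - S'.corr x y a b|
          ≤ K * δ ^ (1 / 4 : ℝ) := by
  -- Dictated by the case of large δ, where r > 1/(5·10⁸) must give 2 ≤ K r; the main case needs
  -- only 8·10⁵.
  refine ⟨1000000000, ?_⟩
  intro X A _ _ _ H _ _ _ G T S σ u σp δ hS hpol hsync hsync'
  have hσp1 : ‖σp T.Ω‖ = 1 := by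
    rw [norm_of_isPolarDecomposition hpol, ← hS.ψ_eq, S.norm_ψ]
  have hσpM := hpol.mem_positive
  -- the marginals
  have hμ1 : ∀ x, 0 ≤ G.marginalFst x := fun x => Finset.sum_nonneg fun y _ => G.μ_nonneg x y
  have hμ2 : ∀ y, 0 ≤ G.marginalSnd y := fun y => Finset.sum_nonneg fun x _ => G.μ_nonneg x y
  have hμ1s : ∑ x, G.marginalFst x = 1 := G.μ_sum
  have hμ2s : ∑ y, G.marginalSnd y = 1 := by
    rw [← G.μ_sum, Finset.sum_comm]; rfl
  obtain ⟨x₀⟩ : Nonempty X := by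
    by_contra hX
    rw [not_nonempty_iff] at hX
    have := G.μ_sum
    simp at this
  obtain ⟨a₀⟩ : Nonempty A := by
    by_contra hA
    rw [not_nonempty_iff] at hA
    have h1 := (S.alice_povm x₀).sum_eq_one
    rw [Finset.univ_eq_empty, Finset.sum_empty] at h1
    have h2 : T.Ω = 0 := congr($h1.symm T.Ω)
    have h3 := T.norm_Ω
    rw [h2, norm_zero] at h3
    exact zero_ne_one h3
  -- rounding question by question
  set E : X → A → H →L[ℂ] H := fun x a =>
    star u * S.alice x a * u + if a = a₀ then 1 - star u * u else 0 with hE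
  have hEP : ∀ x, IsPOVM (E x) := fun x => isPOVM_compress hpol a₀ (S.alice_povm x)
  have huM := hpol.mem_partialIsometry
  have hEM : ∀ x a, E x a ∈ T.M := by
    intro x a
    refine add_mem (mul_mem (mul_mem (star_mem huM) (hS.alice_mem x a)) huM) ?_
    split_ifs
    · exact sub_mem (one_mem _) (mul_mem (star_mem huM) huM)
    · exact zero_mem _
  have hcorr : ∀ x y a b, S.corr x y a b = vecState (σp T.Ω) (E x a * S.bob y b) := by
    intro x y a b
    rw [hE, vecState_compress hpol a₀ (hS.bob_mem y b) T.Ω a, ← hS.ψ_eq]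
    rfl
  set d : X → ℝ := fun x => 1 - ∑ a, vecState (σp T.Ω) (E x a * S.bob x a) with hd
  have hsyn : ∀ ν : X → ℝ, synchronicity ν S.corr = ∑ x, ν x * d x := by
    intro ν
    refine Finset.sum_congr rfl fun x _ => congrArg (ν x * ·) ?_
    have := sum_ne_vecState_mul (hEP x) (S.bob_povm x) (σp T.Ω)
    rw [hσp1, one_pow] at this
    simp only [hcorr]
    exact this
  choose hd0 P hP hPM hEP' hPo hBo using fun x =>
    exists_isPVM_symmetric hpol.isPositive hσpM hσp1 a₀ (hEP x) (hEM x) (S.bob_povm x)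
      (hS.bob_mem x) (δ := d x) rfl
  have hd1 : ∑ x, G.marginalFst x * d x ≤ δ := by rw [← hsyn]; exact hsync
  have hd2 : ∑ x, G.marginalSnd x * d x ≤ δ := by rw [← hsyn]; exact hsync'
  have hδ0 : 0 ≤ δ :=
    (Finset.sum_nonneg fun x _ => mul_nonneg (hμ1 x) (hd0 x)).trans hd1
  set r := δ ^ (1 / 4 : ℝ) with hr
  have hr0 : 0 ≤ r := Real.rpow_nonneg hδ0 _
  have hr4 : δ = r ^ 4 := by
    rw [hr, ← Real.rpow_natCast, ← Real.rpow_mul hδ0]; norm_num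
  have hr2 : √δ = r ^ 2 := by
    rw [hr4, show r ^ 4 = (r ^ 2) ^ 2 by ring, Real.sqrt_sq (sq_nonneg r)]
  -- The rounded strategy is 5·10⁸ r²-synchronous, which is at most r exactly under this smallness
  -- condition.
  rcases le_or_gt (500000000 * r) 1 with hsmall | hlarge
  · have hr1 : r ≤ 1 := by linarith
    have hrr : r ^ 4 ≤ r ^ 2 := pow_le_pow_of_le_one hr0 hr1 (by norm_num)
    have havg : ∀ ν : X → ℝ, (∀ x, 0 ≤ ν x) → ∑ x, ν x = 1 → ∑ x, ν x * d x ≤ δ →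
        ∑ x, ν x * (500000000 * (√(d x) + d x)) ≤ 1000000000 * r ^ 2 := by
      intro ν hν hν1 hνd
      have h1 := sum_mul_sqrt_le hν hν1 hd0
      have h2 := Real.sqrt_le_sqrt hνd
      rw [hr2] at h2
      have h3 : ∑ x, ν x * (500000000 * (√(d x) + d x)) =
          500000000 * (∑ x, ν x * √(d x) + ∑ x, ν x * d x) := by
        rw [← Finset.sum_add_distrib, Finset.mul_sum]
        exact Finset.sum_congr rfl fun x _ => by ring
      rw [h3]
      linarith
    have hsyn' : ∀ ν : X → ℝ, (∀ x, 0 ≤ ν x) → ∑ x, ν x = 1 → ∑ x, ν x * d x ≤ δ →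
        synchronicity ν (symmetricStrategy T hσp1 hP hPM).corr ≤ r := by
      intro ν hν hν1 hνd
      rw [synchronicity_symmetricStrategy]
      have h1 : ∑ x, ν x * (1 / 2 * ∑ a, ‖(P x a - opp T (P x a)) (σp T.Ω)‖ ^ 2) ≤
          1 / 2 * ∑ x, ν x * (500000000 * (√(d x) + d x)) := by
        rw [Finset.mul_sum]
        refine Finset.sum_le_sum fun x _ => ?_
        have := mul_le_mul_of_nonneg_left (hPo x) (hν x)
        linarith
      have h2 := havg ν hν hν1 hνd
      nlinarith
    have hsq : ∀ (ν : X → ℝ) (f : X → ℝ), (∀ x, 0 ≤ ν x) → ∑ x, ν x = 1 →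
        ∑ x, ν x * d x ≤ δ → (∀ x, 0 ≤ f x) → (∀ x, f x ≤ 500000000 * (√(d x) + d x)) →
        ∑ x, ν x * √(f x) ≤ 100000 * r := by
      intro ν f hν hν1 hνd hf0 hf
      refine (sum_mul_sqrt_le hν hν1 hf0).trans ?_
      rw [Real.sqrt_le_iff]
      refine ⟨by positivity, ?_⟩
      have h1 : ∑ x, ν x * f x ≤ ∑ x, ν x * (500000000 * (√(d x) + d x)) :=
        Finset.sum_le_sum fun x _ => mul_le_mul_of_nonneg_left (hf x) (hν x)
      have h2 := havg ν hν hν1 hνd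
      nlinarith [sq_nonneg r]
    refine ⟨symmetricStrategy T hσp1 hP hPM, ⟨hσpM, rfl, hPM, fun y b => opp_mem T (hPM y b)⟩,
      fun x a => isOpposite_opp T (hPM x a), ⟨hP, fun y => isPVM_opp T (hP y) (hPM y)⟩,
      hsyn' _ hμ1 hμ1s hd1, hsyn' _ hμ2 hμ2s hd2, ?_⟩
    have hxy : ∀ x y, ∑ a, ∑ b, |S.corr x y a b - (symmetricStrategy T hσp1 hP hPM).corr x y a b| ≤
        4 * √(∑ a, ‖(E x a - P x a) (σp T.Ω)‖ ^ 2) +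
          4 * √(∑ b, ‖(S.bob y b - opp T (P y b)) (σp T.Ω)‖ ^ 2) := by
      intro x y
      simp only [hcorr]
      exact sum_abs_vecState_mul_sub_mul_le (hEP x) (S.bob_povm y) (hP x)
        (isPVM_opp T (hP y) (hPM y))
        (fun a b => (commute_of_mem_commutant (hS.bob_mem y b) (hEM x a)).symm)
        (fun a b => (commute_of_mem_commutant (hS.bob_mem y b) (hPM x a)).symm)
        (fun a b => (commute_of_mem_commutant (opp_mem T (hPM y b)) (hPM x a)).symm) hσp1
    set α : X → ℝ := fun x => ∑ a, ‖(E x a - P x a) (σp T.Ω)‖ ^ 2 with hα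
    set β : X → ℝ := fun y => ∑ b, ‖(S.bob y b - opp T (P y b)) (σp T.Ω)‖ ^ 2 with hβ
    -- Alice's error depends only on x and Bob's only on y, so each is averaged against its own
    -- marginal; both synchronicity conditions are needed here.
    have hα1 := hsq G.marginalFst α hμ1 hμ1s hd1
      (fun x => Finset.sum_nonneg fun a _ => sq_nonneg _) hEP'
    have hβ1 := hsq G.marginalSnd β hμ2 hμ2s hd2
      (fun x => Finset.sum_nonneg fun a _ => sq_nonneg _) hBo
    have hsum : ∑ x, ∑ y, G.μ x y * (4 * √(α x) + 4 * √(β y)) =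
        4 * ∑ x, G.marginalFst x * √(α x) + 4 * ∑ y, G.marginalSnd y * √(β y) := by
      have e1 : ∑ x, ∑ y, G.μ x y * (4 * √(α x)) = 4 * ∑ x, G.marginalFst x * √(α x) := by
        rw [Finset.mul_sum]
        refine Finset.sum_congr rfl fun x _ => ?_
        rw [← Finset.sum_mul, SynchronousGame.marginalFst]; ring
      have e2 : ∑ x, ∑ y, G.μ x y * (4 * √(β y)) = 4 * ∑ y, G.marginalSnd y * √(β y) := by
        rw [Finset.sum_comm, Finset.mul_sum]
        refine Finset.sum_congr rfl fun x _ => ?_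
        rw [← Finset.sum_mul, SynchronousGame.marginalSnd]; ring
      rw [← e1, ← e2]
      simp only [mul_add, Finset.sum_add_distrib]
    calc _ ≤ ∑ x, ∑ y, G.μ x y * (4 * √(α x) + 4 * √(β y)) :=
          Finset.sum_le_sum fun x _ => Finset.sum_le_sum fun y _ =>
            mul_le_mul_of_nonneg_left (hxy x y) (G.μ_nonneg x y)
      _ ≤ 1000000000 * r := by rw [hsum]; linarith
  -- For large r, always answering `a₀` is perfectly synchronous, and two probability distributions
  -- differ by at most 2 in ℓ¹.
  · have hCP : ∀ _ : X, IsPVM fun a => (if a = a₀ then 1 else 0 : H →L[ℂ] H) :=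
      fun _ => isPVM_const a₀
    have hCM : ∀ (_ : X) a, (if a = a₀ then 1 else 0 : H →L[ℂ] H) ∈ T.M := fun _ a => by
      split_ifs
      · exact one_mem _
      · exact zero_mem _
    have hsyn' : ∀ ν : X → ℝ,
        synchronicity ν (symmetricStrategy T hσp1 hCP hCM).corr ≤ r := by
      intro ν
      rw [synchronicity_symmetricStrategy]
      refine le_trans (le_of_eq (Finset.sum_eq_zero fun x _ => ?_)) hr0
      rw [Finset.sum_eq_zero, mul_zero, mul_zero]
      intro a _
      split_ifs
      · rw [opp_one, sub_self]; simp
      · rw [opp_zero, sub_self]; simp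
    refine ⟨symmetricStrategy T hσp1 hCP hCM, ⟨hσpM, rfl, hCM, fun y b => opp_mem T (hCM y b)⟩,
      fun x a => isOpposite_opp T (hCM x a), ⟨hCP, fun y => isPVM_opp T (hCP y) (hCM y)⟩,
      hsyn' _, hsyn' _, ?_⟩
    calc _ ≤ ∑ x, ∑ y, G.μ x y * 2 :=
          Finset.sum_le_sum fun x _ => Finset.sum_le_sum fun y _ =>
            mul_le_mul_of_nonneg_left (sum_abs_corr_sub_corr_le_two S _ x y) (G.μ_nonneg x y)
      _ = 2 := by simp only [← Finset.sum_mul]; rw [G.μ_sum, one_mul]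
      _ ≤ 1000000000 * r := by linarith
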